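/- **Conventions.** $2$-categories and $2$-functors are strict, $2$-categories are small; a pseudofunctor need not be strictly unital. A $(2,1)$-category is a $2$-category whose $2$-cells are invertible. A pseudofunctor $F\colon \mathcal C\to\mathcal D$ is a *$2$-equivalence* if there are a pseudofunctor $G\colon \mathcal D\to\mathcal C$ and pseudonatural equivalences $1_{\mathcal C}\to GF$ and $FG\to 1_{\mathcal D}$. For a $2$-category $\mathcal D$, $\mathcal L\mathcal D$ is the $(2,1)$-category with the same objects, in which $(\mathcal L\mathcal D)(X,Y)$ is the category $\mathcal D(X,Y)$ with all its morphisms inverted; $\mathcal O\mathcal D$ is the category with the same objects and $(\mathcal O\mathcal D)(X,Y)=\pi_0(\mathcal D(X,Y))$. For a category $D$ and an object $x$, $\pi_1(D,x)$ is the automorphism group of $x$ in the groupoid obtained from $D$ by inverting all morphisms. A $2$-category is *connected* if it is nonempty and any two objects are joined by a finite zigzag of morphisms. Let $\mathcal C$ be a $(2,1)$-category and let $\mathcal A$, $\mathcal B$ be arrowy $2$-subcategories: $2$-subcategories containing all objects, whose categories of morphisms are full in those of $\mathcal C$. **The $2$-category $\mathcal E$.** An $(\mathcal A,\mathcal B)$-square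 $D$ consists of $j\colon X\to Y$, $i\colon Z\to W$ in $\mathcal A$ (top and bottom), $q\colon X\to Z$, $p\colon Y\to W$ in $\mathcal B$ (left and right), and a $2$-cell $iq\Rightarrow pj$. Objects of $\mathcal C$, morphisms of $\mathcal A$ (horizontal), morphisms of $\mathcal B$ (vertical) and such squares form a double category $Q_{\mathcal A,\mathcal B}\mathcal C$. Let $T Q_{\mathcal A,\mathcal B}\mathcal C$ be the $2$-category whose objects are those of $\mathcal C$, whose morphisms are finite paths of horizontal and vertical morphisms (composition $*$ is concatenation), and whose $2$-cells are generated under composition and concatenation by: insertion $\iota\colon \emptyset\Rightarrow 1_X$ and deletion $\theta\colon 1_X\Rightarrow\emptyset$ of a horizontal or vertical identity; $\gamma\colon h'*h\Rightarrow h'h$ and $\delta\colon h'h\Rightarrow h'*h$ for composable $h,h'$ of the same direction; $\sigma_D\colon i*q\Rightarrow p*j$ for every square $D$; subject to the axioms of a $2$-category and the relations: $\iota,\theta$ are mutually inverse; $\gamma,\delta$ are mutually inverse; inserting an identity before or after an edge $f$ is the decomposition $\delta$ of $f=f1=1f$; $\gamma$ is associative; $\sigma$ of the identity square of a horizontal (resp.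 vertical) edge $f$ takes the insertion of a vertical (resp. horizontal) identity at the source end (resp. target end) of $f$ to the insertion at the other end; and, up to $\gamma$, $\sigma$ of a horizontal or vertical pasting of two squares is the composite of the $\sigma$'s of these squares. Put $\mathcal E=\mathcal L T Q_{\mathcal A,\mathcal B}\mathcal C$. The $2$-functor $E\colon\mathcal E\to\mathcal C$ is the identity on objects, sends a path to its composite, $\sigma_D$ to the $2$-cell of $D$, and $\iota,\theta,\gamma,\delta$ to identities. **Compactifications of a morphism.** A compactification of $f\colon X\to Y$ is $(Z,i,p,\alpha)$ with $i\colon X\to Z$ in $\mathcal A$, $p\colon Z\to Y$ in $\mathcal B$ and a $2$-cell $\alpha\colon pi\Rightarrow f$. They are the objects of a $2$-category $\mathrm{Comp}^{\mathcal B}(f)$. A morphism $(Z,i,p,\alpha)\to(W,j,q,\beta)$ is $(r,\gamma,\delta)$ with $r\colon Z\to W$ in $\mathcal B$, $\gamma\colon ri\Rightarrow j$, $\delta\colon qr\Rightarrow p$ such that $\alpha\circ(\delta i)=\beta\circ(q\gamma)\colon qri\Rightarrow f$; a $2$-cell $(r,\gamma,\delta)\Rightarrow(r',\gamma',\delta')$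 is a $2$-cell $\epsilon\colon r\Rightarrow r'$ with $\gamma=\gamma'\circ(\epsilon i)$ and $\delta=\delta'\circ(q\epsilon)$. Associating to $(r,\gamma,\delta)$ the inverse in $\mathcal E(X,Y)$ of the composite $$q*j\Rightarrow q*j*1_X\Rightarrow q*r*i\Rightarrow qr*i\Rightarrow p*i$$ defines a functor $G_f\colon \mathcal O\,\mathrm{Comp}^{\mathcal B}(f)\to\mathcal E(X,Y)$, $(Z,i,p,\alpha)\mapsto p*i$. Here the first $2$-cell inserts the vertical identity of $X$; the second is $\sigma$ of the square with top $i$, left $1_X$, right $r$, bottom $j$ and $2$-cell $\gamma^{-1}$; the third is composition of $q$ and $r$; the last is the composite $qr\Rightarrow 1_Y*qr\Rightarrow p*1_Z\Rightarrow p$ of an insertion of the horizontal identity of $Y$, $\sigma$ of the square with horizontal edges the identities of $Z$ and $Y$, left edge $qr$, right edge $p$ and $2$-cell $\delta$, and a deletion of the horizontal identity of $Z$. **Compactifications of a composable pair.** Let $\Delta_2=\{(k,l)\in\{0,1,2\}^2 : k\ge l\}$, a partially ordered set. For $X\xrightarrow{f}Y\xrightarrow{g}Z$, the objects of $\mathrm{Comp}^{\mathcal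 B}(g,f)$ are the strictly unital pseudofunctors $F\colon\Delta_2\to\mathcal C$ that restrict on the diagonal to the $2$-functor $\{0<1<2\}\to\mathcal C$ given by $(g,f)$, with $F((k,l)\to(k',l))$ in $\mathcal A$ and $F((k',l)\to(k',l'))$ in $\mathcal B$ for all elements of $\Delta_2$; its morphisms are the pseudonatural transformations with components in $\mathcal B$ that restrict to the identity on the diagonal, and its $2$-cells are the modifications that restrict to the identity on the diagonal. **Theorem.** Assume: 1. every morphism $f\colon X\to Y$ of $\mathcal C$ has a compactification $\kappa=(Z,i,p,\alpha)$ such that the homomorphism $\pi_1(\mathcal O\,\mathrm{Comp}^{\mathcal B}(f),\kappa)\to\pi_1(\mathcal E(X,Y),p*i)$ induced by $G_f$ has trivial image; 2. for every pair of composable morphisms $X\xrightarrow{f}Y\xrightarrow{g}Z$ of $\mathcal C$, the $2$-category $\mathrm{Comp}^{\mathcal B}(g,f)$ is connected. Then the $2$-functor $E\colon\mathcal E\to\mathcal C$ is a $2$-equivalence. -/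

import Mathlib

open CategoryTheory Bicategory

universe w v u

namespace Gluing

/-! ### Arrowy 2-subcategories -/

/-- An arrowy `2`-subcategory of `C`: it contains all objects of `C`, and its categories of
morphisms are full subcategories of those of `C`. Such a subcategory is determined by its set of
morphisms, which has to contain the identities and to be stable under composition. -/
structure Arrowy (C : Type u) [Bicategory.{w, v} C] where
  /-- the morphisms of the subcategory -/
  mem : ∀ {X Y : C}, (X ⟶ Y) → Prop
  id_mem : ∀ X : C, mem (𝟙 X)
  comp_mem : ∀ {X Y Z : C} (f : X ⟶ Y) (g : Y ⟶ Z), mem f → mem g → mem (f ≫ g)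

variable {C : Type u} [Bicategory.{w, v} C]

/-- The morphisms from `X` to `Y` of an arrowy `2`-subcategory. -/
@[ext]
structure Arrowy.Mor (A : Arrowy C) (X Y : C) where
  /-- the underlying morphism of `C` -/
  val : X ⟶ Y
  mem : A.mem val

/-- The identity of `X`, as a morphism of `A`. -/
@[simps]
abbrev Arrowy.one (A : Arrowy C) (X : C) : A.Mor X X := ⟨𝟙 X, A.id_mem X⟩

/-- Composition in `A`. -/
@[simps]
abbrev Arrowy.Mor.comp {A : Arrowy C} {X Y Z : C} (f : A.Mor X Y) (g : A.Mor Y Z) : A.Mor X Z :=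
  ⟨f.val ≫ g.val, A.comp_mem _ _ f.mem g.mem⟩

/-! ### The double category of `(A, B)`-squares -/

/-- A square with horizontal morphisms `j`, `i` in `A`, vertical morphisms `q`, `p` in `B`
and a `2`-cell `i ∘ q ⇒ p ∘ j`. The top edge is `j : X ⟶ Y`, the left edge is `q : X ⟶ Z`, the right
edge is `p : Y ⟶ W`, the bottom edge is `i : Z ⟶ W`.
These are the squares of the double category of `(A, B)`-squares in `C`; its horizontal
(vertical) morphisms are the morphisms of `A` (of `B`). -/
structure Sq (A B : Arrowy C) {X Y Z W : C} (j : A.Mor X Y) (q : B.Mor X Z) (p : B.Mor Y W)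
    (i : A.Mor Z W) where
  /-- the `2`-cell of the square -/
  cell : q.val ≫ i.val ⟶ j.val ≫ p.val

namespace Sq

variable {A B : Arrowy C}

/-- The identity square on a horizontal morphism: the two vertical edges are identities. -/
def idHor {X Y : C} (f : A.Mor X Y) : Sq A B f (B.one X) (B.one Y) f :=
  ⟨(λ_ f.val).hom ≫ (ρ_ f.val).inv⟩

/-- The identity square on a vertical morphism: the two horizontal edges are identities. -/
def idVer {X Y : C} (f : B.Mor X Y) : Sq A B (A.one X) f f (A.one Y) :=
  ⟨(ρ_ f.val).hom ≫ (λ_ f.val).inv⟩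

/-- Horizontal pasting of squares, `D` on the left and `D'` on the right. -/
def hcomp {X₁ X₂ X₃ Y₁ Y₂ Y₃ : C} {j : A.Mor X₁ X₂} {j' : A.Mor X₂ X₃} {i : A.Mor Y₁ Y₂}
    {i' : A.Mor Y₂ Y₃} {p₁ : B.Mor X₁ Y₁} {p₂ : B.Mor X₂ Y₂} {p₃ : B.Mor X₃ Y₃}
    (D : Sq A B j p₁ p₂ i) (D' : Sq A B j' p₂ p₃ i') :
    Sq A B (j.comp j') p₁ p₃ (i.comp i') :=
  ⟨(α_ p₁.val i.val i'.val).inv ≫ D.cell ▷ i'.val ≫ (α_ j.val p₂.val i'.val).hom ≫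
    j.val ◁ D'.cell ≫ (α_ j.val j'.val p₃.val).inv⟩

/-- Vertical pasting of squares, `D` on top of `D'`. -/
def vcomp {X₁ X₂ X₃ Y₁ Y₂ Y₃ : C} {i₁ : A.Mor X₁ Y₁} {i₂ : A.Mor X₂ Y₂} {i₃ : A.Mor X₃ Y₃}
    {q : B.Mor X₁ X₂} {q' : B.Mor X₂ X₃} {p : B.Mor Y₁ Y₂} {p' : B.Mor Y₂ Y₃}
    (D : Sq A B i₁ q p i₂) (D' : Sq A B i₂ q' p' i₃) :
    Sq A B i₁ (q.comp q') (p.comp p') i₃ :=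
  ⟨(α_ q.val q'.val i₃.val).hom ≫ q.val ◁ D'.cell ≫ (α_ q.val i₂.val p'.val).inv ≫
    D.cell ▷ p'.val ≫ (α_ i₁.val p.val p'.val).hom⟩

end Sq

/-! ### The `2`-category generated by the double category of `(A, B)`-squares -/

/-- The two directions of a double category. -/
inductive Dir
  | hor
  | ver

/-- The subcategory of the morphisms in a given direction. -/
abbrev side (A B : Arrowy C) : Dir → Arrowy C
  | .hor => A
  | .ver => B

/-- A morphism of `A` or of `B`, with its direction. -/
abbrev Edge (A B : Arrowy C) (X Y : C) := Σ k : Dir, (side A B k).Mor X Y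

/-- A morphism of `A`, as a horizontal edge. -/
abbrev hor {A : Arrowy C} (B : Arrowy C) {X Y : C} (f : A.Mor X Y) : Edge A B X Y := ⟨.hor, f⟩

/-- A morphism of `B`, as a vertical edge. -/
abbrev ver (A : Arrowy C) {B : Arrowy C} {X Y : C} (f : B.Mor X Y) : Edge A B X Y := ⟨.ver, f⟩

/-- Paths of edges. -/
inductive TPath (A B : Arrowy C) : C → C → Type (max u v)
  | nil (X : C) : TPath A B X X
  | cons {X Y Z : C} (p : TPath A B X Y) (e : Edge A B Y Z) : TPath A B X Z

variable {A B : Arrowy C}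

namespace TPath

/-- The path consisting of one edge. -/
abbrev single {X Y : C} (e : Edge A B X Y) : TPath A B X Y := (nil X).cons e

/-- Concatenation of paths, first `p` and then `q`. -/
def comp {X Y Z : C} (p : TPath A B X Y) : TPath A B Y Z → TPath A B X Z
  | nil _ => p
  | cons q e => (p.comp q).cons e

theorem comp_nil {X Y : C} (p : TPath A B X Y) : p.comp (nil Y) = p := rfl

theorem nil_comp {X Y : C} (p : TPath A B X Y) : (nil X).comp p = p := by
  induction p with
  | nil => rfl
  | cons p e ih => exact congrArg (fun t => cons t e) ih

theorem comp_assoc {X Y Z W : C} (p : TPath A B X Y) (q : TPath A B Y Z) (r : TPath A B Z W) :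
    (p.comp q).comp r = p.comp (q.comp r) := by
  induction r with
  | nil => rfl
  | cons r e ih => exact congrArg (fun t => cons t e) ih

end TPath

open TPath

/-- The atomic transformations, without their context: insertion `iota` and deletion `theta` of an
identity edge, composition `gamma` and decomposition `delta` of two consecutive edges in the same
direction, and the transformation `sigma D` from the path "left, bottom" to the path
"top, right" of a square `D`. -/
inductive Gen (A B : Arrowy C) : ∀ {X Y : C}, TPath A B X Y → TPath A B X Y → Type (max u v w)
  | iota (k : Dir) (X : C) : Gen A B (nil X) (single ⟨k, (side A B k).one X⟩)
  | theta (k : Dir) (X : C) : Gen A B (single ⟨k, (side A B k).one X⟩) (nil X)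
  | gamma {k : Dir} {X Y Z : C} (h : (side A B k).Mor X Y) (h' : (side A B k).Mor Y Z)
      (h'' : (side A B k).Mor X Z) (e : h.comp h' = h'') :
      Gen A B ((single ⟨k, h⟩).cons ⟨k, h'⟩) (single ⟨k, h''⟩)
  | delta {k : Dir} {X Y Z : C} (h : (side A B k).Mor X Y) (h' : (side A B k).Mor Y Z)
      (h'' : (side A B k).Mor X Z) (e : h.comp h' = h'') :
      Gen A B (single ⟨k, h''⟩) ((single ⟨k, h⟩).cons ⟨k, h'⟩)
  | sigma {X Y Z W : C} {j : A.Mor X Y} {q : B.Mor X Z} {p : B.Mor Y W} {i : A.Mor Z W}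
      (D : Sq A B j q p i) :
      Gen A B ((single (ver A q)).cons (hor B i)) ((single (hor B j)).cons (ver A p))

/-- An atomic transformation `s ⇒ t`, placed between an initial path `f` and a final path `g`. -/
structure Atom {X Y : C} (a b : TPath A B X Y) where
  /-- source of the part that is changed -/
  {Z : C}
  /-- target of the part that is changed -/
  {W : C}
  /-- the initial path -/
  f : TPath A B X Z
  /-- the part that is changed -/
  {s : TPath A B Z W}
  /-- the part after the change -/
  {t : TPath A B Z W}
  /-- the change -/
  gen : Gen A B s t
  /-- the final path -/
  g : TPath A B W Y
  source_eq : a = f.comp (s.comp g)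
  target_eq : b = f.comp (t.comp g)

/-- A transformation is a finite sequence of atomic transformations. -/
inductive Trans {X Y : C} (a : TPath A B X Y) : TPath A B X Y → Type (max u v w)
  | refl : Trans a a
  | tail {b c : TPath A B X Y} (t : Trans a b) (x : Atom b c) : Trans a c

namespace Trans

/-- The transformation consisting of one atomic transformation. -/
def of {X Y : C} {a b : TPath A B X Y} (x : Gen A B a b) : Trans a b :=
  refl.tail ⟨nil X, x, nil Y, (nil_comp _).symm, (nil_comp _).symm⟩

/-- Composition of transformations, first `s` and then `t`. -/
def trans {X Y : C} {a b c : TPath A B X Y} (s : Trans a b) : Trans b c → Trans a c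
  | refl => s
  | tail t x => (s.trans t).tail x

/-- Concatenation of a transformation with an initial path. -/
def whiskerL {X Y Z : C} (h : TPath A B X Y) {a b : TPath A B Y Z} :
    Trans a b → Trans (h.comp a) (h.comp b)
  | refl => refl
  | tail t x => (t.whiskerL h).tail
      ⟨h.comp x.f, x.gen, x.g, by rw [comp_assoc, ← x.source_eq], by rw [comp_assoc, ← x.target_eq]⟩

/-- Concatenation of a transformation with a final path. -/
def whiskerR {X Y Z : C} {a b : TPath A B X Y} (h : TPath A B Y Z) :
    Trans a b → Trans (a.comp h) (b.comp h)
  | refl => refl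
  | tail t x => (t.whiskerR h).tail
      ⟨x.f, x.gen, x.g.comp h, by rw [← comp_assoc x.s, ← comp_assoc x.f, ← x.source_eq],
        by rw [← comp_assoc x.t, ← comp_assoc x.f, ← x.target_eq]⟩

end Trans

open Gen

/-- The finest system of equivalence relations on transformations that is stable under composition
and concatenation and satisfies the listed relations. -/
inductive Rel : ∀ {X Y : C} {a b : TPath A B X Y}, Trans a b → Trans a b → Prop
  | refl {X Y : C} {a b : TPath A B X Y} (s : Trans a b) : Rel s s
  | symm {X Y : C} {a b : TPath A B X Y} {s t : Trans a b} : Rel s t → Rel t s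
  | trans {X Y : C} {a b : TPath A B X Y} {s t r : Trans a b} : Rel s t → Rel t r → Rel s r
  -- stability under composition
  | comp {X Y : C} {a a' b' b : TPath A B X Y} (x : Trans a a') {s t : Trans a' b'}
      (y : Trans b' b) : Rel s t → Rel ((x.trans s).trans y) ((x.trans t).trans y)
  -- stability under concatenation
  | whiskerL {X Y Z : C} (h : TPath A B X Y) {a b : TPath A B Y Z} {s t : Trans a b} :
      Rel s t → Rel (s.whiskerL h) (t.whiskerL h)
  | whiskerR {X Y Z : C} {a b : TPath A B X Y} {s t : Trans a b} (h : TPath A B Y Z) :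
      Rel s t → Rel (s.whiskerR h) (t.whiskerR h)
  -- compatibility with concatenation
  | exchange {X Y Z : C} {a a' : TPath A B X Y} {b b' : TPath A B Y Z} (s : Trans a a')
      (t : Trans b b') :
      Rel ((t.whiskerL a).trans (s.whiskerR b')) ((s.whiskerR b).trans (t.whiskerL a'))
  -- `iota` and `theta` are inverse to each other
  | iota_theta (k : Dir) (X : C) :
      Rel ((Trans.of (iota (A := A) (B := B) k X)).trans (Trans.of (theta k X))) .refl
  | theta_iota (k : Dir) (X : C) :
      Rel ((Trans.of (theta (A := A) (B := B) k X)).trans (Trans.of (iota k X))) .refl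
  -- the insertion of an identity before or after an edge is a decomposition of that edge
  | iota_delta {k : Dir} {X Y : C} (f : (side A B k).Mor X Y)
      (e : ((side A B k).one X).comp f = f) :
      Rel ((Trans.of (iota k X)).whiskerR (single ⟨k, f⟩)) (Trans.of (delta _ _ f e))
  | delta_iota {k : Dir} {X Y : C} (f : (side A B k).Mor X Y)
      (e : f.comp ((side A B k).one Y) = f) :
      Rel ((Trans.of (iota k Y)).whiskerL (single ⟨k, f⟩)) (Trans.of (delta _ _ f e))
  -- `gamma` and `delta` are inverse to each other
  | gamma_delta {k : Dir} {X Y Z : C} (f : (side A B k).Mor X Y) (g : (side A B k).Mor Y Z) :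
      Rel ((Trans.of (gamma f g _ rfl)).trans (Trans.of (delta f g _ rfl))) .refl
  | delta_gamma {k : Dir} {X Y Z : C} (f : (side A B k).Mor X Y) (g : (side A B k).Mor Y Z) :
      Rel ((Trans.of (delta f g _ rfl)).trans (Trans.of (gamma f g _ rfl))) .refl
  -- associativity of `gamma`
  | gamma_gamma {k : Dir} {X Y Z W : C} (f : (side A B k).Mor X Y) (g : (side A B k).Mor Y Z)
      (h : (side A B k).Mor Z W) (e : (f.comp g).comp h = f.comp (g.comp h)) :
      Rel (((Trans.of (gamma f g _ rfl)).whiskerR (single ⟨k, h⟩)).trans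
          (Trans.of (gamma (f.comp g) h _ e)))
        (((Trans.of (gamma g h _ rfl)).whiskerL (single ⟨k, f⟩)).trans
          (Trans.of (gamma f (g.comp h) _ rfl)))
  -- identity squares
  | sigma_idHor {X Y : C} (f : A.Mor X Y) :
      Rel (((Trans.of (iota .ver X)).whiskerR (single (hor B f))).trans
          (Trans.of (sigma (Sq.idHor f))))
        ((Trans.of (iota .ver Y)).whiskerL (single (hor B f)))
  | sigma_idVer {X Y : C} (f : B.Mor X Y) :
      Rel (((Trans.of (iota .hor Y)).whiskerL (single (ver A f))).trans
          (Trans.of (sigma (Sq.idVer f))))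
        ((Trans.of (iota .hor X)).whiskerR (single (ver A f)))
  -- pasting of squares
  | sigma_hcomp {X₁ X₂ X₃ Y₁ Y₂ Y₃ : C} {j : A.Mor X₁ X₂} {j' : A.Mor X₂ X₃} {i : A.Mor Y₁ Y₂}
      {i' : A.Mor Y₂ Y₃} {p₁ : B.Mor X₁ Y₁} {p₂ : B.Mor X₂ Y₂} {p₃ : B.Mor X₃ Y₃}
      (D : Sq A B j p₁ p₂ i) (D' : Sq A B j' p₂ p₃ i') :
      Rel ((((Trans.of (sigma D)).whiskerR (single (hor B i'))).trans
          ((Trans.of (sigma D')).whiskerL (single (hor B j)))).trans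
          ((Trans.of (gamma (k := .hor) j j' _ rfl)).whiskerR (single (ver A p₃))))
        (((Trans.of (gamma (k := .hor) i i' _ rfl)).whiskerL (single (ver A p₁))).trans
          (Trans.of (sigma (D.hcomp D'))))
  | sigma_vcomp {X₁ X₂ X₃ Y₁ Y₂ Y₃ : C} {i₁ : A.Mor X₁ Y₁} {i₂ : A.Mor X₂ Y₂} {i₃ : A.Mor X₃ Y₃}
      {q : B.Mor X₁ X₂} {q' : B.Mor X₂ X₃} {p : B.Mor Y₁ Y₂} {p' : B.Mor Y₂ Y₃}
      (D : Sq A B i₁ q p i₂) (D' : Sq A B i₂ q' p' i₃) :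
      Rel ((((Trans.of (sigma D')).whiskerL (single (ver A q))).trans
          ((Trans.of (sigma D)).whiskerR (single (ver A p')))).trans
          ((Trans.of (gamma (k := .ver) p p' _ rfl)).whiskerL (single (hor B i₁))))
        (((Trans.of (gamma (k := .ver) q q' _ rfl)).whiskerR (single (hor B i₃))).trans
          (Trans.of (sigma (D.vcomp D'))))

/-- The equivalence relation `Rel`, bundled. -/
instance cellSetoid {X Y : C} (a b : TPath A B X Y) : Setoid (Trans a b) :=
  ⟨Rel, ⟨Rel.refl, Rel.symm, Rel.trans⟩⟩

/-- A `2`-cell is an equivalence class of transformations. -/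
def Cell {X Y : C} (a b : TPath A B X Y) := Quotient (cellSetoid a b)

namespace Trans

/-- The class of a transformation. -/
def toCell {X Y : C} {a b : TPath A B X Y} (s : Trans a b) : Cell a b := Quotient.mk _ s

theorem refl_trans {X Y : C} {a b : TPath A B X Y} (s : Trans a b) : refl.trans s = s := by
  induction s with
  | refl => rfl
  | tail t x ih => exact congrArg (fun s => tail s x) ih

theorem trans_assoc {X Y : C} {a b c d : TPath A B X Y} (s : Trans a b) (t : Trans b c)
    (r : Trans c d) : (s.trans t).trans r = s.trans (t.trans r) := by
  induction r with
  | refl => rfl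
  | tail r x ih => exact congrArg (fun s => tail s x) ih

theorem whiskerL_trans {X Y Z : C} (h : TPath A B X Y) {a b c : TPath A B Y Z} (s : Trans a b)
    (t : Trans b c) : (s.trans t).whiskerL h = (s.whiskerL h).trans (t.whiskerL h) := by
  induction t with
  | refl => rfl
  | tail r x ih => exact congrArg (fun s => tail s _) ih

theorem whiskerR_trans {X Y Z : C} (h : TPath A B Y Z) {a b c : TPath A B X Y} (s : Trans a b)
    (t : Trans b c) : (s.trans t).whiskerR h = (s.whiskerR h).trans (t.whiskerR h) := by
  induction t with
  | refl => rfl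
  | tail r x ih => exact congrArg (fun s => tail s _) ih

end Trans

instance cellCategory (X Y : C) : Category (TPath A B X Y) where
  Hom a b := Cell a b
  id a := (Trans.refl : Trans a a).toCell
  comp {a b c} := Quotient.map₂ Trans.trans fun s s' hs t t' ht => by
    have h1 := Rel.comp s (Trans.refl : Trans c c) ht
    have h2 := Rel.comp (Trans.refl : Trans a a) t' hs
    rw [Trans.refl_trans, Trans.refl_trans] at h2
    exact h1.trans h2
  id_comp := by
    rintro a b ⟨s⟩
    exact congrArg Trans.toCell s.refl_trans
  comp_id := by
    rintro a b ⟨s⟩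
    rfl
  assoc := by
    rintro a b c d ⟨s⟩ ⟨t⟩ ⟨r⟩
    exact congrArg Trans.toCell (s.trans_assoc t r)

/-- The class of a transformation, as a morphism of the category of paths. -/
abbrev Trans.toHom {X Y : C} {a b : TPath A B X Y} (s : Trans a b) : a ⟶ b := s.toCell

theorem toHom_trans {X Y : C} {a b c : TPath A B X Y} (s : Trans a b) (t : Trans b c) :
    (s.trans t).toHom = s.toHom ≫ t.toHom := rfl

theorem toHom_tail {X Y : C} {a b c : TPath A B X Y} (s : Trans a b) (x : Atom b c) :
    (s.tail x).toHom = s.toHom ≫ (Trans.refl.tail x).toHom := rfl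

/-- Concatenation of a `2`-cell with an initial path. -/
def cellL {X Y Z : C} (h : TPath A B X Y) {a b : TPath A B Y Z} (s : a ⟶ b) :
    h.comp a ⟶ h.comp b :=
  Quotient.map (Trans.whiskerL h) (fun _ _ r => Rel.whiskerL h r) s

/-- Concatenation of a `2`-cell with a final path. -/
def cellR {X Y Z : C} {a b : TPath A B X Y} (s : a ⟶ b) (h : TPath A B Y Z) :
    a.comp h ⟶ b.comp h :=
  Quotient.map (Trans.whiskerR h) (fun _ _ r => Rel.whiskerR h r) s

theorem cellL_id {X Y Z : C} (h : TPath A B X Y) (a : TPath A B Y Z) :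
    cellL h (𝟙 a) = 𝟙 (h.comp a) := rfl

theorem cellR_id {X Y Z : C} (a : TPath A B X Y) (h : TPath A B Y Z) :
    cellR (𝟙 a) h = 𝟙 (a.comp h) := rfl

theorem cellL_comp {X Y Z : C} (h : TPath A B X Y) {a b c : TPath A B Y Z} (s : a ⟶ b)
    (t : b ⟶ c) : cellL h (s ≫ t) = cellL h s ≫ cellL h t := by
  obtain ⟨s⟩ := s
  obtain ⟨t⟩ := t
  exact congrArg Trans.toCell (s.whiskerL_trans h t)

theorem cellR_comp {X Y Z : C} {a b c : TPath A B X Y} (s : a ⟶ b) (t : b ⟶ c)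
    (h : TPath A B Y Z) : cellR (s ≫ t) h = cellR s h ≫ cellR t h := by
  obtain ⟨s⟩ := s
  obtain ⟨t⟩ := t
  exact congrArg Trans.toCell (s.whiskerR_trans h t)

theorem cellL_eqToHom {X Y Z : C} (h : TPath A B X Y) {a b : TPath A B Y Z} (e : a = b) :
    cellL h (eqToHom e) = eqToHom (congrArg h.comp e) := by
  subst e
  rfl

theorem cellR_eqToHom {X Y Z : C} {a b : TPath A B X Y} (e : a = b) (h : TPath A B Y Z) :
    cellR (eqToHom e) h = eqToHom (congrArg (fun t => t.comp h) e) := by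
  subst e
  rfl

/-- An atomic transformation depends on its context only. -/
theorem atom_congr {X Y Z W : C} {s t : TPath A B Z W} (x : Gen A B s t)
    {f f' : TPath A B X Z} {g g' : TPath A B W Y} {a a' b b' : TPath A B X Y}
    (ha : a = f.comp (s.comp g)) (hb : b = f.comp (t.comp g))
    (ha' : a' = f'.comp (s.comp g')) (hb' : b' = f'.comp (t.comp g'))
    (hf : f = f') (hg : g = g') (ea : a = a') (eb : b' = b) :
    (Trans.refl.tail ⟨f, x, g, ha, hb⟩).toHom =
      eqToHom ea ≫ (Trans.refl.tail ⟨f', x, g', ha', hb'⟩).toHom ≫ eqToHom eb := by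
  subst hf hg ea eb
  simp

theorem cellL_nil {X Y : C} {a b : TPath A B X Y} (s : a ⟶ b) :
    cellL (nil X) s = eqToHom (nil_comp a) ≫ s ≫ eqToHom (nil_comp b).symm := by
  revert s
  refine Quotient.ind fun s => ?_
  change (s.whiskerL _).toHom = _ ≫ s.toHom ≫ _
  induction s with
  | refl => exact (by simp : 𝟙 _ = eqToHom (nil_comp a) ≫ 𝟙 a ≫ eqToHom (nil_comp a).symm)
  | tail t x ih =>
    rw [toHom_tail, Trans.whiskerL, toHom_tail, ih,
      atom_congr x.gen _ _ x.source_eq x.target_eq (nil_comp x.f) rfl (nil_comp _)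
        (nil_comp _).symm]
    simp

theorem cellL_cellL {X Y Z W : C} (h : TPath A B X Y) (h' : TPath A B Y Z)
    {a b : TPath A B Z W} (s : a ⟶ b) :
    cellL (h.comp h') s =
      eqToHom (comp_assoc h h' a) ≫ cellL h (cellL h' s) ≫ eqToHom (comp_assoc h h' b).symm := by
  revert s
  refine Quotient.ind fun s => ?_
  change (s.whiskerL _).toHom = _ ≫ ((s.whiskerL h').whiskerL h).toHom ≫ _
  induction s with
  | refl =>
    exact (by simp : 𝟙 _ = eqToHom (comp_assoc h h' a) ≫ 𝟙 _ ≫ eqToHom (comp_assoc h h' a).symm)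
  | tail t x ih =>
    simp only [Trans.whiskerL]
    rw [toHom_tail, toHom_tail (Trans.whiskerL h (Trans.whiskerL h' t)), ih,
      atom_congr x.gen _ _ _ _ (comp_assoc h h' x.f) rfl (comp_assoc _ _ _)
        (comp_assoc _ _ _).symm]
    · simp
    · simp only [comp_assoc, ← x.source_eq]
    · simp only [comp_assoc, ← x.target_eq]

theorem cellR_nil {X Y : C} {a b : TPath A B X Y} (s : a ⟶ b) : cellR s (nil Y) = s := by
  revert s
  refine Quotient.ind fun s => ?_
  change (s.whiskerR (nil Y)).toHom = s.toHom
  induction s with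
  | refl => rfl
  | tail t x ih =>
    simp only [Trans.whiskerR]
    rw [toHom_tail, ih]
    rfl

theorem cellR_cellR {X Y Z W : C} {a b : TPath A B X Y} (s : a ⟶ b) (h : TPath A B Y Z)
    (h' : TPath A B Z W) :
    cellR s (h.comp h') =
      eqToHom (comp_assoc a h h').symm ≫ cellR (cellR s h) h' ≫ eqToHom (comp_assoc b h h') := by
  revert s
  refine Quotient.ind fun s => ?_
  change (s.whiskerR _).toHom = _ ≫ ((s.whiskerR h).whiskerR h').toHom ≫ _
  induction s with
  | refl =>
    exact (by simp : 𝟙 _ = eqToHom (comp_assoc a h h').symm ≫ 𝟙 _ ≫ eqToHom (comp_assoc a h h'))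
  | tail t x ih =>
    simp only [Trans.whiskerR]
    rw [toHom_tail, toHom_tail (Trans.whiskerR h' (Trans.whiskerR h t)), ih,
      atom_congr x.gen _ _ _ _ rfl (comp_assoc x.g h h').symm (comp_assoc _ _ _).symm
        (comp_assoc _ _ _)]
    · simp
    · simp only [← comp_assoc, x.source_eq]
    · simp only [← comp_assoc, x.target_eq]

theorem cellR_cellL {X Y Z W : C} (h : TPath A B X Y) {a b : TPath A B Y Z} (s : a ⟶ b)
    (h' : TPath A B Z W) :
    cellR (cellL h s) h' =
      eqToHom (comp_assoc h a h') ≫ cellL h (cellR s h') ≫ eqToHom (comp_assoc h b h').symm := by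
  revert s
  refine Quotient.ind fun s => ?_
  change ((s.whiskerL h).whiskerR h').toHom = _ ≫ ((s.whiskerR h').whiskerL h).toHom ≫ _
  induction s with
  | refl =>
    exact (by simp : 𝟙 _ = eqToHom (comp_assoc h a h') ≫ 𝟙 _ ≫ eqToHom (comp_assoc h a h').symm)
  | tail t x ih =>
    simp only [Trans.whiskerR, Trans.whiskerL]
    rw [toHom_tail, toHom_tail (Trans.whiskerL h (Trans.whiskerR h' t)), ih,
      atom_congr x.gen _ _ _ _ rfl rfl (comp_assoc _ _ _) (comp_assoc _ _ _).symm]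
    · simp
    · simp only [comp_assoc, x.source_eq]
    · simp only [comp_assoc, x.target_eq]

/-- The objects of the `2`-category generated by the double category of `(A, B)`-squares in `C`,
which are those of `C`. -/
structure TQ (A B : Arrowy C) where
  /-- the underlying object of `C` -/
  as : C

/-- The `2`-category generated by the double category of `(A, B)`-squares in `C`: morphisms are
paths, `2`-cells are equivalence classes of transformations. -/
instance TQ.bicategory (A B : Arrowy C) : Bicategory (TQ A B) where
  Hom X Y := TPath A B X.as Y.as
  id X := nil X.as
  comp f g := f.comp g
  homCategory X Y := cellCategory X.as Y.as
  whiskerLeft f _ _ s := cellL f s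
  whiskerRight s h := cellR s h
  associator f g h := eqToIso (comp_assoc f g h)
  leftUnitor f := eqToIso (nil_comp f)
  rightUnitor f := eqToIso (comp_nil f)
  whiskerLeft_id f g := cellL_id f g
  whiskerLeft_comp f _ _ _ s t := cellL_comp f s t
  id_whiskerLeft s := cellL_nil s
  comp_whiskerLeft f g _ _ s := cellL_cellL f g s
  id_whiskerRight f g := cellR_id f g
  comp_whiskerRight s t h := cellR_comp s t h
  whiskerRight_id {a b f g} s := by
    rw [cellR_nil]
    exact (by simp : s = 𝟙 f ≫ s ≫ 𝟙 g)
  whiskerRight_comp s g h := cellR_cellR s g h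
  whisker_assoc f _ _ s h := cellR_cellL f s h
  whisker_exchange := by
    rintro a b c f g h i ⟨s⟩ ⟨t⟩
    exact Quotient.sound (Rel.exchange s t)
  pentagon f g h i := by
    simp only [eqToIso.hom, cellL_eqToHom, cellR_eqToHom, eqToHom_trans]
  triangle f g := by
    simp only [eqToIso.hom, cellL_eqToHom, cellR_eqToHom, eqToHom_trans]

instance TQ.strict (A B : Arrowy C) : Bicategory.Strict (TQ A B) where
  id_comp f := nil_comp f
  comp_id f := comp_nil f
  assoc f g h := comp_assoc f g h

/-! ### Inverting the `2`-cells of a `2`-category -/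

section Localization

universe w₁ v₁ u₁ w₂ v₂ u₂

section Cells

variable {D : Type u₁} [Category.{v₁} D] {D' : Type u₂} [Category.{v₂} D']

/-- The morphisms between two objects of `D` after all morphisms of `D` have been inverted. -/
abbrev LocHom (x y : D) := FreeGroupoid.mk x ⟶ FreeGroupoid.mk y

/-- The class of a morphism of `D`. -/
abbrev locOf {x y : D} (f : x ⟶ y) : LocHom x y := FreeGroupoid.homMk f

/-- The action of a functor after all morphisms have been inverted. -/
def locMap (F : D ⥤ D') {x y : D} (s : LocHom x y) : LocHom (F.obj x) (F.obj y) :=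
  (FreeGroupoid.map F).map s

theorem locOf_comp {x y z : D} (f : x ⟶ y) (g : y ⟶ z) : locOf (f ≫ g) = locOf f ≫ locOf g :=
  (FreeGroupoid.of D).map_comp f g

theorem locOf_id (x : D) : locOf (𝟙 x) = 𝟙 (FreeGroupoid.mk x) := (FreeGroupoid.of D).map_id x

theorem locMap_of (F : D ⥤ D') {x y : D} (f : x ⟶ y) : locMap F (locOf f) = locOf (F.map f) :=
  rfl

theorem locMap_comp (F : D ⥤ D') {x y z : D} (s : LocHom x y) (t : LocHom y z) :
    locMap F (s ≫ t) = locMap F s ≫ locMap F t := (FreeGroupoid.map F).map_comp s t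

theorem locMap_id (F : D ⥤ D') (x : D) :
    locMap F (𝟙 (FreeGroupoid.mk x)) = 𝟙 (FreeGroupoid.mk (F.obj x)) :=
  (FreeGroupoid.map F).map_id _

/-- A family of morphisms that is natural with respect to the morphisms of a category is natural
with respect to the morphisms of its free groupoid. -/
theorem natural_of_locOf {G : Type u₂} [Groupoid.{v₂} G]
    (F₁ F₂ : FreeGroupoid D ⥤ G)
    (τ : ∀ x : D, F₁.obj (FreeGroupoid.mk x) ⟶ F₂.obj (FreeGroupoid.mk x))
    (hτ : ∀ {x y : D} (f : x ⟶ y), F₁.map (locOf f) ≫ τ y = τ x ≫ F₂.map (locOf f))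
    {x y : D} (f : LocHom x y) : F₁.map f ≫ τ y = τ x ≫ F₂.map f := by
  let t : FreeGroupoid.of D ⋙ F₁ ≅ FreeGroupoid.of D ⋙ F₂ :=
    NatIso.ofComponents (fun X => ⟨τ X, Groupoid.inv (τ X), by simp, by simp⟩) (fun f => hτ f)
  have h := (FreeGroupoid.liftNatIso F₁ F₂ t).hom.naturality f
  have hx := FreeGroupoid.liftNatIso_hom_app F₁ F₂ t x
  have hy := FreeGroupoid.liftNatIso_hom_app F₁ F₂ t y
  change _ = τ x at hx
  change _ = τ y at hy
  rw [← hx, ← hy]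
  exact h

theorem locMap_natural (F₁ F₂ : D ⥤ D') (τ : ∀ x : D, LocHom (F₁.obj x) (F₂.obj x))
    (hτ : ∀ {x y : D} (f : x ⟶ y), locOf (F₁.map f) ≫ τ y = τ x ≫ locOf (F₂.map f))
    {x y : D} (f : LocHom x y) : locMap F₁ f ≫ τ y = τ x ≫ locMap F₂ f :=
  natural_of_locOf (FreeGroupoid.map F₁) (FreeGroupoid.map F₂) τ hτ f

theorem locMap_conj {F₁ F₂ : D ⥤ D'} (e : F₁ ≅ F₂) {x y : D} (s : LocHom x y) :
    locMap F₁ s = locOf (e.hom.app x) ≫ locMap F₂ s ≫ locOf (e.inv.app y) := by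
  have h := locMap_natural F₁ F₂ (fun x => locOf (e.hom.app x))
    (fun f => by rw [← locOf_comp, ← locOf_comp, e.hom.naturality]) s
  rw [← Category.assoc, ← h, Category.assoc, ← locOf_comp, e.hom_inv_id_app, locOf_id,
    Category.comp_id]

theorem locMap_functorId {x y : D} (s : LocHom x y) : locMap (𝟭 D) s = s := by
  have h := natural_of_locOf (FreeGroupoid.map (𝟭 D)) (𝟭 _) (fun x => 𝟙 (FreeGroupoid.mk x))
    (fun f => (Category.comp_id (locOf f)).trans (Category.id_comp (locOf f)).symm) s
  exact (Category.comp_id (locMap (𝟭 D) s)).symm.trans (h.trans (Category.id_comp s))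

theorem locMap_functorComp {D'' : Type*} [Category* D''] (F : D ⥤ D') (G : D' ⥤ D'') {x y : D}
    (s : LocHom x y) : locMap (F ⋙ G) s = locMap G (locMap F s) := by
  have h := FreeGroupoid.map_comp F G
  have := Functor.congr_hom h s
  exact this.trans ((Category.id_comp _).trans (Category.comp_id _))

end Cells

variable (T : Type u₁) [Bicategory.{w₁, v₁} T]

/-- The objects of the localization of a `2`-category at all its `2`-cells, which are those of the
given `2`-category. -/
structure Loc where
  /-- the underlying object -/
  as : T

variable {T}

/-- The morphisms of the localization of a `2`-category at all its `2`-cells, which are those of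
the given `2`-category. -/
structure LocMor (X Y : T) where
  /-- the underlying morphism -/
  of : X ⟶ Y

/-- The category of morphisms from `X` to `Y` of the localization of a `2`-category at all its
`2`-cells is obtained from the one of the given `2`-category by inverting all its morphisms. -/
instance LocMor.groupoid (X Y : T) : Groupoid (LocMor X Y) where
  Hom f g := LocHom f.of g.of
  id f := 𝟙 (FreeGroupoid.mk f.of)
  comp {f g h} s t := CategoryStruct.comp (obj := FreeGroupoid (X ⟶ Y)) s t
  inv {f g} s := Groupoid.inv (obj := FreeGroupoid (X ⟶ Y)) s
  id_comp s := Category.id_comp (obj := FreeGroupoid (X ⟶ Y)) s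
  comp_id s := Category.comp_id (obj := FreeGroupoid (X ⟶ Y)) s
  assoc s t r := Category.assoc (obj := FreeGroupoid (X ⟶ Y)) s t r
  inv_comp s := Groupoid.inv_comp (obj := FreeGroupoid (X ⟶ Y)) s
  comp_inv s := Groupoid.comp_inv (obj := FreeGroupoid (X ⟶ Y)) s

/-- The localization functor on the categories of morphisms. -/
def toLocMor (X Y : T) : (X ⟶ Y) ⥤ LocMor X Y where
  obj f := ⟨f⟩
  map s := locOf s
  map_id f := locOf_id f
  map_comp s t := locOf_comp s t

theorem locMap_exchange {X Y Z : T} {f g : X ⟶ Y} {h i : Y ⟶ Z} (s : LocHom f g)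
    (t : LocHom h i) :
    locMap (precomp Z f) t ≫ locMap (postcomp X i) s =
      locMap (postcomp X h) s ≫ locMap (precomp Z g) t := by
  have key : ∀ {h i : Y ⟶ Z} (t : h ⟶ i) {f g : X ⟶ Y} (s : LocHom f g),
      locMap (postcomp X h) s ≫ locOf (g ◁ t) = locOf (f ◁ t) ≫ locMap (postcomp X i) s :=
    fun {h i} t {f g} s => locMap_natural (postcomp X h) (postcomp X i) (fun f => locOf (f ◁ t))
      (fun {x y} s => (locOf_comp (s ▷ h) (y ◁ t)).symm.trans
        ((congrArg locOf (whisker_exchange s t).symm).trans (locOf_comp (x ◁ t) (s ▷ i)))) s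
  exact locMap_natural (precomp Z f) (precomp Z g) (fun h => locMap (postcomp X h) s)
    (fun t => (key t s).symm) t

/-- The localization of a `2`-category at all its `2`-cells. -/
instance Loc.bicategory : Bicategory (Loc T) where
  Hom X Y := LocMor X.as Y.as
  id X := ⟨𝟙 X.as⟩
  comp f g := ⟨f.of ≫ g.of⟩
  homCategory X Y := (LocMor.groupoid X.as Y.as).toCategory
  whiskerLeft {X Y Z} f _ _ s := locMap (precomp Z.as f.of) s
  whiskerRight {X Y Z} _ _ s g := locMap (postcomp X.as g.of) s
  associator f g h := (toLocMor _ _).mapIso (α_ f.of g.of h.of)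
  leftUnitor f := (toLocMor _ _).mapIso (λ_ f.of)
  rightUnitor f := (toLocMor _ _).mapIso (ρ_ f.of)
  whiskerLeft_id f g := locMap_id (precomp _ f.of) g.of
  whiskerLeft_comp f _ _ _ s t := locMap_comp (precomp _ f.of) s t
  id_whiskerRight f g := locMap_id (postcomp _ g.of) f.of
  comp_whiskerRight s t g := locMap_comp (postcomp _ g.of) s t
  id_whiskerLeft {X Y f g} s := by
    have h := locMap_conj (F₁ := precomp Y.as (𝟙 X.as)) (F₂ := 𝟭 _)
      (leftUnitorNatIso X.as Y.as) s
    rw [locMap_functorId] at h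
    exact h
  comp_whiskerLeft {X Y Z W} f g _ _ s := by
    have h := locMap_conj (F₁ := precomp W.as (f.of ≫ g.of))
      (F₂ := precomp W.as g.of ⋙ precomp W.as f.of)
      (associatorNatIsoRight f.of g.of W.as) s
    rw [locMap_functorComp] at h
    exact h
  whiskerRight_id {X Y _ _} s := by
    have h := locMap_conj (F₁ := postcomp X.as (𝟙 Y.as)) (F₂ := 𝟭 _)
      (rightUnitorNatIso X.as Y.as) s
    rw [locMap_functorId] at h
    exact h
  whiskerRight_comp {X Y Z W _ _} s g h := by
    have h := locMap_conj (F₁ := postcomp X.as (g.of ≫ h.of))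
      (F₂ := postcomp X.as g.of ⋙ postcomp X.as h.of)
      (associatorNatIsoLeft X.as g.of h.of).symm s
    rw [locMap_functorComp] at h
    exact h
  whisker_assoc {X Y Z W} f _ _ s h := by
    have h := locMap_conj (F₁ := precomp Z.as f.of ⋙ postcomp X.as h.of)
      (F₂ := postcomp Y.as h.of ⋙ precomp W.as f.of)
      (associatorNatIsoMiddle f.of h.of) s
    rw [locMap_functorComp, locMap_functorComp] at h
    exact h
  whisker_exchange s t := locMap_exchange s t
  pentagon {X Y Z W V} f g h i := by
    have := congrArg (toLocMor X.as V.as).map (pentagon f.of g.of h.of i.of)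
    rw [Functor.map_comp, Functor.map_comp, Functor.map_comp] at this
    exact this
  triangle {X Y Z} f g := by
    have := congrArg (toLocMor X.as Z.as).map (triangle f.of g.of)
    rw [Functor.map_comp] at this
    exact this

instance Loc.locallyGroupoid (X Y : Loc T) : Groupoid (X ⟶ Y) := LocMor.groupoid X.as Y.as

instance Loc.strict [Bicategory.Strict T] : Bicategory.Strict (Loc T) where
  id_comp f := congrArg LocMor.mk (Strict.id_comp f.of)
  comp_id f := congrArg LocMor.mk (Strict.comp_id f.of)
  assoc f g h := congrArg LocMor.mk (Strict.assoc f.of g.of h.of)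
  leftUnitor_eqToIso {X Y} f :=
    (congrArg (toLocMor X.as Y.as).mapIso (Strict.leftUnitor_eqToIso f.of)).trans
      (eqToIso_map (toLocMor X.as Y.as) _)
  rightUnitor_eqToIso {X Y} f :=
    (congrArg (toLocMor X.as Y.as).mapIso (Strict.rightUnitor_eqToIso f.of)).trans
      (eqToIso_map (toLocMor X.as Y.as) _)
  associator_eqToIso {X Y Z W} f g h :=
    (congrArg (toLocMor X.as W.as).mapIso (Strict.associator_eqToIso f.of g.of h.of)).trans
      (eqToIso_map (toLocMor X.as W.as) _)

end Localization

/-! ### Extension of `2`-functors to the localization -/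

section Lift

universe w₁ v₁ u₁ w₂ v₂ u₂

variable {T : Type u₁} [Bicategory.{w₁, v₁} T] {D : Type u₂} [Bicategory.{w₂, v₂} D]
  [IsLocallyGroupoid D]

/-- The groupoid structure on the categories of morphisms of a `(2,1)`-category. -/
noncomputable abbrev homGroupoid (X Y : D) : Groupoid (X ⟶ Y) := Groupoid.ofIsGroupoid

theorem eq_eqToHom_conj {E : Type u₁} [Category.{v₁} E] {a b a' b' : E} {s : a ⟶ b} {t : a' ⟶ b'}
    (h : a = a') (k : b = b') (e : s ≫ eqToHom k = eqToHom h ≫ t) :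
    s = eqToHom h ≫ t ≫ eqToHom k.symm := by
  subst h k
  simpa using e

theorem eqToHom_conj_comp {E : Type u₁} [Category.{v₁} E] {a b a' b' : E} (h : a = a')
    (t : a' ⟶ b') (k : b = b') :
    ((eqToIso h).hom ≫ t ≫ (eqToIso k).inv) ≫ eqToHom k = eqToHom h ≫ t := by
  subst h k
  simp

/-- Extension of the action of a pseudofunctor on `2`-cells to the localization. -/
noncomputable def liftHom (F : T ⥤ᵖ D) (X Y : T) :
    FreeGroupoid (X ⟶ Y) ⥤ (F.obj X ⟶ F.obj Y) :=
  letI : Groupoid (F.obj X ⟶ F.obj Y) := homGroupoid _ _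
  FreeGroupoid.lift (F.mapFunctor X Y)

theorem liftHom_of (F : T ⥤ᵖ D) {X Y : T} {f g : X ⟶ Y} (s : f ⟶ g) :
    (liftHom F X Y).map (locOf s) = F.map₂ s :=
  letI : Groupoid (F.obj X ⟶ F.obj Y) := homGroupoid _ _
  FreeGroupoid.lift_map_homMk (F.mapFunctor X Y) s

/-- A `2`-functor from `T` to a `(2,1)`-category `D` extends to the localization of `T` at all its
`2`-cells. -/
noncomputable def Loc.lift [Strict T] [Strict D] (F : StrictPseudofunctor T D) :
    StrictPseudofunctor (Loc T) D :=
  StrictPseudofunctor.mk''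
    { obj X := F.obj X.as
      map f := F.map f.of
      map₂ {X Y _ _} s := (liftHom F.toPseudofunctor X.as Y.as).map s
      map₂_id {X Y} f := (liftHom F.toPseudofunctor X.as Y.as).map_id (FreeGroupoid.mk f.of)
      map₂_comp {X Y _ _ _} s t := (liftHom F.toPseudofunctor X.as Y.as).map_comp s t
      map_id X := F.map_id X.as
      map_comp f g := F.map_comp f.of g.of
      map₂_whisker_left {X Y Z} f g h s := by
        let _ : Groupoid (F.obj X.as ⟶ F.obj Z.as) := homGroupoid _ _
        have key := natural_of_locOf
          (FreeGroupoid.map (precomp Z.as f.of) ⋙ liftHom F.toPseudofunctor X.as Z.as)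
          (liftHom F.toPseudofunctor Y.as Z.as ⋙ precomp (F.obj Z.as) (F.map f.of))
          (fun g => eqToHom (F.map_comp f.of g)) (fun {g h} s => by
            change (liftHom F.toPseudofunctor X.as Z.as).map (locOf (f.of ◁ s)) ≫ _ =
              _ ≫ F.map f.of ◁ ((liftHom F.toPseudofunctor Y.as Z.as).map (locOf s))
            rw [liftHom_of, liftHom_of]
            have := F.map₂_whisker_left f.of s
            rw [F.mapComp_eq_eqToIso, F.mapComp_eq_eqToIso] at this
            rw [this]
            exact eqToHom_conj_comp _ _ _) s
        exact eq_eqToHom_conj _ _ key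
      map₂_whisker_right {X Y Z f g} s h := by
        let _ : Groupoid (F.obj X.as ⟶ F.obj Z.as) := homGroupoid _ _
        have key := natural_of_locOf
          (FreeGroupoid.map (postcomp X.as h.of) ⋙ liftHom F.toPseudofunctor X.as Z.as)
          (liftHom F.toPseudofunctor X.as Y.as ⋙ postcomp (F.obj X.as) (F.map h.of))
          (fun g => eqToHom (F.map_comp g h.of)) (fun {f g} s => by
            change (liftHom F.toPseudofunctor X.as Z.as).map (locOf (s ▷ h.of)) ≫ _ =
              _ ≫ ((liftHom F.toPseudofunctor X.as Y.as).map (locOf s)) ▷ F.map h.of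
            rw [liftHom_of, liftHom_of]
            have := F.map₂_whisker_right s h.of
            rw [F.mapComp_eq_eqToIso, F.mapComp_eq_eqToIso] at this
            rw [this]
            exact eqToHom_conj_comp _ _ _) s
        exact eq_eqToHom_conj _ _ key }

end Lift

/-! ### The `2`-functor to `C` -/

section TrivialCells

/-- A `2`-cell is trivial if it is the identity of a morphism, up to an equality of its source and
its target. -/
def Triv {X Y : C} {a b : X ⟶ Y} (s : a ⟶ b) : Prop := ∃ h : a = b, s = eqToHom h

/-- Equality of `2`-cells up to equalities of their sources and targets. -/
def Same {X Y : C} {a b a' b' : X ⟶ Y} (s : a ⟶ b) (t : a' ⟶ b') : Prop :=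
  ∃ (h : a = a') (k : b' = b), s = eqToHom h ≫ t ≫ eqToHom k

theorem triv_id {X Y : C} (a : X ⟶ Y) : Triv (𝟙 a) := ⟨rfl, rfl⟩

theorem triv_eqToHom {X Y : C} {a b : X ⟶ Y} (h : a = b) : Triv (eqToHom h) := ⟨h, rfl⟩

theorem Triv.comp {X Y : C} {a b c : X ⟶ Y} {s : a ⟶ b} {t : b ⟶ c} (hs : Triv s)
    (ht : Triv t) : Triv (s ≫ t) := by
  obtain ⟨rfl, rfl⟩ := hs
  obtain ⟨rfl, rfl⟩ := ht
  exact ⟨rfl, by simp⟩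

theorem Triv.left {X Y Z : C} {a b : Y ⟶ Z} {s : a ⟶ b} (hs : Triv s) (f : X ⟶ Y) :
    Triv (f ◁ s) := by
  obtain ⟨rfl, rfl⟩ := hs
  exact ⟨rfl, by simp⟩

theorem Triv.right {X Y Z : C} {a b : X ⟶ Y} {s : a ⟶ b} (hs : Triv s) (f : Y ⟶ Z) :
    Triv (s ▷ f) := by
  obtain ⟨rfl, rfl⟩ := hs
  exact ⟨rfl, by simp⟩

theorem Triv.eq {X Y : C} {a b : X ⟶ Y} {s t : a ⟶ b} (hs : Triv s) (ht : Triv t) : s = t := by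
  obtain ⟨_, rfl⟩ := hs
  obtain ⟨_, rfl⟩ := ht
  rfl

theorem Same.refl {X Y : C} {a b : X ⟶ Y} (s : a ⟶ b) : Same s s := ⟨rfl, rfl, by simp⟩

theorem Same.symm {X Y : C} {a b a' b' : X ⟶ Y} {s : a ⟶ b} {t : a' ⟶ b'} (h : Same s t) :
    Same t s := by
  obtain ⟨rfl, rfl, rfl⟩ := h
  exact ⟨rfl, rfl, by simp⟩

theorem Same.trans {X Y : C} {a b a' b' a'' b'' : X ⟶ Y} {s : a ⟶ b} {t : a' ⟶ b'}
    {r : a'' ⟶ b''} (h : Same s t) (h' : Same t r) : Same s r := by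
  obtain ⟨rfl, rfl, rfl⟩ := h
  obtain ⟨rfl, rfl, rfl⟩ := h'
  exact ⟨rfl, rfl, by simp⟩

theorem Same.comp {X Y : C} {a b c a' b' c' : X ⟶ Y} {s : a ⟶ b} {s' : b ⟶ c} {t : a' ⟶ b'}
    {t' : b' ⟶ c'} (h : Same s t) (h' : Same s' t') : Same (s ≫ s') (t ≫ t') := by
  obtain ⟨rfl, rfl, rfl⟩ := h
  obtain ⟨_, rfl, rfl⟩ := h'
  exact ⟨rfl, rfl, by simp⟩

theorem Same.left {X Y Z : C} {a b a' b' : Y ⟶ Z} {s : a ⟶ b} {t : a' ⟶ b'} (h : Same s t)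
    {f f' : X ⟶ Y} (hf : f = f') : Same (f ◁ s) (f' ◁ t) := by
  obtain ⟨rfl, rfl, rfl⟩ := h
  subst hf
  exact ⟨rfl, rfl, by simp⟩

theorem Same.right {X Y Z : C} {a b a' b' : X ⟶ Y} {s : a ⟶ b} {t : a' ⟶ b'} (h : Same s t)
    {f f' : Y ⟶ Z} (hf : f = f') : Same (s ▷ f) (t ▷ f') := by
  obtain ⟨rfl, rfl, rfl⟩ := h
  subst hf
  exact ⟨rfl, rfl, by simp⟩

theorem Same.eq {X Y : C} {a b : X ⟶ Y} {s t : a ⟶ b} (h : Same s t) : s = t := by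
  obtain ⟨_, _, rfl⟩ := h
  simp

theorem Triv.same_comp {X Y : C} {a b c : X ⟶ Y} {s : a ⟶ b} (hs : Triv s) (t : b ⟶ c) :
    Same (s ≫ t) t := by
  obtain ⟨rfl, rfl⟩ := hs
  exact ⟨rfl, rfl, by simp⟩

theorem Triv.comp_same {X Y : C} {a b c : X ⟶ Y} {t : b ⟶ c} (ht : Triv t) (s : a ⟶ b) :
    Same (s ≫ t) s := by
  obtain ⟨rfl, rfl⟩ := ht
  exact ⟨rfl, rfl, by simp⟩

theorem Triv.of_same {X Y : C} {a b a' b' : X ⟶ Y} {s : a ⟶ b} {t : a' ⟶ b'} (ht : Triv t)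
    (h : Same s t) : Triv s := by
  obtain ⟨rfl, rfl, rfl⟩ := h
  obtain ⟨rfl, rfl⟩ := ht
  exact ⟨rfl, by simp⟩

variable [Strict C]

theorem triv_assoc {X Y Z W : C} (f : X ⟶ Y) (g : Y ⟶ Z) (h : Z ⟶ W) : Triv (α_ f g h).hom :=
  ⟨Strict.assoc f g h, by rw [Strict.associator_eqToIso]; rfl⟩

theorem triv_assoc_inv {X Y Z W : C} (f : X ⟶ Y) (g : Y ⟶ Z) (h : Z ⟶ W) :
    Triv (α_ f g h).inv :=
  ⟨(Strict.assoc f g h).symm, by rw [Strict.associator_eqToIso]; rfl⟩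

theorem triv_leftUnitor {X Y : C} (f : X ⟶ Y) : Triv (λ_ f).hom :=
  ⟨Strict.id_comp f, by rw [Strict.leftUnitor_eqToIso]; rfl⟩

theorem triv_leftUnitor_inv {X Y : C} (f : X ⟶ Y) : Triv (λ_ f).inv :=
  ⟨(Strict.id_comp f).symm, by rw [Strict.leftUnitor_eqToIso]; rfl⟩

theorem triv_rightUnitor {X Y : C} (f : X ⟶ Y) : Triv (ρ_ f).hom :=
  ⟨Strict.comp_id f, by rw [Strict.rightUnitor_eqToIso]; rfl⟩

theorem triv_rightUnitor_inv {X Y : C} (f : X ⟶ Y) : Triv (ρ_ f).inv :=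
  ⟨(Strict.comp_id f).symm, by rw [Strict.rightUnitor_eqToIso]; rfl⟩

theorem same_id_left {X Y : C} {a b : X ⟶ Y} (s : a ⟶ b) : Same (𝟙 X ◁ s) s := by
  rw [id_whiskerLeft]
  exact ((triv_leftUnitor a).same_comp _).trans ((triv_leftUnitor_inv b).comp_same _)

theorem same_right_id {X Y : C} {a b : X ⟶ Y} (s : a ⟶ b) : Same (s ▷ 𝟙 Y) s := by
  rw [whiskerRight_id]
  exact ((triv_rightUnitor a).same_comp _).trans ((triv_rightUnitor_inv b).comp_same _)

theorem same_comp_left {X Y Z W : C} (f : X ⟶ Y) (g : Y ⟶ Z) {a b : Z ⟶ W} (s : a ⟶ b) :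
    Same ((f ≫ g) ◁ s) (f ◁ g ◁ s) := by
  rw [comp_whiskerLeft]
  exact ((triv_assoc f g a).same_comp _).trans ((triv_assoc_inv f g b).comp_same _)

theorem same_right_comp {X Y Z W : C} {a b : X ⟶ Y} (s : a ⟶ b) (f : Y ⟶ Z) (g : Z ⟶ W) :
    Same (s ▷ (f ≫ g)) (s ▷ f ▷ g) := by
  rw [whiskerRight_comp]
  exact ((triv_assoc_inv a f g).same_comp _).trans ((triv_assoc b f g).comp_same _)

theorem same_mid {X Y Z W : C} (f : X ⟶ Y) {a b : Y ⟶ Z} (s : a ⟶ b) (g : Z ⟶ W) :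
    Same ((f ◁ s) ▷ g) (f ◁ s ▷ g) := by
  rw [whisker_assoc]
  exact ((triv_assoc f a g).same_comp _).trans ((triv_assoc_inv f b g).comp_same _)

end TrivialCells

section Eval

/-- The composite of a path in `C`. -/
def TPath.eval {X Y : C} : TPath A B X Y → (X ⟶ Y)
  | nil X => 𝟙 X
  | cons p e => p.eval ≫ e.2.val

variable [Strict C]

theorem TPath.eval_comp {X Y Z : C} (p : TPath A B X Y) (q : TPath A B Y Z) :
    (p.comp q).eval = p.eval ≫ q.eval := by
  induction q with
  | nil => exact (Strict.comp_id _).symm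
  | cons q e ih =>
    change (p.comp q).eval ≫ e.2.val = p.eval ≫ q.eval ≫ e.2.val
    rw [ih, Strict.assoc]

theorem TPath.eval_single {X Y : C} (e : Edge A B X Y) : (single e).eval = e.2.val :=
  Strict.id_comp _

/-- The image of an atomic transformation without context: `sigma D` goes to the `2`-cell of the
square `D`, the other ones go to identities. -/
def Gen.eval : ∀ {X Y : C} {a b : TPath A B X Y}, Gen A B a b → (a.eval ⟶ b.eval)
  | _, _, _, _, .iota k X =>
      eqToHom (Strict.id_comp (𝟙 X)).symm
  | _, _, _, _, .theta k X =>
      eqToHom (Strict.id_comp (𝟙 X))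
  | _, _, _, _, .gamma h h' _ e =>
      eqToHom (by subst e; exact Strict.assoc _ _ _)
  | _, _, _, _, .delta h h' _ e =>
      eqToHom (by subst e; exact (Strict.assoc _ _ _).symm)
  | _, _, _, _, .sigma (j := j) (q := q) (p := p) (i := i) D =>
      eqToHom (congrArg (fun t => t ≫ i.val) (Strict.id_comp q.val)) ≫ D.cell ≫
        eqToHom (congrArg (fun t => t ≫ p.val) (Strict.id_comp j.val)).symm

theorem Gen.same_sigma {X Y Z W : C} {j : A.Mor X Y} {q : B.Mor X Z} {p : B.Mor Y W}
    {i : A.Mor Z W} (D : Sq A B j q p i) : Same (sigma D).eval D.cell := ⟨_, _, rfl⟩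

theorem Atom.eval_source {X Y : C} {a b : TPath A B X Y} (x : Atom a b) :
    a.eval = x.f.eval ≫ x.s.eval ≫ x.g.eval :=
  (congrArg TPath.eval x.source_eq).trans (by rw [TPath.eval_comp, TPath.eval_comp])

theorem Atom.eval_target {X Y : C} {a b : TPath A B X Y} (x : Atom a b) :
    b.eval = x.f.eval ≫ x.t.eval ≫ x.g.eval :=
  (congrArg TPath.eval x.target_eq).trans (by rw [TPath.eval_comp, TPath.eval_comp])

/-- The image of an atomic transformation. -/
def Atom.eval {X Y : C} {a b : TPath A B X Y} (x : Atom a b) : a.eval ⟶ b.eval :=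
  eqToHom x.eval_source ≫ x.f.eval ◁ x.gen.eval ▷ x.g.eval ≫ eqToHom x.eval_target.symm

theorem Atom.same_eval {X Y : C} {a b : TPath A B X Y} (x : Atom a b) :
    Same x.eval (x.f.eval ◁ x.gen.eval ▷ x.g.eval) := ⟨_, _, rfl⟩

/-- The image of a transformation. -/
def Trans.eval {X Y : C} {a b : TPath A B X Y} : Trans a b → (a.eval ⟶ b.eval)
  | refl => 𝟙 _
  | tail t x => t.eval ≫ x.eval

theorem Trans.eval_trans {X Y : C} {a b c : TPath A B X Y} (s : Trans a b) (t : Trans b c) :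
    (s.trans t).eval = s.eval ≫ t.eval := by
  induction t with
  | refl => exact (Category.comp_id _).symm
  | tail t x ih =>
    change (s.trans t).eval ≫ x.eval = s.eval ≫ t.eval ≫ x.eval
    rw [ih, Category.assoc]

theorem Trans.same_whiskerL {X Y Z : C} (h : TPath A B X Y) {a b : TPath A B Y Z}
    (s : Trans a b) : Same (s.whiskerL h).eval (h.eval ◁ s.eval) := by
  induction s with
  | refl =>
    exact ⟨TPath.eval_comp h a, (TPath.eval_comp h a).symm, by simp [Trans.whiskerL, Trans.eval]⟩
  | tail t x ih =>
    have h1 : Same (h.eval ◁ x.f.eval ◁ x.gen.eval ▷ x.g.eval) (h.eval ◁ x.eval) :=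
      x.same_eval.symm.left rfl
    have h2 : Same ((h.comp x.f).eval ◁ x.gen.eval ▷ x.g.eval) (h.eval ◁ x.eval) :=
      ((Same.refl _).left (TPath.eval_comp h x.f)).trans ((same_comp_left _ _ _).trans h1)
    change Same ((t.whiskerL h).eval ≫ Atom.eval _) (h.eval ◁ (t.eval ≫ x.eval))
    rw [Bicategory.whiskerLeft_comp]
    exact ih.comp ((Atom.same_eval _).trans h2)

theorem Trans.same_whiskerR {X Y Z : C} {a b : TPath A B X Y} (s : Trans a b)
    (h : TPath A B Y Z) : Same (s.whiskerR h).eval (s.eval ▷ h.eval) := by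
  induction s with
  | refl =>
    exact ⟨TPath.eval_comp a h, (TPath.eval_comp a h).symm, by simp [Trans.whiskerR, Trans.eval]⟩
  | tail t x ih =>
    have h1 : Same ((x.f.eval ◁ x.gen.eval ▷ x.g.eval) ▷ h.eval) (x.eval ▷ h.eval) :=
      x.same_eval.symm.right rfl
    have h2 : Same (x.f.eval ◁ x.gen.eval ▷ (x.g.comp h).eval) (x.eval ▷ h.eval) :=
      ((((Same.refl _).right (TPath.eval_comp x.g h)).trans (same_right_comp _ _ _)).left
        rfl).trans ((same_mid _ _ _).symm.trans h1)
    change Same ((t.whiskerR h).eval ≫ Atom.eval _) ((t.eval ≫ x.eval) ▷ h.eval)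
    rw [Bicategory.comp_whiskerRight]
    exact ih.comp ((Atom.same_eval _).trans h2)

theorem Trans.same_of {X Y : C} {a b : TPath A B X Y} (x : Gen A B a b) :
    Same (Trans.of x).eval x.eval :=
  ((triv_id _).same_comp _).trans ((Atom.same_eval _).trans
    ((same_id_left _).trans (same_right_id _)))

theorem Trans.triv_of {X Y : C} {a b : TPath A B X Y} {x : Gen A B a b} (h : Triv x.eval) :
    Triv (Trans.of x).eval := h.of_same (Trans.same_of x)

theorem Trans.triv_whiskerL {X Y Z : C} (h : TPath A B X Y) {a b : TPath A B Y Z}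
    {s : Trans a b} (hs : Triv s.eval) : Triv (s.whiskerL h).eval :=
  (hs.left _).of_same (Trans.same_whiskerL h s)

theorem Trans.triv_whiskerR {X Y Z : C} {a b : TPath A B X Y} (h : TPath A B Y Z)
    {s : Trans a b} (hs : Triv s.eval) : Triv (s.whiskerR h).eval :=
  (hs.right _).of_same (Trans.same_whiskerR s h)

theorem Trans.triv_trans {X Y : C} {a b c : TPath A B X Y} {s : Trans a b} {t : Trans b c}
    (hs : Triv s.eval) (ht : Triv t.eval) : Triv (s.trans t).eval := by
  rw [Trans.eval_trans]
  exact hs.comp ht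

theorem Trans.triv_iota (k : Dir) (X : C) :
    Triv (Trans.of (iota (A := A) (B := B) k X)).eval := Trans.triv_of ⟨(Strict.id_comp _).symm, rfl⟩

theorem Trans.triv_theta (k : Dir) (X : C) :
    Triv (Trans.of (theta (A := A) (B := B) k X)).eval := Trans.triv_of ⟨Strict.id_comp _, rfl⟩

theorem Trans.triv_gamma {k : Dir} {X Y Z : C} (h : (side A B k).Mor X Y)
    (h' : (side A B k).Mor Y Z) (h'' : (side A B k).Mor X Z) (e : h.comp h' = h'') :
    Triv (Trans.of (gamma h h' h'' e)).eval := by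
  subst e
  exact Trans.triv_of ⟨Strict.assoc _ _ _, rfl⟩

theorem Trans.triv_delta {k : Dir} {X Y Z : C} (h : (side A B k).Mor X Y)
    (h' : (side A B k).Mor Y Z) (h'' : (side A B k).Mor X Z) (e : h.comp h' = h'') :
    Triv (Trans.of (delta h h' h'' e)).eval := by
  subst e
  exact Trans.triv_of ⟨(Strict.assoc _ _ _).symm, rfl⟩

/-- Equivalent transformations have the same image. -/
theorem Rel.eval_eq {X Y : C} {a b : TPath A B X Y} {s t : Trans a b} (r : Rel s t) :
    s.eval = t.eval := by
  induction r with
  | refl s => rfl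
  | symm _ ih => exact ih.symm
  | trans _ _ ih ih' => exact ih.trans ih'
  | comp x y _ ih => simp only [Trans.eval_trans, ih]
  | whiskerL h _ ih =>
    refine ((Trans.same_whiskerL _ _).trans (Same.trans ?_ (Trans.same_whiskerL _ _).symm)).eq
    rw [ih]
    exact Same.refl _
  | whiskerR h _ ih =>
    refine ((Trans.same_whiskerR _ _).trans (Same.trans ?_ (Trans.same_whiskerR _ _).symm)).eq
    rw [ih]
    exact Same.refl _
  | exchange s t =>
    rw [Trans.eval_trans, Trans.eval_trans]
    refine Same.eq (Same.trans ((Trans.same_whiskerL _ t).comp (Trans.same_whiskerR s _)) (Same.trans ?_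
      ((Trans.same_whiskerR s _).comp (Trans.same_whiskerL _ t)).symm))
    rw [whisker_exchange]
    exact Same.refl _
  | iota_theta k X => exact (Trans.triv_trans (Trans.triv_iota k X) (Trans.triv_theta k X)).eq (triv_id _)
  | theta_iota k X => exact (Trans.triv_trans (Trans.triv_theta k X) (Trans.triv_iota k X)).eq (triv_id _)
  | iota_delta f e => exact (Trans.triv_whiskerR _ (Trans.triv_iota _ _)).eq (Trans.triv_delta _ _ _ _)
  | delta_iota f e => exact (Trans.triv_whiskerL _ (Trans.triv_iota _ _)).eq (Trans.triv_delta _ _ _ _)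
  | gamma_delta f g => exact (Trans.triv_trans (Trans.triv_gamma _ _ _ _) (Trans.triv_delta _ _ _ _)).eq (triv_id _)
  | delta_gamma f g => exact (Trans.triv_trans (Trans.triv_delta _ _ _ _) (Trans.triv_gamma _ _ _ _)).eq (triv_id _)
  | gamma_gamma f g h e =>
    exact (Trans.triv_trans (Trans.triv_whiskerR _ (Trans.triv_gamma _ _ _ _)) (Trans.triv_gamma _ _ _ _)).eq
      (Trans.triv_trans (Trans.triv_whiskerL _ (Trans.triv_gamma _ _ _ _)) (Trans.triv_gamma _ _ _ _))
  | sigma_idHor f =>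
    refine (Trans.triv_trans (Trans.triv_whiskerR _ (Trans.triv_iota _ _)) (Trans.triv_of ?_)).eq
      (Trans.triv_whiskerL _ (Trans.triv_iota _ _))
    exact ((triv_leftUnitor _).comp (triv_rightUnitor_inv _)).of_same (Gen.same_sigma _)
  | sigma_idVer f =>
    refine (Trans.triv_trans (Trans.triv_whiskerL _ (Trans.triv_iota _ _)) (Trans.triv_of ?_)).eq
      (Trans.triv_whiskerR _ (Trans.triv_iota _ _))
    exact ((triv_rightUnitor _).comp (triv_leftUnitor_inv _)).of_same (Gen.same_sigma _)
  | @sigma_hcomp X₁ X₂ X₃ Y₁ Y₂ Y₃ j j' i i' p₁ p₂ p₃ D D' =>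
    have e1 := (Trans.same_whiskerR (Trans.of (sigma D)) (single (hor B i'))).trans
      (((Trans.same_of _).trans (Gen.same_sigma D)).right (TPath.eval_single _))
    have e2 := (Trans.same_whiskerL (single (hor B j)) (Trans.of (sigma D'))).trans
      (((Trans.same_of _).trans (Gen.same_sigma D')).left (TPath.eval_single _))
    have e3 : Same (Trans.of (sigma (D.hcomp D'))).eval (D.hcomp D').cell :=
      (Trans.same_of _).trans (Gen.same_sigma _)
    have e4 := e2.trans (((triv_assoc _ _ _).same_comp _).trans
      ((triv_assoc_inv _ _ _).comp_same _)).symm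
    have e5 := (e1.comp (e4)).trans
      ((triv_assoc_inv _ _ _).same_comp _).symm
    refine (Trans.eval_trans _ _).trans (Eq.trans ?_ (Trans.eval_trans _ _).symm)
    refine (congrArg (fun x => x ≫ _) (Trans.eval_trans _ _)).trans (Same.eq ?_)
    refine ((Trans.triv_whiskerR _ (Trans.triv_gamma _ _ _ _)).comp_same _).trans
      (Same.trans ?_ ((Trans.triv_whiskerL _ (Trans.triv_gamma _ _ _ _)).same_comp _).symm)
    exact e5.trans e3.symm
  | @sigma_vcomp X₁ X₂ X₃ Y₁ Y₂ Y₃ i₁ i₂ i₃ q q' p p' D D' =>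
    have e1 := (Trans.same_whiskerR (Trans.of (sigma D)) (single (ver A p'))).trans
      (((Trans.same_of _).trans (Gen.same_sigma D)).right (TPath.eval_single _))
    have e2 := (Trans.same_whiskerL (single (ver A q)) (Trans.of (sigma D'))).trans
      (((Trans.same_of _).trans (Gen.same_sigma D')).left (TPath.eval_single _))
    have e3 : Same (Trans.of (sigma (D.vcomp D'))).eval (D.vcomp D').cell :=
      (Trans.same_of _).trans (Gen.same_sigma _)
    have e4 := e1.trans (((triv_assoc_inv _ _ _).same_comp _).trans
      ((triv_assoc _ _ _).comp_same _)).symm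
    have e5 := (e2.comp (e4)).trans
      ((triv_assoc _ _ _).same_comp _).symm
    refine (Trans.eval_trans _ _).trans (Eq.trans ?_ (Trans.eval_trans _ _).symm)
    refine (congrArg (fun x => x ≫ _) (Trans.eval_trans
      ((Trans.of (sigma D')).whiskerL (single (ver A q)))
      ((Trans.of (sigma D)).whiskerR (single (ver A p'))))).trans (Same.eq ?_)
    refine ((Trans.triv_whiskerL (single (hor B i₁))
      (Trans.triv_gamma (k := .ver) p p' _ rfl)).comp_same _).trans
      (Same.trans ?_ ((Trans.triv_whiskerR (single (hor B i₃))
        (Trans.triv_gamma (k := .ver) q q' _ rfl)).same_comp _).symm)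
    exact e5.trans e3.symm

/-- The image of a `2`-cell. -/
def evalCell {X Y : C} {a b : TPath A B X Y} (s : a ⟶ b) : a.eval ⟶ b.eval :=
  Quotient.lift Trans.eval (fun _ _ r => Rel.eval_eq r) s

variable (A B)

/-- The `2`-functor from the `2`-category generated by the double category of `(A, B)`-squares to
`C`. It is the identity on objects, sends a path to its composite, the transformation `sigma D` to
the `2`-cell of the square `D`, and the other elementary transformations to identities. -/
def evalFunctor : StrictPseudofunctor (TQ A B) C :=
  StrictPseudofunctor.mk''
    { obj X := X.as
      map f := TPath.eval f
      map₂ s := evalCell s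
      map₂_id _ := rfl
      map₂_comp := by
        rintro X Y f g h ⟨s⟩ ⟨t⟩
        exact Trans.eval_trans s t
      map_id _ := rfl
      map_comp f g := TPath.eval_comp f g
      map₂_whisker_left := by
        rintro X Y Z f g h ⟨s⟩
        obtain ⟨_, _, e⟩ := Trans.same_whiskerL f s
        exact e
      map₂_whisker_right := by
        rintro X Y Z f g ⟨s⟩ h
        obtain ⟨_, _, e⟩ := Trans.same_whiskerR s h
        exact e }

/-- The `(2,1)`-category obtained from the double category of `(A, B)`-squares in `C`: all
`2`-cells of the `2`-category generated by the double category are inverted. -/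
abbrev Glue := Loc (TQ A B)

variable [IsLocallyGroupoid C]

/-- The `2`-functor from `Glue A B` to the `(2,1)`-category `C` induced by `evalFunctor A B`. -/
noncomputable def Glue.toBase : StrictPseudofunctor (Glue A B) C := Loc.lift (evalFunctor A B)

end Eval

/-! ### The category of `2`-cells up to connection -/

section Ho

universe w₁ v₁ u₁ v₂ u₂

/-- The objects of the category associated to a `2`-category `D`, which are those of `D`. -/
structure Ho (D : Type u₁) where
  /-- the underlying object -/
  as : D

variable {D : Type u₁} [Bicategory.{w₁, v₁} D]

theorem zigzag_comp {X Y Z : D} {f f' : X ⟶ Y} {g g' : Y ⟶ Z} (h : Zigzag f f')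
    (k : Zigzag g g') : Zigzag (f ≫ g) (f' ≫ g') :=
  (zigzag_obj_of_zigzag (postcomp X g) h).trans (zigzag_obj_of_zigzag (precomp Z f') k)

/-- The category associated to a `2`-category: the set of morphisms from `X` to `Y` is the set of
connected components of the category of morphisms from `X` to `Y` of the `2`-category. -/
instance Ho.category : Category (Ho D) where
  Hom X Y := CategoryTheory.ConnectedComponents (X.as ⟶ Y.as)
  id X := CategoryTheory.ConnectedComponents.mk (𝟙 X.as)
  comp := Quotient.map₂ (fun f g => f ≫ g) fun _ _ h _ _ k => zigzag_comp h k
  id_comp := by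
    rintro X Y ⟨f⟩
    exact Quotient.sound (s := Zigzag.setoid _) (Zigzag.of_hom (λ_ f).hom)
  comp_id := by
    rintro X Y ⟨f⟩
    exact Quotient.sound (s := Zigzag.setoid _) (Zigzag.of_hom (ρ_ f).hom)
  assoc := by
    rintro X Y Z W ⟨f⟩ ⟨g⟩ ⟨h⟩
    exact Quotient.sound (s := Zigzag.setoid _) (Zigzag.of_hom (α_ f g h).hom)

/-- The class of a morphism. -/
def Ho.mkHom {X Y : D} (f : X ⟶ Y) : (Ho.mk X) ⟶ (Ho.mk Y) := CategoryTheory.ConnectedComponents.mk f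

theorem eq_of_zigzag_of_hom {E : Type u₁} [Category.{v₁} E] {S : Type v₂} (F : E → S)
    (hF : ∀ {f g : E}, (f ⟶ g) → F f = F g) {f g : E} (h : Zigzag f g) : F f = F g := by
  induction h with
  | refl => rfl
  | tail _ h ih => exact ih.trans (h.elim (fun ⟨s⟩ => hF s) (fun ⟨s⟩ => (hF s).symm))

/-- A functor on the category associated to a `2`-category, defined by its values on objects and
morphisms. -/
def Ho.lift {K : Type u₂} [Category.{v₂} K] (obj : D → K)
    (map : ∀ {X Y : D}, (X ⟶ Y) → (obj X ⟶ obj Y))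
    (map_cell : ∀ {X Y : D} {f g : X ⟶ Y}, (f ⟶ g) → map f = map g)
    (map_id : ∀ X : D, map (𝟙 X) = 𝟙 (obj X))
    (map_comp : ∀ {X Y Z : D} (f : X ⟶ Y) (g : Y ⟶ Z), map (f ≫ g) = map f ≫ map g) :
    Ho D ⥤ K where
  obj X := obj X.as
  map {X Y} := Quotient.lift map fun _ _ h =>
    eq_of_zigzag_of_hom map (fun s => map_cell s) h
  map_id X := by exact map_id X.as
  map_comp := by
    rintro X Y Z ⟨f⟩ ⟨g⟩
    exact map_comp f g

end Ho

/-! ### Fundamental groups of categories -/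

section FundamentalGroup

universe v₁ u₁ v₂ u₂

variable {D : Type u₁} [Category.{v₁} D] {D' : Type u₂} [Category.{v₂} D']

/-- The fundamental group of a category at an object `x`: the group of automorphisms of `x` in the
groupoid obtained by inverting all morphisms. -/
abbrev FundGroup (D : Type u₁) [Category.{v₁} D] (x : D) := Aut (FreeGroupoid.mk x)

/-- The homomorphism of fundamental groups induced by a functor. -/
def FundGroup.map (F : D ⥤ D') (x : D) : FundGroup D x →* FundGroup D' (F.obj x) :=
  (FreeGroupoid.map F).mapAut (FreeGroupoid.mk x)

end FundamentalGroup

/-! ### Compactifications of a morphism -/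

/-- A compactification `(Z, i, p, α)` of `f`. The subcategory `P` only plays a role in the
definition of the morphisms between compactifications. -/
structure Comp (A B P : Arrowy C) {X Y : C} (f : X ⟶ Y) where
  /-- the intermediate object `Z` -/
  mid : C
  /-- the morphism `i` of `A` -/
  i : A.Mor X mid
  /-- the morphism `p` of `B` -/
  p : B.Mor mid Y
  /-- the invertible `2`-cell `α : p ∘ i ⇒ f` -/
  α : i.val ≫ p.val ≅ f

namespace Comp

variable {P : Arrowy C} {X Y : C} {f : X ⟶ Y}

/-- A morphism `(r, γ, δ)` of compactifications `(Z, i, p, α) ⟶ (W, j, q, β)`. -/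
@[ext]
structure Hom (κ l : Comp A B P f) where
  /-- the morphism `r : Z ⟶ W` of `P` -/
  r : P.Mor κ.mid l.mid
  /-- the `2`-cell `γ : r ∘ i ⇒ j` -/
  γ : κ.i.val ≫ r.val ⟶ l.i.val
  /-- the `2`-cell `δ : q ∘ r ⇒ p` -/
  δ : r.val ≫ l.p.val ⟶ κ.p.val
  comm : κ.i.val ◁ δ ≫ κ.α.hom =
    (α_ κ.i.val r.val l.p.val).inv ≫ γ ▷ l.p.val ≫ l.α.hom

/-- A `2`-cell `(r, γ, δ) ⇒ (r', γ', δ')`. -/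
@[ext]
structure Hom₂ {κ l : Comp A B P f} (s t : Hom κ l) where
  /-- the underlying `2`-cell `r ⇒ r'` -/
  cell : s.r.val ⟶ t.r.val
  left : s.γ = κ.i.val ◁ cell ≫ t.γ
  right : s.δ = cell ▷ l.p.val ≫ t.δ

/-- The category of morphisms between two compactifications. -/
@[simps]
instance homCat (κ l : Comp A B P f) : Category (Hom κ l) where
  Hom s t := Hom₂ s t
  id s := ⟨𝟙 _, by simp, by simp⟩
  comp x y := ⟨x.cell ≫ y.cell, by rw [x.left, y.left]; simp, by rw [x.right, y.right]; simp⟩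
  id_comp x := Hom₂.ext (Category.id_comp _)
  comp_id x := Hom₂.ext (Category.comp_id _)
  assoc x y z := Hom₂.ext (Category.assoc _ _ _)

/-- The identity of a compactification. -/
@[simps]
abbrev Hom.id (κ : Comp A B P f) : Hom κ κ where
  r := P.one κ.mid
  γ := (ρ_ κ.i.val).hom
  δ := (λ_ κ.p.val).hom
  comm := by simp

/-- Composition of morphisms of compactifications. -/
@[simps]
abbrev Hom.comp {κ l m : Comp A B P f} (s : Hom κ l) (t : Hom l m) : Hom κ m where
  r := s.r.comp t.r
  γ := (α_ κ.i.val s.r.val t.r.val).inv ≫ s.γ ▷ t.r.val ≫ t.γ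
  δ := (α_ s.r.val t.r.val m.p.val).hom ≫ s.r.val ◁ t.δ ≫ s.δ
  comm := by
    have h1 : κ.i.val ◁ s.r.val ◁ t.δ ≫ (α_ κ.i.val s.r.val l.p.val).inv ≫ s.γ ▷ l.p.val =
        (α_ κ.i.val s.r.val (t.r.val ≫ m.p.val)).inv ≫ s.γ ▷ _ ≫ l.i.val ◁ t.δ := by
      rw [← whisker_exchange]
      simp
    simp only [Bicategory.whiskerLeft_comp, Category.assoc, s.comm]
    rw [reassoc_of% h1, t.comm]
    simp

/-- An isomorphism of morphisms of compactifications. -/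
@[simps]
def Hom.isoMk {κ l : Comp A B P f} {s t : Hom κ l} (e : s.r.val ≅ t.r.val)
    (h : s.γ = κ.i.val ◁ e.hom ≫ t.γ) (k : s.δ = e.hom ▷ l.p.val ≫ t.δ) : s ≅ t where
  hom := ⟨e.hom, h, k⟩
  inv := ⟨e.inv, by rw [h]; simp, by rw [k]; simp⟩
  hom_inv_id := Hom₂.ext e.hom_inv_id
  inv_hom_id := Hom₂.ext e.inv_hom_id

/-- The `2`-category of compactifications of `f`. -/
instance bicategory : Bicategory (Comp A B P f) where
  Hom κ l := Hom κ l
  id κ := Hom.id κ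
  comp s t := s.comp t
  homCategory κ l := homCat κ l
  whiskerLeft {κ l m} s t t' x := ⟨s.r.val ◁ x.cell,
    by simp [x.left, ← whisker_exchange_assoc], by simp [x.right]⟩
  whiskerRight {κ l m} s s' x t := ⟨x.cell ▷ t.r.val,
    by simp [x.left], by simp [x.right, whisker_exchange_assoc]⟩
  associator s t u := Hom.isoMk (α_ s.r.val t.r.val u.r.val) (by simp) (by simp)
  leftUnitor s := Hom.isoMk (λ_ s.r.val) (by simp) (by simp)
  rightUnitor s := Hom.isoMk (ρ_ s.r.val) (by simp) (by simp)
  whiskerLeft_id _ _ := Hom₂.ext (by simp)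
  whiskerLeft_comp _ _ _ _ _ _ := Hom₂.ext (by simp)
  id_whiskerLeft _ := Hom₂.ext (by simp)
  comp_whiskerLeft _ _ _ _ _ := Hom₂.ext (by simp)
  id_whiskerRight _ _ := Hom₂.ext (by simp)
  comp_whiskerRight _ _ _ := Hom₂.ext (by simp)
  whiskerRight_id _ := Hom₂.ext (by simp)
  whiskerRight_comp _ _ _ := Hom₂.ext (by simp)
  whisker_assoc _ _ _ _ _ := Hom₂.ext (by simp)
  whisker_exchange x y := Hom₂.ext (by simp [whisker_exchange])
  pentagon _ _ _ _ := Hom₂.ext (by simp)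
  triangle _ _ := Hom₂.ext (by simp)

end Comp

/-! ### Computations in the `2`-category generated by the double category -/

namespace TQ

/-- The morphism given by an edge. -/
def edge (A B : Arrowy C) (k : Dir) {X Y : C} (f : (side A B k).Mor X Y) :
    (TQ.mk X : TQ A B) ⟶ TQ.mk Y := single ⟨k, f⟩

/-- The `2`-cell `iota`. -/
def u (A B : Arrowy C) (k : Dir) (X : C) :
    𝟙 (TQ.mk X : TQ A B) ⟶ edge A B k ((side A B k).one X) := (Trans.of (iota k X)).toHom

/-- The `2`-cell `theta`. -/
def v (A B : Arrowy C) (k : Dir) (X : C) :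
    edge A B k ((side A B k).one X) ⟶ 𝟙 (TQ.mk X : TQ A B) := (Trans.of (theta k X)).toHom

/-- The `2`-cell `gamma`. -/
def m (A B : Arrowy C) (k : Dir) {X Y Z : C} (f : (side A B k).Mor X Y)
    (g : (side A B k).Mor Y Z) (h : (side A B k).Mor X Z) (e : f.comp g = h) :
    edge A B k f ≫ edge A B k g ⟶ edge A B k h := (Trans.of (gamma f g h e)).toHom

/-- The `2`-cell `sigma D`. -/
def sq {X Y Z W : C} {j : A.Mor X Y} {q : B.Mor X Z} {p : B.Mor Y W} {i : A.Mor Z W}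
    (D : Sq A B j q p i) :
    edge A B .ver q ≫ edge A B .hor i ⟶ edge A B .hor j ≫ edge A B .ver p :=
  (Trans.of (sigma D)).toHom

theorem u_v (k : Dir) (X : C) : u A B k X ≫ v A B k X = 𝟙 _ := Quotient.sound (.iota_theta k X)

theorem v_u (k : Dir) (X : C) : v A B k X ≫ u A B k X = 𝟙 _ := Quotient.sound (.theta_iota k X)

theorem toHom_of_rel {X Y : C} {a b : TPath A B X Y} {s t : Trans a b} (h : Rel s t) :
    s.toHom = t.toHom := Quotient.sound h

theorem u_m {k : Dir} {X Y : C} (f : (side A B k).Mor X Y)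
    (e : ((side A B k).one X).comp f = f) :
    u A B k X ▷ edge A B k f ≫ m A B k _ f f e = (λ_ (edge A B k f)).hom := by
  have key : ∀ (g : (side A B k).Mor X Y) (e' : ((side A B k).one X).comp f = g),
      (Trans.of (delta (A := A) (B := B) _ _ g e')).toHom ≫ (Trans.of (gamma _ _ g e')).toHom =
        𝟙 _ := by
    rintro g rfl
    exact toHom_of_rel (.delta_gamma _ _)
  refine Eq.trans ?_ (key f e)
  exact congrArg (fun x : (single ⟨k, f⟩ : TPath A B X Y) ⟶ _ => x ≫ m A B k _ f f e)
    (toHom_of_rel (.iota_delta f e))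

theorem m_u {k : Dir} {X Y : C} (f : (side A B k).Mor X Y)
    (e : f.comp ((side A B k).one Y) = f) :
    edge A B k f ◁ u A B k Y ≫ m A B k f _ f e = (ρ_ (edge A B k f)).hom := by
  have key : ∀ (g : (side A B k).Mor X Y) (e' : f.comp ((side A B k).one Y) = g),
      (Trans.of (delta (A := A) (B := B) _ _ g e')).toHom ≫ (Trans.of (gamma _ _ g e')).toHom =
        𝟙 _ := by
    rintro g rfl
    exact toHom_of_rel (.delta_gamma _ _)
  refine Eq.trans ?_ (key f e)
  exact congrArg (fun x : (single ⟨k, f⟩ : TPath A B X Y) ⟶ _ => x ≫ m A B k f _ f e)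
    (toHom_of_rel (.delta_iota f e))

theorem m_one_left {k : Dir} {X Y : C} (f : (side A B k).Mor X Y)
    (e : ((side A B k).one X).comp f = f) :
    m A B k _ f f e = v A B k X ▷ edge A B k f ≫ (λ_ (edge A B k f)).hom := by
  rw [← u_m f e, ← comp_whiskerRight_assoc, v_u]
  simp

theorem m_one_right {k : Dir} {X Y : C} (f : (side A B k).Mor X Y)
    (e : f.comp ((side A B k).one Y) = f) :
    m A B k f _ f e = edge A B k f ◁ v A B k Y ≫ (ρ_ (edge A B k f)).hom := by
  rw [← m_u f e, ← Bicategory.whiskerLeft_comp_assoc, v_u]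
  simp

theorem m_assoc {k : Dir} {X Y Z W : C} (f : (side A B k).Mor X Y) (g : (side A B k).Mor Y Z)
    (h : (side A B k).Mor Z W) (fg : (side A B k).Mor X Z) (gh : (side A B k).Mor Y W)
    (fgh : (side A B k).Mor X W) (e₁ : f.comp g = fg) (e₂ : g.comp h = gh)
    (e₃ : fg.comp h = fgh) (e₄ : f.comp gh = fgh) :
    m A B k f g fg e₁ ▷ edge A B k h ≫ m A B k fg h fgh e₃ =
      (α_ (edge A B k f) (edge A B k g) (edge A B k h)).hom ≫ edge A B k f ◁ m A B k g h gh e₂ ≫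
        m A B k f gh fgh e₄ := by
  subst e₁ e₂ e₄
  exact toHom_of_rel (.gamma_gamma f g h e₃)

theorem sq_idHor {X Y : C} (f : A.Mor X Y) :
    u A B .ver X ▷ edge A B .hor f ≫ sq (Sq.idHor f) =
      (λ_ (edge A B .hor f)).hom ≫ (ρ_ (edge A B .hor f)).inv ≫
        edge A B .hor f ◁ u A B .ver Y :=
  toHom_of_rel (.sigma_idHor f)

theorem sq_idVer {X Y : C} (f : B.Mor X Y) :
    edge A B .ver f ◁ u A B .hor Y ≫ sq (Sq.idVer f) =
      (ρ_ (edge A B .ver f)).hom ≫ (λ_ (edge A B .ver f)).inv ≫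
        u A B .hor X ▷ edge A B .ver f :=
  toHom_of_rel (.sigma_idVer f)

theorem sq_hcomp {X₁ X₂ X₃ Y₁ Y₂ Y₃ : C} {j : A.Mor X₁ X₂} {j' : A.Mor X₂ X₃}
    {j'' : A.Mor X₁ X₃} {i : A.Mor Y₁ Y₂} {i' : A.Mor Y₂ Y₃} {i'' : A.Mor Y₁ Y₃}
    {p₁ : B.Mor X₁ Y₁} {p₂ : B.Mor X₂ Y₂} {p₃ : B.Mor X₃ Y₃}
    (D : Sq A B j p₁ p₂ i) (D' : Sq A B j' p₂ p₃ i') (D'' : Sq A B j'' p₁ p₃ i'')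
    (hj : j.comp j' = j'') (hi : i.comp i' = i'') (h : Same D''.cell (D.hcomp D').cell) :
    sq D ▷ edge A B .hor i' ≫ (α_ _ _ _).hom ≫ edge A B .hor j ◁ sq D' ≫ (α_ _ _ _).inv ≫
        m A B .hor j j' j'' hj ▷ edge A B .ver p₃ =
      (α_ _ _ _).hom ≫ edge A B .ver p₁ ◁ m A B .hor i i' i'' hi ≫ sq D'' := by
  subst hj hi
  obtain ⟨c⟩ := D''
  obtain rfl : c = _ := h.eq
  exact toHom_of_rel (.sigma_hcomp D D')

theorem sq_vcomp {X₁ X₂ X₃ Y₁ Y₂ Y₃ : C} {i₁ : A.Mor X₁ Y₁} {i₂ : A.Mor X₂ Y₂}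
    {i₃ : A.Mor X₃ Y₃} {q : B.Mor X₁ X₂} {q' : B.Mor X₂ X₃} {q'' : B.Mor X₁ X₃}
    {p : B.Mor Y₁ Y₂} {p' : B.Mor Y₂ Y₃} {p'' : B.Mor Y₁ Y₃}
    (D : Sq A B i₁ q p i₂) (D' : Sq A B i₂ q' p' i₃) (D'' : Sq A B i₁ q'' p'' i₃)
    (hq : q.comp q' = q'') (hp : p.comp p' = p'') (h : Same D''.cell (D.vcomp D').cell) :
    edge A B .ver q ◁ sq D' ≫ (α_ _ _ _).inv ≫ sq D ▷ edge A B .ver p' ≫ (α_ _ _ _).hom ≫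
        edge A B .hor i₁ ◁ m A B .ver p p' p'' hp =
      (α_ _ _ _).inv ≫ m A B .ver q q' q'' hq ▷ edge A B .hor i₃ ≫ sq D'' := by
  subst hq hp
  obtain ⟨c⟩ := D''
  obtain rfl : c = _ := h.eq
  exact toHom_of_rel (.sigma_vcomp D D')

end TQ

namespace TQ

/-- A `2`-cell between vertical morphisms, as a square whose horizontal edges are identities. -/
def sqOf {X Y : C} {p p' : B.Mor X Y} (δ : p.val ⟶ p'.val) :
    Sq A B (A.one X) p p' (A.one Y) := ⟨(ρ_ p.val).hom ≫ δ ≫ (λ_ p'.val).inv⟩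

variable (A) in
/-- The image of a `2`-cell `δ` of `B` under the pseudofunctor from `B` to the `2`-category
generated by the double category: an identity of `A` is inserted, the transformation `sigma` of the
square given by `δ` is applied, and the identity is deleted. -/
def verCell {X Y : C} {p p' : B.Mor X Y} (δ : p.val ⟶ p'.val) :
    edge A B .ver p ⟶ edge A B .ver p' :=
  (ρ_ _).inv ≫ edge A B .ver p ◁ u A B .hor Y ≫ sq (sqOf δ) ≫
    v A B .hor X ▷ edge A B .ver p' ≫ (λ_ _).hom

theorem verCell_id {X Y : C} (p : B.Mor X Y) : verCell A (𝟙 p.val) = 𝟙 _ := by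
  have h : (sqOf (𝟙 p.val) : Sq A B _ p p _) = Sq.idVer p := by simp [sqOf, Sq.idVer]
  have h1 := sq_idVer (A := A) p
  rw [verCell, h, reassoc_of% h1, ← comp_whiskerRight_assoc, u_v]
  simp

variable [Strict C]

theorem same_sqOf {X Y : C} {p p' : B.Mor X Y} (δ : p.val ⟶ p'.val) :
    Same (sqOf (A := A) δ).cell δ :=
  ((triv_rightUnitor _).same_comp _).trans ((triv_leftUnitor_inv _).comp_same _)

theorem sq_right {X Y Z W : C} {j : A.Mor X Y} {q : B.Mor X Z} {p p' : B.Mor Y W}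
    {i : A.Mor Z W} (D : Sq A B j q p i) (δ : p.val ⟶ p'.val) (D' : Sq A B j q p' i)
    (h : D'.cell = D.cell ≫ j.val ◁ δ) :
    sq D ≫ edge A B .hor j ◁ verCell A δ = sq D' := by
  have hs : Same D'.cell (D.hcomp (sqOf δ)).cell := by
    rw [h]
    have h1 : Same (j.val ◁ (sqOf (A := A) δ).cell) (j.val ◁ δ) := (same_sqOf δ).left rfl
    have h2 := (((triv_assoc j.val p.val (𝟙 W)).same_comp _).trans
      (((triv_assoc_inv j.val (𝟙 Y) p'.val).comp_same _).trans h1)).symm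
    exact (Same.comp (same_right_id D.cell).symm h2).trans
      ((triv_assoc_inv q.val i.val (𝟙 W)).same_comp _).symm
  have hj : j.comp (A.one Y) = j := Arrowy.Mor.ext (Strict.comp_id _)
  have hi : i.comp (A.one W) = i := Arrowy.Mor.ext (Strict.comp_id _)
  have key := sq_hcomp D (sqOf δ) D' hj hi hs
  rw [m_one_right, m_one_right] at key
  calc sq D ≫ edge A B .hor j ◁ verCell A δ
      = sq D ⊗≫ ((edge A B .hor j ≫ edge A B .ver p) ◁ u A B .hor W) ⊗≫
          edge A B .hor j ◁ sq (sqOf δ) ⊗≫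
            (edge A B .hor j ◁ v A B .hor Y) ▷ edge A B .ver p' ⊗≫ 𝟙 _ := by
        rw [verCell]
        bicategory
    _ = 𝟙 _ ⊗≫ (sq D ▷ 𝟙 _ ≫ (edge A B .hor j ≫ edge A B .ver p) ◁ u A B .hor W) ⊗≫
          edge A B .hor j ◁ sq (sqOf δ) ⊗≫
            (edge A B .hor j ◁ v A B .hor Y) ▷ edge A B .ver p' ⊗≫ 𝟙 _ := by bicategory
    _ = 𝟙 _ ⊗≫ (edge A B .ver q ≫ edge A B .hor i) ◁ u A B .hor W ⊗≫
          (sq D ▷ edge A B .hor (A.one W) ≫ (α_ _ _ _).hom ≫ edge A B .hor j ◁ sq (sqOf δ) ≫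
            (α_ _ _ _).inv ≫
            (edge A B .hor j ◁ v A B .hor Y ≫ (ρ_ _).hom) ▷ edge A B .ver p') := by
        rw [← whisker_exchange]
        bicategory
    _ = sq D' := by
        erw [key]
        calc _ = 𝟙 _ ⊗≫ (edge A B .ver q ≫ edge A B .hor i) ◁ (u A B .hor W ≫ v A B .hor W) ⊗≫
              sq D' := by
              bicategory
          _ = sq D' := by
              rw [u_v]
              bicategory

theorem verCell_comp {X Y : C} {p p' p'' : B.Mor X Y} (δ : p.val ⟶ p'.val)
    (δ' : p'.val ⟶ p''.val) : verCell A (δ ≫ δ') = verCell A δ ≫ verCell A δ' := by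
  have h := sq_right (A := A) (sqOf δ) δ' (sqOf (δ ≫ δ')) (by simp [sqOf])
  have e : verCell A (δ ≫ δ') = (ρ_ _).inv ≫ edge A B .ver p ◁ u A B .hor Y ≫
    sq (sqOf (δ ≫ δ')) ≫ v A B .hor X ▷ edge A B .ver p'' ≫ (λ_ _).hom := rfl
  rw [e, ← h]
  generalize verCell A δ' = w
  rw [verCell]
  simp only [Category.assoc]
  rw [whisker_exchange_assoc]
  simp

theorem verCell_m {X Y Z : C} {r r' : B.Mor X Y} {q q' : B.Mor Y Z} {rq r'q' : B.Mor X Z}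
    (hr : r.comp q = rq) (hr' : r'.comp q' = r'q') (δ : r.val ⟶ r'.val) (δ' : q.val ⟶ q'.val)
    (δ'' : rq.val ⟶ r'q'.val) (h : Same δ'' (r.val ◁ δ' ≫ δ ▷ q'.val)) :
    edge A B .ver r ◁ verCell A δ' ≫ verCell A δ ▷ edge A B .ver q' ≫
        m A B .ver r' q' r'q' hr' =
      m A B .ver r q rq hr ≫ verCell A δ'' := by
  have hs : Same (sqOf (A := A) δ'').cell ((sqOf (A := A) δ).vcomp (sqOf δ')).cell := by
    have h0 : Same (sqOf (A := A) δ'').cell δ'' := same_sqOf δ''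
    have h1 : Same (r.val ◁ (sqOf (A := A) δ').cell) (r.val ◁ δ') := (same_sqOf δ').left rfl
    have h2 : Same ((sqOf (A := A) δ).cell ▷ q'.val) (δ ▷ q'.val) := (same_sqOf δ).right rfl
    refine (h0.trans h).trans (Same.symm ?_)
    refine ((triv_assoc _ _ _).same_comp _).trans (h1.comp ?_)
    exact ((triv_assoc_inv _ _ _).same_comp _).trans (((triv_assoc _ _ _).comp_same _).trans h2)
  have key := sq_vcomp (sqOf δ) (sqOf δ') (sqOf δ'') hr hr' hs
  calc edge A B .ver r ◁ verCell A δ' ≫ verCell A δ ▷ edge A B .ver q' ≫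
        m A B .ver r' q' r'q' hr'
      = 𝟙 _ ⊗≫ edge A B .ver r ◁ edge A B .ver q ◁ u A B .hor Z ⊗≫
          edge A B .ver r ◁ sq (sqOf δ') ⊗≫
          edge A B .ver r ◁ (v A B .hor Y ≫ u A B .hor Y) ▷ edge A B .ver q' ⊗≫
          sq (sqOf δ) ▷ edge A B .ver q' ⊗≫
          (v A B .hor X ▷ (edge A B .ver r' ≫ edge A B .ver q') ≫ _ ◁ m A B .ver r' q' r'q' hr')
            ⊗≫ 𝟙 _ := by
        simp only [verCell]
        bicategory
    _ = 𝟙 _ ⊗≫ edge A B .ver r ◁ edge A B .ver q ◁ u A B .hor Z ⊗≫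
          (edge A B .ver r ◁ sq (sqOf δ') ≫ (α_ _ _ _).inv ≫
          sq (sqOf δ) ▷ edge A B .ver q' ≫ (α_ _ _ _).hom ≫
          edge A B .hor (A.one X) ◁ m A B .ver r' q' r'q' hr') ⊗≫
            v A B .hor X ▷ edge A B .ver r'q' ⊗≫ 𝟙 _ := by
        rw [v_u, ← whisker_exchange]
        bicategory
    _ = 𝟙 _ ⊗≫ ((edge A B .ver r ≫ edge A B .ver q) ◁ u A B .hor Z ≫
          m A B .ver r q rq hr ▷ edge A B .hor (A.one Z)) ⊗≫ sq (sqOf δ'') ⊗≫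
            v A B .hor X ▷ edge A B .ver r'q' ⊗≫ 𝟙 _ := by
        rw [key]
        bicategory
    _ = m A B .ver r q rq hr ≫ verCell A δ'' := by
        erw [whisker_exchange]
        rw [verCell]
        bicategory

end TQ

/-! ### The `2`-cell given by a morphism of compactifications -/

namespace Comp

open TQ

variable {X Y : C} {f : X ⟶ Y}

/-- The morphism `p * i` of the `2`-category generated by the double category. -/
abbrev path {P : Arrowy C} (κ : Comp A B P f) : (TQ.mk X : TQ A B) ⟶ TQ.mk Y :=
  edge A B .hor κ.i ≫ edge A B .ver κ.p

variable [IsLocallyGroupoid C]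

/-- The square given by the inverse of `γ`, whose left edge is the identity. -/
noncomputable def Hom.square {κ l : Comp A B B f} (s : Hom κ l) :
    Sq A B κ.i (B.one X) s.r l.i := ⟨(λ_ l.i.val).hom ≫ inv s.γ⟩

/-- The composite `j ⇒ j * 1 ⇒ r * i` of `iota` and the transformation `sigma` of the square given
by `γ⁻¹`. -/
noncomputable def Hom.cellA {κ l : Comp A B B f} (s : Hom κ l) :
    edge A B .hor l.i ⟶ edge A B .hor κ.i ≫ edge A B .ver s.r :=
  (λ_ _).inv ≫ u A B .ver X ▷ edge A B .hor l.i ≫ sq s.square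

variable [Strict C]

/-- The composite `q * r ⇒ qr ⇒ p` of `gamma` and the image of `δ`. -/
def Hom.cellB {κ l : Comp A B B f} (s : Hom κ l) :
    edge A B .ver s.r ≫ edge A B .ver l.p ⟶ edge A B .ver κ.p :=
  m A B .ver s.r l.p (s.r.comp l.p) rfl ≫ verCell A s.δ

/-- The `2`-cell `q * j ⇒ q * j * 1 ⇒ q * r * i ⇒ qr * i ⇒ p * i` given by a morphism `(r, γ, δ)` of
compactifications `(Z, i, p, α) ⟶ (W, j, q, β)`. -/
noncomputable def Hom.pathCell {κ l : Comp A B B f} (s : Hom κ l) : path l ⟶ path κ :=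
  s.cellA ▷ edge A B .ver l.p ≫ (α_ _ _ _).hom ≫ edge A B .hor κ.i ◁ s.cellB

theorem Hom.cellA_id (κ : Comp A B B f) :
    (Hom.id κ).cellA = (ρ_ _).inv ≫ edge A B .hor κ.i ◁ u A B .ver κ.mid := by
  have h : (Hom.id κ).square = Sq.idHor κ.i := by simp [Hom.square, Sq.idHor]
  rw [Hom.cellA, h]
  erw [sq_idHor]
  simp

theorem m_verCell {X Y Z : C} (r : B.Mor X Y) (q : B.Mor Y Z) (rq r'q' : B.Mor X Z)
    (hr : r.comp q = rq) (hr' : r.comp q = r'q') (δ : rq.val ⟶ r'q'.val) (h : Triv δ) :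
    m A B .ver r q rq hr ≫ verCell A δ = m A B .ver r q r'q' hr' := by
  have key := verCell_m (A := A) hr hr' (𝟙 _) (𝟙 _) δ (by
    obtain ⟨h, rfl⟩ := h
    exact ⟨by rw [← hr], by rw [← hr'], by simp⟩)
  rw [← key, verCell_id, verCell_id]
  simp

theorem Hom.cellB_id (κ : Comp A B B f) :
    (Hom.id κ).cellB = v A B .ver κ.mid ▷ edge A B .ver κ.p ≫ (λ_ _).hom := by
  have e : (B.one κ.mid).comp κ.p = κ.p := Arrowy.Mor.ext (Strict.id_comp _)
  rw [← m_one_left (k := .ver) κ.p e]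
  exact m_verCell _ _ _ _ rfl e _ (triv_leftUnitor _)

theorem Hom.pathCell_id (κ : Comp A B B f) : (Hom.id κ).pathCell = 𝟙 _ := by
  rw [Hom.pathCell, Hom.cellA_id, Hom.cellB_id]
  calc _ = 𝟙 _ ⊗≫ edge A B .hor κ.i ◁ (u A B .ver κ.mid ≫ v A B .ver κ.mid) ▷
        edge A B .ver κ.p ⊗≫ 𝟙 _ := by bicategory
    _ = 𝟙 _ := by
      rw [u_v]
      bicategory

theorem Hom.cellA_comp {κ l n : Comp A B B f} (s : Hom κ l) (t : Hom l n) :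
    (s.comp t).cellA = t.cellA ≫ s.cellA ▷ edge A B .ver t.r ≫ (α_ _ _ _).hom ≫
      edge A B .hor κ.i ◁ m A B .ver s.r t.r (s.r.comp t.r) rfl := by
  have e : (B.one X).comp (B.one X) = B.one X := Arrowy.Mor.ext (Strict.id_comp _)
  have hs : Same (s.comp t).square.cell (s.square.vcomp t.square).cell := by
    have h0 : (s.comp t).square.cell = (λ_ _).hom ≫ inv t.γ ≫ inv s.γ ▷ t.r.val ≫
        (α_ _ _ _).hom := by simp [Hom.square]
    have h1 : Same (𝟙 X ◁ t.square.cell) (inv t.γ) :=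
      (same_id_left _).trans ((triv_leftUnitor _).same_comp _)
    have h2 : Same (s.square.cell ▷ t.r.val) (inv s.γ ▷ t.r.val) :=
      Same.right ((triv_leftUnitor _).same_comp _) rfl
    rw [h0]
    refine ((triv_leftUnitor _).same_comp _).trans (Same.symm ?_)
    refine ((triv_assoc _ _ _).same_comp _).trans (h1.comp ?_)
    refine ((triv_assoc_inv _ _ _).same_comp _).trans (h2.comp (Same.refl _))
  have key := sq_vcomp s.square t.square (s.comp t).square e rfl hs
  rw [m_one_left] at key
  symm
  calc _ = (λ_ _).inv ≫ u A B .ver X ▷ edge A B .hor n.i ⊗≫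
          (𝟙 _ ◁ sq t.square ≫ u A B .ver X ▷ (edge A B .hor l.i ≫ edge A B .ver t.r)) ⊗≫
          sq s.square ▷ edge A B .ver t.r ≫ (α_ _ _ _).hom ≫
            edge A B .hor κ.i ◁ m A B .ver s.r t.r (s.r.comp t.r) rfl := by
        simp only [Hom.cellA]
        bicategory
    _ = (λ_ _).inv ≫ u A B .ver X ▷ edge A B .hor n.i ⊗≫
          u A B .ver X ▷ (edge A B .ver (B.one X) ≫ edge A B .hor n.i) ⊗≫
          (edge A B .ver (B.one X) ◁ sq t.square ≫ (α_ _ _ _).inv ≫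
          sq s.square ▷ edge A B .ver t.r ≫ (α_ _ _ _).hom ≫
            edge A B .hor κ.i ◁ m A B .ver s.r t.r (s.r.comp t.r) rfl) := by
        rw [whisker_exchange]
        bicategory
    _ = (λ_ _).inv ≫ u A B .ver X ▷ edge A B .hor n.i ⊗≫
          (u A B .ver X ≫ v A B .ver X) ▷ (edge A B .ver (B.one X) ≫ edge A B .hor n.i) ⊗≫
          sq (s.comp t).square := by
        erw [key]
        bicategory
    _ = (s.comp t).cellA := by
        rw [u_v, Hom.cellA]
        bicategory

theorem Hom.cellB_comp {κ l n : Comp A B B f} (s : Hom κ l) (t : Hom l n) :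
    m A B .ver s.r t.r (s.r.comp t.r) rfl ▷ edge A B .ver n.p ≫ (s.comp t).cellB =
      (α_ _ _ _).hom ≫ edge A B .ver s.r ◁ t.cellB ≫ s.cellB := by
  have e : s.r.comp (t.r.comp n.p) = (s.r.comp t.r).comp n.p :=
    Arrowy.Mor.ext (Strict.assoc _ _ _).symm
  have h1 := m_assoc (A := A) (k := .ver) s.r t.r n.p (s.r.comp t.r) (t.r.comp n.p)
    ((s.r.comp t.r).comp n.p) rfl rfl rfl e
  have h2 := verCell_m (A := A) (rq := (s.r.comp t.r).comp n.p) (r'q' := s.r.comp l.p) e rfl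
    (𝟙 _) t.δ ((α_ _ _ _).hom ≫ s.r.val ◁ t.δ) (by
      rw [id_whiskerRight, Category.comp_id]
      exact (triv_assoc _ _ _).same_comp _)
  rw [verCell_id, id_whiskerRight, Category.id_comp] at h2
  have h3 := verCell_comp (A := A) (p := (s.r.comp t.r).comp n.p) (p' := s.r.comp l.p)
    (p'' := κ.p) ((α_ _ _ _).hom ≫ s.r.val ◁ t.δ) s.δ
  have h4 : (s.comp t).cellB = m A B .ver (s.r.comp t.r) n.p _ rfl ≫
      verCell A (p := (s.r.comp t.r).comp n.p) (p' := κ.p)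
        (((α_ _ _ _).hom ≫ s.r.val ◁ t.δ) ≫ s.δ) := by
    rw [Category.assoc]
    rfl
  rw [h4, h3]
  have h5 : t.cellB = m A B .ver t.r n.p _ rfl ≫ verCell A t.δ := rfl
  have h6 : s.cellB = m A B .ver s.r l.p _ rfl ≫ verCell A s.δ := rfl
  rw [h5, h6, Bicategory.whiskerLeft_comp]
  simp only [Category.assoc]
  rw [reassoc_of% h1, reassoc_of% h2]

theorem Hom.pathCell_comp {κ l n : Comp A B B f} (s : Hom κ l) (t : Hom l n) :
    (s.comp t).pathCell = t.pathCell ≫ s.pathCell := by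
  have h := Hom.cellB_comp s t
  have e : (s.comp t).pathCell = (s.comp t).cellA ▷ edge A B .ver n.p ≫ (α_ _ _ _).hom ≫
    edge A B .hor κ.i ◁ (s.comp t).cellB := rfl
  rw [e, Hom.cellA_comp]
  calc _ = t.cellA ▷ edge A B .ver n.p ≫
          s.cellA ▷ edge A B .ver t.r ▷ edge A B .ver n.p ⊗≫
          edge A B .hor κ.i ◁ (m A B .ver s.r t.r (s.r.comp t.r) rfl ▷ edge A B .ver n.p ≫
            (s.comp t).cellB) := by bicategory
    _ = t.cellA ▷ edge A B .ver n.p ⊗≫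
          (s.cellA ▷ (edge A B .ver t.r ≫ edge A B .ver n.p) ≫ _ ◁ t.cellB) ⊗≫
          edge A B .hor κ.i ◁ s.cellB := by
        rw [h]
        bicategory
    _ = _ := by
        rw [← whisker_exchange]
        simp only [Hom.pathCell]
        bicategory

theorem Hom.pathCell_eq {κ l : Comp A B B f} {s t : Hom κ l} (x : Hom₂ s t) :
    s.pathCell = t.pathCell := by
  have h1 : s.cellA ≫ edge A B .hor κ.i ◁ verCell A x.cell = t.cellA := by
    have h0 := sq_right s.square x.cell t.square (by simp [Hom.square, x.left])
    simp only [Hom.cellA, Category.assoc]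
    rw [h0]
  have h2 : verCell A x.cell ▷ edge A B .ver l.p ≫ t.cellB = s.cellB := by
    have h3 := verCell_m (A := A) (r := s.r) (r' := t.r) (q := l.p) (q' := l.p) rfl rfl
      x.cell (𝟙 _) (x.cell ▷ l.p.val) (by
        rw [Bicategory.whiskerLeft_id, Category.id_comp]
        exact Same.refl _)
    rw [verCell_id, Bicategory.whiskerLeft_id, Category.id_comp] at h3
    have h4 := verCell_comp (A := A) (p := s.r.comp l.p) (p' := t.r.comp l.p) (p'' := κ.p)
      (x.cell ▷ l.p.val) t.δ
    have h5 : t.cellB = m A B .ver t.r l.p _ rfl ≫ verCell A t.δ := rfl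
    have h6 : s.cellB = m A B .ver s.r l.p _ rfl ≫
        verCell A (p := s.r.comp l.p) (p' := κ.p) (x.cell ▷ l.p.val ≫ t.δ) := by
      rw [← x.right]
      rfl
    rw [h5, h6, h4, reassoc_of% h3]
  have e : s.pathCell = s.cellA ▷ edge A B .ver l.p ≫ (α_ _ _ _).hom ≫
    edge A B .hor κ.i ◁ s.cellB := rfl
  have e' : t.pathCell = t.cellA ▷ edge A B .ver l.p ≫ (α_ _ _ _).hom ≫
    edge A B .hor κ.i ◁ t.cellB := rfl
  rw [e, e', ← h2, ← h1]
  simp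

end Comp

theorem inv_map_id {D E : Type*} [Category* D] [Groupoid E] (F : D ⥤ E) (x : D) :
    Groupoid.inv (F.map (𝟙 x)) = 𝟙 (F.obj x) := by simp

theorem inv_map_comp {D E : Type*} [Category* D] [Groupoid E] (F : D ⥤ E) {x y z : D}
    (s : x ⟶ y) (t : y ⟶ z) :
    Groupoid.inv (F.map (s ≫ t)) = Groupoid.inv (F.map t) ≫ Groupoid.inv (F.map s) := by simp

/-- The functor from the category associated to the `2`-category of compactifications of `f` to the
category of morphisms from `X` to `Y` of `Glue A B`. It sends a compactification `(Z, i, p, α)` to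
`p * i`, and a morphism of compactifications to the inverse of its `2`-cell. -/
noncomputable def compFunctor [Strict C] [IsLocallyGroupoid C] (A B : Arrowy C) {X Y : C}
    (f : X ⟶ Y) :
    Ho (Comp A B B f) ⥤ ((⟨⟨X⟩⟩ : Glue A B) ⟶ (⟨⟨Y⟩⟩ : Glue A B)) :=
  Ho.lift (fun κ => ⟨κ.path⟩)
    (fun s => Groupoid.inv ((toLocMor _ _).map (Comp.Hom.pathCell s)))
    (fun x => by rw [Comp.Hom.pathCell_eq x])
    (fun κ => (congrArg (fun s => Groupoid.inv ((toLocMor _ _).map s))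
      (Comp.Hom.pathCell_id κ)).trans (inv_map_id (toLocMor _ _) κ.path))
    (fun s t => (congrArg (fun s => Groupoid.inv ((toLocMor _ _).map s))
      (Comp.Hom.pathCell_comp s t)).trans (inv_map_comp (toLocMor _ _) _ _))

/-! ### Compactifications of a pair of composable morphisms -/

section Simplices

/-- A strictly unital pseudofunctor from a partially ordered set to a `2`-category, with given
action on objects. -/
structure UPsFun {S : Type} [Preorder S] (obj : S → C) where
  /-- the action on morphisms -/
  map : ∀ {x y : S}, x ≤ y → (obj x ⟶ obj y)
  /-- the compatibility with composition -/
  mapComp : ∀ {x y z : S} (h : x ≤ y) (k : y ≤ z), map h ≫ map k ≅ map (h.trans k)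
  map_refl : ∀ x : S, map (le_refl x) = 𝟙 (obj x)
  mapComp_refl_left : ∀ {x y : S} (h : x ≤ y), Triv (mapComp (le_refl x) h).hom
  mapComp_refl_right : ∀ {x y : S} (h : x ≤ y), Triv (mapComp h (le_refl y)).hom
  mapComp_assoc : ∀ {x y z t : S} (h : x ≤ y) (k : y ≤ z) (l : z ≤ t),
    (mapComp h k).hom ▷ map l ≫ (mapComp (h.trans k) l).hom =
      (α_ (map h) (map k) (map l)).hom ≫ map h ◁ (mapComp k l).hom ≫
        (mapComp h (k.trans l)).hom

/-- A pseudonatural transformation between strictly unital pseudofunctors on a partially ordered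
set. -/
structure UPsTrans {S : Type} [Preorder S] {obj obj' : S → C} (F : UPsFun obj)
    (G : UPsFun obj') where
  /-- the components on objects -/
  app : ∀ x : S, obj x ⟶ obj' x
  /-- the components on morphisms -/
  nat : ∀ {x y : S} (h : x ≤ y), F.map h ≫ app y ≅ app x ≫ G.map h
  nat_refl : ∀ x : S, Triv (nat (le_refl x)).hom
  nat_comp : ∀ {x y z : S} (h : x ≤ y) (k : y ≤ z),
    (F.mapComp h k).hom ▷ app z ≫ (nat (h.trans k)).hom =
      (α_ (F.map h) (F.map k) (app z)).hom ≫ F.map h ◁ (nat k).hom ≫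
        (α_ (F.map h) (app y) (G.map k)).inv ≫ (nat h).hom ▷ G.map k ≫
          (α_ (app x) (G.map h) (G.map k)).hom ≫ app x ◁ (G.mapComp h k).hom

/-- The set of pairs `(k, l)` with `k, l ∈ {0, 1, 2}` and `k ≥ l`; the pair `(k, l)` is called
`dkl`. -/
inductive Delta
  | d00
  | d10
  | d11
  | d20
  | d21
  | d22

namespace Delta

/-- The pair `(k, l)`. -/
def pair : Delta → Fin 3 × Fin 3
  | d00 => (0, 0)
  | d10 => (1, 0)
  | d11 => (1, 1)
  | d20 => (2, 0)
  | d21 => (2, 1)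
  | d22 => (2, 2)

/-- The partial order: `(k, l) ≤ (k', l')` if `k ≤ k'` and `l ≤ l'`. -/
instance : Preorder Delta := Preorder.lift pair

theorem le_00_11 : d00 ≤ d11 := show pair d00 ≤ pair d11 by decide
theorem le_11_22 : d11 ≤ d22 := show pair d11 ≤ pair d22 by decide

/-- A family of objects indexed by the pairs, with prescribed objects on the diagonal. -/
abbrev objects (X Y Z Z₁₀ Z₂₀ Z₂₁ : C) : Delta → C
  | d00 => X
  | d10 => Z₁₀
  | d11 => Y
  | d20 => Z₂₀
  | d21 => Z₂₁
  | d22 => Z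

end Delta

open Delta

variable {X Y Z : C}

/-- A compactification of the pair of composable morphisms `f : X ⟶ Y`, `g : Y ⟶ Z`: a strictly
unital pseudofunctor on the partially ordered set of pairs `(k, l)` as above that restricts to the
`2`-functor `(g, f)` on the diagonal, sends the morphisms `(k, l) → (k', l)` to `A` and the
morphisms `(k', l) → (k', l')` to `B`. -/
structure Comp₂ (A B : Arrowy C) (f : X ⟶ Y) (g : Y ⟶ Z) where
  /-- the image of `(1, 0)` -/
  Z₁₀ : C
  /-- the image of `(2, 0)` -/
  Z₂₀ : C
  /-- the image of `(2, 1)` -/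
  Z₂₁ : C
  /-- the pseudofunctor -/
  F : UPsFun (objects X Y Z Z₁₀ Z₂₀ Z₂₁)
  hor_mem : ∀ {x y : Delta} (h : x ≤ y), x.pair.2 = y.pair.2 → A.mem (F.map h)
  ver_mem : ∀ {x y : Delta} (h : x ≤ y), x.pair.1 = y.pair.1 → B.mem (F.map h)
  map_f : F.map le_00_11 = f
  map_g : F.map le_11_22 = g
  map_gf : F.map (le_00_11.trans le_11_22) = f ≫ g
  mapComp_gf : Triv (F.mapComp le_00_11 le_11_22).hom

/-- A morphism of compactifications of `(g, f)` with components in `P`: a pseudonatural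
transformation that restricts to the identity on the diagonal. -/
structure Comp₂.Hom (P : Arrowy C) {f : X ⟶ Y} {g : Y ⟶ Z} (κ l : Comp₂ A B f g) where
  /-- the pseudonatural transformation -/
  τ : UPsTrans κ.F l.F
  mem : ∀ x : Delta, P.mem (τ.app x)
  app_00 : τ.app d00 = 𝟙 X
  app_11 : τ.app d11 = 𝟙 Y
  app_22 : τ.app d22 = 𝟙 Z
  nat_f : Triv (τ.nat le_00_11).hom
  nat_g : Triv (τ.nat le_11_22).hom
  nat_gf : Triv (τ.nat (le_00_11.trans le_11_22)).hom

/-- The `2`-category of compactifications of `(g, f)` relative to `P` is connected: it has an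
object, and any two objects are related by a finite zigzag of morphisms. -/
def Comp₂.Connected (A B P : Arrowy C) (f : X ⟶ Y) (g : Y ⟶ Z) : Prop :=
  Nonempty (Comp₂ A B f g) ∧
    ∀ κ l : Comp₂ A B f g, Relation.EqvGen (fun κ l => Nonempty (Comp₂.Hom P κ l)) κ l

end Simplices

/-! ### `2`-equivalences -/

section Equivalence

universe w₁ v₁ u₁ w₂ v₂ u₂

open scoped Pseudofunctor.StrongTrans

/-- A pseudofunctor is a `2`-equivalence if it admits a quasi-inverse, up to equivalences in the
`2`-categories of pseudofunctors, pseudonatural transformations and modifications. -/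
def IsTwoEquivalence {D : Type u₁} [Bicategory.{w₁, v₁} D] {D' : Type u₂} [Bicategory.{w₂, v₂} D']
    (F : D ⥤ᵖ D') : Prop :=
  ∃ G : D' ⥤ᵖ D, Nonempty (Pseudofunctor.id D ≌ F.comp G) ∧
    Nonempty (G.comp F ≌ Pseudofunctor.id D')

end Equivalence

end Gluing

open CategoryTheory Bicategory

set_option linter.unusedSectionVars false

/-! `E` is bijective on objects, so it is a `2`-equivalence as soon as every functor `E(X, Y) → C(X,
Y)` is an equivalence of categories: local quasi-inverses assemble to a pseudofunctor
(`PsUnder.quasiInv`), and their units and counits are icons, that is, transformations with identity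
components (`Glue.isTwoEquivalence_of_locally`). Essential surjectivity is the existence of
compactifications; full faithfulness is the point.

Fix `f`. A zigzag of compactifications of `f` from `(Z, i, p)` to `(W, j, q)` gives a `2`-cell of
`E(X, Y)` from `p * i` to `q * j`. Zigzags exist, because every compactification of `f` is the
restriction of one of the pair `(1_Y, f)`, and those are connected (`Comp.linked_of_connected`). All
zigzags give the same `2`-cell, because loops at one base point have trivial image and conjugation
carries this to every other base point (`nonempty_canonical`). So there is a coherent system `S` of
canonical isomorphisms between the compactifications of each morphism.

Every path `a` is then compared with the compactifications of its composite by a `2`-cell `S.norm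
a`, built one edge at a time. A vertical edge `e` turns `p * i` into `ep * i`. For a horizontal edge
`e`, a compactification `(j, q)` of `ep` is a square with left edge `p` and bottom edge `e`; its
`sigma` turns `e * p * i` into `q * j * i`, then `q * ji`. The result does not depend on the square,
because compactifications of `ep` are linked (`extSq_eq`), nor on `p * i`, because squares can be
pasted along a morphism of compactifications (`whisker_cell_ext`).

The heart is that these comparisons are natural. It suffices to treat a generator placed after a
path; by interchange this path may be replaced by its normal form `p * i`, and the claim becomes a
relation of the double category: unit, associativity or pasting (`nat_u_ver`, `nat_u_hor`,
`nat_m_ver`, `nat_m_hor`, `nat_sq`).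

Let `Φ` send `f` to its chosen compactification. The comparisons form an isomorphism from the
identity to `Φ E` on each category of morphisms, so `E` is faithful there. The `2`-cells `α`
identify `E Φ` with the identity, so `Φ` is faithful; together with `Φ E ≅ 1` this makes `E` full.
-/

namespace Gluing

/-! ### Pseudofunctors with a prescribed action on objects -/

section Icon

universe w₁ v₁ u₁ w₂ v₂ u₂

variable {D : Type u₁} [Bicategory.{w₁, v₁} D] {D' : Type u₂} [Bicategory.{w₂, v₂} D']

/-- The structure of a pseudofunctor on a function between the sets of objects. -/
structure PsOver (o : D → D') where
  /-- the action on morphisms -/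
  fn : ∀ X Y : D, (X ⟶ Y) ⥤ (o X ⟶ o Y)
  /-- the compatibility with identities -/
  mapId : ∀ X : D, (fn X X).obj (𝟙 X) ≅ 𝟙 (o X)
  /-- the compatibility with composition -/
  mapComp : ∀ {X Y Z : D} (f : X ⟶ Y) (g : Y ⟶ Z),
    (fn X Z).obj (f ≫ g) ≅ (fn X Y).obj f ≫ (fn Y Z).obj g
  map₂_whisker_left : ∀ {X Y Z : D} (f : X ⟶ Y) {g h : Y ⟶ Z} (s : g ⟶ h),
    (fn X Z).map (f ◁ s) =
      (mapComp f g).hom ≫ (fn X Y).obj f ◁ (fn Y Z).map s ≫ (mapComp f h).inv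
  map₂_whisker_right : ∀ {X Y Z : D} {f g : X ⟶ Y} (s : f ⟶ g) (h : Y ⟶ Z),
    (fn X Z).map (s ▷ h) =
      (mapComp f h).hom ≫ (fn X Y).map s ▷ (fn Y Z).obj h ≫ (mapComp g h).inv
  map₂_associator : ∀ {X Y Z W : D} (f : X ⟶ Y) (g : Y ⟶ Z) (h : Z ⟶ W),
    (fn X W).map (α_ f g h).hom = (mapComp (f ≫ g) h).hom ≫ (mapComp f g).hom ▷ (fn Z W).obj h ≫
      (α_ ((fn X Y).obj f) ((fn Y Z).obj g) ((fn Z W).obj h)).hom ≫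
        (fn X Y).obj f ◁ (mapComp g h).inv ≫ (mapComp f (g ≫ h)).inv
  map₂_left_unitor : ∀ {X Y : D} (f : X ⟶ Y),
    (fn X Y).map (λ_ f).hom =
      (mapComp (𝟙 X) f).hom ≫ (mapId X).hom ▷ (fn X Y).obj f ≫ (λ_ ((fn X Y).obj f)).hom
  map₂_right_unitor : ∀ {X Y : D} (f : X ⟶ Y),
    (fn X Y).map (ρ_ f).hom =
      (mapComp f (𝟙 Y)).hom ≫ (fn X Y).obj f ◁ (mapId Y).hom ≫ (ρ_ ((fn X Y).obj f)).hom

namespace PsOver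

variable {o : D → D'}

/-- The underlying pseudofunctor. -/
def toPs (P : PsOver o) : D ⥤ᵖ D' where
  obj := o
  map f := (P.fn _ _).obj f
  map₂ s := (P.fn _ _).map s
  map₂_id f := (P.fn _ _).map_id f
  map₂_comp s t := (P.fn _ _).map_comp s t
  mapId := P.mapId
  mapComp := P.mapComp
  map₂_whisker_left := P.map₂_whisker_left
  map₂_whisker_right := P.map₂_whisker_right
  map₂_associator := P.map₂_associator
  map₂_left_unitor := P.map₂_left_unitor
  map₂_right_unitor := P.map₂_right_unitor

/-- A pseudofunctor, seen as a structure on its action on objects. -/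
def ofPs (F : D ⥤ᵖ D') : PsOver F.obj where
  fn X Y := F.mapFunctor X Y
  mapId := F.mapId
  mapComp := F.mapComp
  map₂_whisker_left := F.map₂_whisker_left
  map₂_whisker_right := F.map₂_whisker_right
  map₂_associator := F.map₂_associator
  map₂_left_unitor := F.map₂_left_unitor
  map₂_right_unitor := F.map₂_right_unitor

/-- An invertible icon: an isomorphism between pseudofunctors with the same action on objects, all
of whose components are identities. -/
structure Icon (P Q : PsOver o) where
  /-- the components on morphisms -/
  iso : ∀ {X Y : D} (f : X ⟶ Y), (P.fn X Y).obj f ≅ (Q.fn X Y).obj f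
  nat : ∀ {X Y : D} {f g : X ⟶ Y} (s : f ⟶ g),
    (P.fn X Y).map s ≫ (iso g).hom = (iso f).hom ≫ (Q.fn X Y).map s
  id : ∀ X : D, (iso (𝟙 X)).hom ≫ (Q.mapId X).hom = (P.mapId X).hom
  comp : ∀ {X Y Z : D} (f : X ⟶ Y) (g : Y ⟶ Z),
    (iso (f ≫ g)).hom ≫ (Q.mapComp f g).hom =
      (P.mapComp f g).hom ≫ (iso f).hom ▷ (P.fn Y Z).obj g ≫ (Q.fn X Y).obj f ◁ (iso g).hom

namespace Icon

variable {P Q : PsOver o}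

/-- The inverse of an invertible icon. -/
def symm (e : Icon P Q) : Icon Q P where
  iso f := (e.iso f).symm
  nat {X Y f g} s := by
    have h := e.nat s
    simp [Iso.comp_inv_eq, h]
  id X := by simp [← e.id X]
  comp f g := by
    have h := e.comp f g
    rw [← cancel_epi (e.iso (f ≫ g)).hom]
    simp only [Iso.symm_hom, Iso.hom_inv_id_assoc, reassoc_of% h]
    -- The inverse icon also changes the left factor first, so interchange is needed before inverse
    -- factors become adjacent.
    rw [whisker_exchange_assoc]
    simp

open scoped Pseudofunctor.StrongTrans

/-- The pseudonatural transformation given by an icon. -/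
def toTrans (e : Icon P Q) : P.toPs ⟶ Q.toPs :=
  { app X := 𝟙 (o X)
    naturality f := ρ_ _ ≪≫ e.iso f ≪≫ (λ_ _).symm
    naturality_naturality {X Y f g} s := by
      have h := e.nat s
      change (P.fn X Y).map s ▷ 𝟙 _ ≫ (ρ_ _ ≪≫ e.iso g ≪≫ (λ_ _).symm).hom =
        (ρ_ _ ≪≫ e.iso f ≪≫ (λ_ _).symm).hom ≫ 𝟙 _ ◁ (Q.fn X Y).map s
      simp [reassoc_of% h]
    naturality_id X := by
      have h := e.id X
      change (ρ_ _ ≪≫ e.iso (𝟙 X) ≪≫ (λ_ _).symm).hom ≫ 𝟙 _ ◁ (Q.mapId X).hom =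
        (P.mapId X).hom ▷ 𝟙 _ ≫ (λ_ _).hom ≫ (ρ_ _).inv
      simp [reassoc_of% h, unitors_equal]
    naturality_comp {X Y Z} f g := by
      have h := e.comp f g
      change (ρ_ _ ≪≫ e.iso (f ≫ g) ≪≫ (λ_ _).symm).hom ≫ 𝟙 _ ◁ (Q.mapComp f g).hom =
        (P.mapComp f g).hom ▷ 𝟙 _ ≫ (α_ _ _ _).hom ≫
          (P.fn X Y).obj f ◁ (ρ_ _ ≪≫ e.iso g ≪≫ (λ_ _).symm).hom ≫ (α_ _ _ _).inv ≫
            (ρ_ _ ≪≫ e.iso f ≪≫ (λ_ _).symm).hom ▷ (Q.fn Y Z).obj g ≫ (α_ _ _ _).hom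
      rw [← whisker_exchange] at h
      simp [reassoc_of% h] }

/-- An invertible icon gives an equivalence of pseudofunctors. -/
theorem nonempty_equivalence (e : Icon P Q) : Nonempty (P.toPs ≌ Q.toPs) := by
  have key : ∀ {P Q : PsOver o} (e : Icon P Q),
      Nonempty (e.toTrans ≫ e.symm.toTrans ≅ 𝟙 P.toPs) := by
    intro P Q e
    refine ⟨Pseudofunctor.StrongTrans.isoMk (fun X => λ_ (𝟙 (o X))) ?_⟩
    intro X Y f
    change (P.fn X Y).obj f ◁ (λ_ (𝟙 (o Y))).hom ≫ ((ρ_ _).hom ≫ (λ_ _).inv) =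
      ((α_ _ _ _).inv ≫ (ρ_ _ ≪≫ e.iso f ≪≫ (λ_ _).symm).hom ▷ 𝟙 _ ≫ (α_ _ _ _).hom ≫
        𝟙 (o X) ◁ (ρ_ _ ≪≫ (e.iso f).symm ≪≫ (λ_ _).symm).hom ≫ (α_ _ _ _).inv) ≫
          (λ_ (𝟙 (o X))).hom ▷ (P.fn X Y).obj f
    simp [unitors_equal]
  -- No triangle identity has to be checked, since the counit gets corrected. As `e.symm.symm`
  -- unfolds to `e`, the second use of `key` has the type of a counit.
  exact ⟨.mkOfAdjointifyCounit (f := e.toTrans) (g := e.symm.toTrans) (key e).some.symm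
    (key e.symm).some⟩

end Icon

end PsOver

end Icon

/-! ### Quasi-inverses of pseudofunctors that are locally equivalences. -/

section QuasiInverse

universe w₁ v₁ u₁ w₂ v₂ u₂

variable {C : Type u₁} [Bicategory.{w₁, v₁} C] {D : Type u₂} [Bicategory.{w₂, v₂} D]

/-- The structure of a pseudofunctor from the full sub-bicategory of `D` on the objects `d X` to
`C` that sends `d X` to `X`. -/
structure PsUnder (d : C → D) where
  /-- the action on morphisms -/
  fn : ∀ X Y : C, (d X ⟶ d Y) ⥤ (X ⟶ Y)
  /-- the compatibility with identities -/
  mapId : ∀ X : C, (fn X X).obj (𝟙 (d X)) ≅ 𝟙 X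
  /-- the compatibility with composition -/
  mapComp : ∀ {X Y Z : C} (f : d X ⟶ d Y) (g : d Y ⟶ d Z),
    (fn X Z).obj (f ≫ g) ≅ (fn X Y).obj f ≫ (fn Y Z).obj g
  map₂_whisker_left : ∀ {X Y Z : C} (f : d X ⟶ d Y) {g h : d Y ⟶ d Z} (s : g ⟶ h),
    (fn X Z).map (f ◁ s) =
      (mapComp f g).hom ≫ (fn X Y).obj f ◁ (fn Y Z).map s ≫ (mapComp f h).inv
  map₂_whisker_right : ∀ {X Y Z : C} {f g : d X ⟶ d Y} (s : f ⟶ g) (h : d Y ⟶ d Z),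
    (fn X Z).map (s ▷ h) =
      (mapComp f h).hom ≫ (fn X Y).map s ▷ (fn Y Z).obj h ≫ (mapComp g h).inv
  map₂_associator : ∀ {X Y Z W : C} (f : d X ⟶ d Y) (g : d Y ⟶ d Z) (h : d Z ⟶ d W),
    (fn X W).map (α_ f g h).hom = (mapComp (f ≫ g) h).hom ≫ (mapComp f g).hom ▷ (fn Z W).obj h ≫
      (α_ ((fn X Y).obj f) ((fn Y Z).obj g) ((fn Z W).obj h)).hom ≫
        (fn X Y).obj f ◁ (mapComp g h).inv ≫ (mapComp f (g ≫ h)).inv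
  map₂_left_unitor : ∀ {X Y : C} (f : d X ⟶ d Y),
    (fn X Y).map (λ_ f).hom =
      (mapComp (𝟙 (d X)) f).hom ≫ (mapId X).hom ▷ (fn X Y).obj f ≫ (λ_ ((fn X Y).obj f)).hom
  map₂_right_unitor : ∀ {X Y : C} (f : d X ⟶ d Y),
    (fn X Y).map (ρ_ f).hom =
      (mapComp f (𝟙 (d Y))).hom ≫ (fn X Y).obj f ◁ (mapId Y).hom ≫ (ρ_ ((fn X Y).obj f)).hom

/-- Both halves of this loop change the three factors in the same order, so interchange has to bring
each factor next to its inverse. It is what remains of the associativity axiom of `quasiInv` after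
`F` has been applied. -/
theorem whisker_conj {X Y Z W : C} {f f' : X ⟶ Y} {g g' : Y ⟶ Z} {h h' : Z ⟶ W} (a : f' ≅ f)
    (b : g' ≅ g) (c : h' ≅ h) :
    f ◁ g ◁ c.inv ≫ f ◁ b.inv ▷ h' ≫ (α_ f g' h').inv ≫ a.inv ▷ g' ▷ h' ≫ (α_ f' g' h').hom ≫
      f' ◁ g' ◁ c.hom ≫ f' ◁ b.hom ▷ h ≫ (α_ f' g h).inv ≫ a.hom ▷ g ▷ h ≫ (α_ f g h).hom =
        𝟙 _ := by
  have h₀ : (g ◁ c.inv ≫ b.inv ▷ h') ≫ (g' ◁ c.hom ≫ b.hom ▷ h) = 𝟙 _ := by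
    rw [Category.assoc, ← whisker_exchange_assoc]
    simp
  have h : f ◁ (g ◁ c.inv ≫ b.inv ▷ h') ≫ (a.inv ▷ (g' ≫ h') ≫ f' ◁ (g' ◁ c.hom ≫ b.hom ▷ h)) ≫
      a.hom ▷ (g ≫ h) = 𝟙 _ := by
    rw [← whisker_exchange, Category.assoc, ← comp_whiskerRight, Iso.inv_hom_id, id_whiskerRight,
      Category.comp_id, ← Bicategory.whiskerLeft_comp, h₀, Bicategory.whiskerLeft_id]
  simpa using h

namespace PsUnder

variable {d : C → D} (F : PsUnder d) [∀ X Y, (F.fn X Y).IsEquivalence]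

/-- The comparison `F G f ≅ f` for the local quasi-inverse `G` of `F`. -/
noncomputable def counit {X Y : C} (f : X ⟶ Y) : (F.fn X Y).obj ((F.fn X Y).inv.obj f) ≅ f :=
  (F.fn X Y).asEquivalence.counitIso.app f

theorem map_inv {X Y : C} {f g : X ⟶ Y} (s : f ⟶ g) :
    (F.fn X Y).map ((F.fn X Y).inv.map s) = (F.counit f).hom ≫ s ≫ (F.counit g).inv :=
  (F.fn X Y).asEquivalence.counitIso.hom.naturality s |> fun h => by
    have h' : (F.fn X Y).map ((F.fn X Y).inv.map s) ≫ (F.counit g).hom = (F.counit f).hom ≫ s := h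
    rw [← Category.assoc, ← h', Category.assoc, Iso.hom_inv_id, Category.comp_id]

/-- The comparison `f ≅ G F f` for the local quasi-inverse `G` of `F`. -/
noncomputable def unit {X Y : C} (f : d X ⟶ d Y) : f ≅ (F.fn X Y).inv.obj ((F.fn X Y).obj f) :=
  (F.fn X Y).asEquivalence.unitIso.app f

/-- This is a triangle identity of the adjoint equivalence `(F.fn X Y).asEquivalence`. It turns
statements on units into statements on counits once `F` is applied. -/
theorem map_unit {X Y : C} (f : d X ⟶ d Y) :
    (F.fn X Y).map (F.unit f).hom = (F.counit ((F.fn X Y).obj f)).inv := by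
  rw [← cancel_mono (F.counit ((F.fn X Y).obj f)).hom, Iso.inv_hom_id]
  exact (F.fn X Y).asEquivalence.functor_unitIso_comp f

theorem unit_nat {X Y : C} {f g : d X ⟶ d Y} (s : f ⟶ g) :
    s ≫ (F.unit g).hom = (F.unit f).hom ≫ (F.fn X Y).inv.map ((F.fn X Y).map s) :=
  (F.fn X Y).asEquivalence.unitIso.hom.naturality s

theorem counit_nat {X Y : C} {f g : X ⟶ Y} (s : f ⟶ g) :
    (F.fn X Y).map ((F.fn X Y).inv.map s) ≫ (F.counit g).hom = (F.counit f).hom ≫ s :=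
  (F.fn X Y).asEquivalence.counitIso.hom.naturality s

/-- The quasi-inverse of a pseudofunctor that is locally an equivalence. -/
noncomputable def quasiInv : PsOver d where
  fn X Y := (F.fn X Y).inv
  -- Each `F.fn X Y` is fully faithful. Hence the structure isomorphisms can be taken as preimages
  -- of composites of counits with the structure isomorphisms of `F`, and all axioms can be checked
  -- after applying `F`.
  mapId X := (F.fn X X).preimageIso (F.counit (𝟙 X) ≪≫ (F.mapId X).symm)
  mapComp {X Y Z} f g := (F.fn X Z).preimageIso (F.counit (f ≫ g) ≪≫
    whiskerRightIso (F.counit f).symm g ≪≫ whiskerLeftIso _ (F.counit g).symm ≪≫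
      (F.mapComp _ _).symm)
  map₂_whisker_left {X Y Z} f g h s := (F.fn X Z).map_injective (by
    simp only [Functor.map_comp, map_inv, F.map₂_whisker_left, Functor.preimageIso_hom,
      Functor.preimageIso_inv, Functor.map_preimage]
    simp [whisker_exchange_assoc])
  map₂_whisker_right {X Y Z f g} s h := (F.fn X Z).map_injective (by
    simp only [Functor.map_comp, map_inv, F.map₂_whisker_right, Functor.preimageIso_hom,
      Functor.preimageIso_inv, Functor.map_preimage]
    simp [← whisker_exchange_assoc])
  map₂_associator {X Y Z W} f g h := (F.fn X W).map_injective (by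
    simp only [Functor.map_comp, map_inv, F.map₂_whisker_right, F.map₂_whisker_left,
      F.map₂_associator, Functor.preimageIso_hom,
      Functor.preimageIso_inv, Functor.map_preimage]
    -- In the image of `F`, the two bracketings contribute counits of `f`, `g`, `h` and their
    -- inverses, which cancel by `whisker_conj`.
    have key := whisker_conj (F.counit f) (F.counit g) (F.counit h) =≫ (F.counit (f ≫ g ≫ h)).inv
    simp only [Category.assoc, Category.id_comp] at key
    simp [← whisker_exchange_assoc, key])
  map₂_left_unitor {X Y} f := (F.fn X Y).map_injective (by
    simp only [Functor.map_comp, map_inv, F.map₂_whisker_right, F.map₂_left_unitor,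
      Functor.preimageIso_hom, Functor.map_preimage]
    simp [← whisker_exchange_assoc])
  map₂_right_unitor {X Y} f := (F.fn X Y).map_injective (by
    simp only [Functor.map_comp, map_inv, F.map₂_whisker_left, F.map₂_right_unitor,
      Functor.preimageIso_hom, Functor.map_preimage]
    simp)

theorem unit_id (X : C) :
    (F.unit (𝟙 (d X))).hom ≫ (F.fn X X).inv.map (F.mapId X).hom ≫ (F.quasiInv.mapId X).hom =
      𝟙 _ := by
  refine (F.fn X X).map_injective ?_
  simp only [Functor.map_comp, map_inv, map_unit, quasiInv, Functor.preimageIso_hom,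
    Functor.map_preimage]
  simp

/-- After `F` is applied, `map_unit` reduces this to the definition of the compositors of
`quasiInv`. Together with `unit_id` and `unit_nat` it makes the units an icon. -/
theorem unit_comp {X Y Z : C} (f : d X ⟶ d Y) (g : d Y ⟶ d Z) :
    (F.unit (f ≫ g)).hom ≫ (F.fn X Z).inv.map (F.mapComp f g).hom ≫
        (F.quasiInv.mapComp _ _).hom =
      (F.unit f).hom ▷ g ≫ _ ◁ (F.unit g).hom := by
  refine (F.fn X Z).map_injective ?_
  simp only [Functor.map_comp, map_inv, map_unit, quasiInv, Functor.preimageIso_hom,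
    Functor.map_preimage, F.map₂_whisker_right, F.map₂_whisker_left]
  simp

theorem counit_id (X : C) :
    (F.counit (𝟙 X)).hom = (F.fn X X).map (F.quasiInv.mapId X).hom ≫ (F.mapId X).hom := by
  simp [quasiInv]

/-- The definition of the compositors of `quasiInv`, solved for the counit. Together with
`counit_id` and `counit_nat` it makes the counits an icon. -/
theorem counit_comp {X Y Z : C} (f : X ⟶ Y) (g : Y ⟶ Z) :
    (F.counit (f ≫ g)).hom = ((F.fn X Z).map (F.quasiInv.mapComp f g).hom ≫ (F.mapComp _ _).hom) ≫
      (F.counit f).hom ▷ ((F.fn Y Z).obj ((F.fn Y Z).inv.obj g)) ≫ f ◁ (F.counit g).hom := by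
  simp [quasiInv, whisker_exchange_assoc]

end PsUnder

end QuasiInverse

/-! ### Reduction of the theorem to the categories of morphisms. -/

section Base

variable {C : Type u} [Bicategory.{w, v} C] [Strict C] [IsLocallyGroupoid C] (A B : Arrowy C)

/-- An object of `C`, as an object of `Glue A B`. -/
abbrev Glue.of (X : C) : Glue A B := ⟨⟨X⟩⟩

/-- The functor from the category of morphisms of `Glue A B` to that of `C`. -/
noncomputable abbrev Glue.homFunctor (X Y : C) : (Glue.of A B X ⟶ Glue.of A B Y) ⥤ (X ⟶ Y) :=
  (Glue.toBase A B).toPseudofunctor.mapFunctor _ _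

/-- The `2`-functor to the base, as a structure on the identity of the set of objects. -/
noncomputable def Glue.under : PsUnder (Glue.of A B) where
  fn X Y := Glue.homFunctor A B X Y
  mapId _ := (Glue.toBase A B).mapId _
  mapComp f g := (Glue.toBase A B).mapComp f g
  map₂_whisker_left f := (Glue.toBase A B).map₂_whisker_left f
  map₂_whisker_right s := (Glue.toBase A B).map₂_whisker_right s
  map₂_associator f := (Glue.toBase A B).map₂_associator f
  map₂_left_unitor f := (Glue.toBase A B).map₂_left_unitor f
  map₂_right_unitor f := (Glue.toBase A B).map₂_right_unitor f

/-- The `2`-functor `Glue A B → C` is a `2`-equivalence if it is an equivalence on the categories of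
morphisms. -/
theorem Glue.isTwoEquivalence_of_locally [∀ X Y : C, (Glue.homFunctor A B X Y).IsEquivalence] :
    IsTwoEquivalence (Glue.toBase A B).toPseudofunctor := by
  have : ∀ X Y, ((Glue.under A B).fn X Y).IsEquivalence := fun X Y =>
    inferInstanceAs (Glue.homFunctor A B X Y).IsEquivalence
  let F := Glue.under A B
  let G := F.quasiInv
  refine ⟨G.toPs, ?_, ?_⟩
  -- An object of `Glue A B` is a wrapped object of `C`, so by eta the composite pseudofunctor fixes
  -- objects on the nose, and the units can be read as an icon over the identity.
  · have e : PsOver.Icon (o := fun X : Glue A B => X)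
        (PsOver.ofPs (Pseudofunctor.id (Glue A B)))
        (PsOver.ofPs ((Glue.toBase A B).toPseudofunctor.comp G.toPs)) :=
      { iso f := F.unit f
        nat s := F.unit_nat s
        id X := F.unit_id X.as.as
        comp f g := (F.unit_comp f g).trans (Category.id_comp _).symm }
    exact e.nonempty_equivalence
  · have e : PsOver.Icon (o := fun X : C => X)
        (PsOver.ofPs (G.toPs.comp (Glue.toBase A B).toPseudofunctor))
        (PsOver.ofPs (Pseudofunctor.id C)) :=
      { iso f := F.counit f
        nat s := F.counit_nat s
        id X := (Category.comp_id _).trans (F.counit_id X)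
        comp f g := (Category.comp_id _).trans (F.counit_comp f g) }
    exact e.nonempty_equivalence

end Base

variable {C : Type u} [Bicategory.{w, v} C] [Strict C] [IsLocallyGroupoid C] {A B : Arrowy C}

/-! ### The canonical isomorphisms between compactifications -/

/-- A path of edges, as a morphism of `Glue A B`. -/
def Glue.mor {X Y : C} (a : (TQ.mk X : TQ A B) ⟶ TQ.mk Y) : Glue.of A B X ⟶ Glue.of A B Y := ⟨a⟩

/-- The class of a `2`-cell, as a `2`-cell of `Glue A B`. -/
def Glue.cell {X Y : C} {a b : (TQ.mk X : TQ A B) ⟶ TQ.mk Y} (s : a ⟶ b) :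
    Glue.mor a ⟶ Glue.mor b := locOf s

theorem Glue.cell_id {X Y : C} (a : (TQ.mk X : TQ A B) ⟶ TQ.mk Y) :
    Glue.cell (𝟙 a) = 𝟙 (Glue.mor a) := locOf_id a

theorem Glue.cell_comp {X Y : C} {a b c : (TQ.mk X : TQ A B) ⟶ TQ.mk Y} (s : a ⟶ b) (t : b ⟶ c) :
    Glue.cell (s ≫ t) = Glue.cell s ≫ Glue.cell t := locOf_comp s t

/-- Concatenation of a `2`-cell of `Glue A B` with a final path. -/
def Glue.whisker {X Y Z : C} {a b : (TQ.mk X : TQ A B) ⟶ TQ.mk Y} (s : Glue.mor a ⟶ Glue.mor b)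
    (e : (TQ.mk Y : TQ A B) ⟶ TQ.mk Z) : Glue.mor (a ≫ e) ⟶ Glue.mor (b ≫ e) :=
  s ▷ Glue.mor e

theorem Glue.whisker_id {X Y Z : C} (a : (TQ.mk X : TQ A B) ⟶ TQ.mk Y)
    (e : (TQ.mk Y : TQ A B) ⟶ TQ.mk Z) :
    Glue.whisker (𝟙 (Glue.mor a)) e = 𝟙 (Glue.mor (a ≫ e)) :=
  id_whiskerRight (Glue.mor a) (Glue.mor e)

theorem Glue.whisker_comp {X Y Z : C} {a b c : (TQ.mk X : TQ A B) ⟶ TQ.mk Y}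
    (s : Glue.mor a ⟶ Glue.mor b) (t : Glue.mor b ⟶ Glue.mor c)
    (e : (TQ.mk Y : TQ A B) ⟶ TQ.mk Z) :
    Glue.whisker (s ≫ t) e = Glue.whisker s e ≫ Glue.whisker t e :=
  comp_whiskerRight s t (Glue.mor e)

theorem Glue.whisker_cell {X Y Z : C} {a b : (TQ.mk X : TQ A B) ⟶ TQ.mk Y} (s : a ⟶ b)
    (e : (TQ.mk Y : TQ A B) ⟶ TQ.mk Z) :
    Glue.whisker (Glue.cell s) e = Glue.cell (s ▷ e) := rfl

/-- The morphism `p * i` of `Glue A B` given by a compactification. -/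
abbrev Comp.gpath {X Y : C} {f : X ⟶ Y} (κ : Comp A B B f) : Glue.of A B X ⟶ Glue.of A B Y :=
  Glue.mor κ.path

/-- Two compactifications are linked if they are related by a finite zigzag of morphisms. -/
def Comp.Linked {X Y : C} {f : X ⟶ Y} (κ l : Comp A B B f) : Prop :=
  Relation.EqvGen (fun κ l : Comp A B B f => Nonempty (Comp.Hom κ l)) κ l

variable (A B) in
/-- A choice of compactifications, together with a coherent system of isomorphisms between the
morphisms of `Glue A B` given by the compactifications of each morphism. -/
structure Canonical where
  /-- the chosen compactifications -/
  comp : ∀ {X Y : C} (f : X ⟶ Y), Comp A B B f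
  linked : ∀ {X Y : C} {f : X ⟶ Y} (κ l : Comp A B B f), κ.Linked l
  /-- the isomorphisms -/
  cell : ∀ {X Y : C} {f : X ⟶ Y} (κ l : Comp A B B f), κ.gpath ⟶ l.gpath
  cell_comp : ∀ {X Y : C} {f : X ⟶ Y} (κ l m : Comp A B B f), cell κ l ≫ cell l m = cell κ m
  cell_hom : ∀ {X Y : C} {f : X ⟶ Y} {κ l : Comp A B B f} (s : Comp.Hom κ l),
    cell l κ = Glue.cell s.pathCell

/-! ### Existence of a canonical system of isomorphisms. -/

section Existence

variable {X Y : C} (f : X ⟶ Y)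

/-- The functor from the fundamental groupoid of the compactifications of `f` to `Glue A B`. -/
noncomputable def compGroupoidFunctor (A B : Arrowy C) :
    FreeGroupoid (Ho (Comp A B B f)) ⥤ (Glue.of A B X ⟶ Glue.of A B Y) :=
  FreeGroupoid.lift (compFunctor A B f)

/-- The hypothesis lives in the free groupoid on `E(X, Y)`, although `E(X, Y)` is already a
groupoid. The extension of the identity functor retracts this free groupoid onto `E(X, Y)`, and its
composite with `FreeGroupoid.map` agrees with `compGroupoidFunctor` because both agree on morphisms
of compactifications. -/
theorem compGroupoidFunctor_loop {κ : Comp A B B f}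
    (h : (FundGroup.map (compFunctor A B f) ⟨κ⟩).range = ⊥)
    (s : FreeGroupoid.mk (Ho.mk κ) ⟶ FreeGroupoid.mk (Ho.mk κ)) :
    (compGroupoidFunctor f A B).map s = 𝟙 _ := by
  have h1 : FundGroup.map (compFunctor A B f) ⟨κ⟩ (Groupoid.isoEquivHom _ _ |>.symm s) = 1 := by
    have : FundGroup.map (compFunctor A B f) ⟨κ⟩ (Groupoid.isoEquivHom _ _ |>.symm s) ∈
      (FundGroup.map (compFunctor A B f) ⟨κ⟩).range := ⟨_, rfl⟩
    rw [h] at this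
    exact this
  have h2 : (FreeGroupoid.map (compFunctor A B f)).map s = 𝟙 _ := congrArg Iso.hom h1
  have key := natural_of_locOf (FreeGroupoid.map (compFunctor A B f) ⋙
      FreeGroupoid.lift (𝟭 (Glue.of A B X ⟶ Glue.of A B Y))) (compGroupoidFunctor f A B)
    (fun x => 𝟙 ((compFunctor A B f).obj x))
    (fun t => (Category.comp_id _).trans (((FreeGroupoid.lift_map_homMk (𝟭 _) _).trans
      (FreeGroupoid.lift_map_homMk (compFunctor A B f) t).symm).trans (Category.id_comp _).symm)) s
  refine (Category.id_comp _).symm.trans (key.symm.trans ((Category.comp_id _).trans ?_))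
  exact (congrArg (FreeGroupoid.lift (𝟭 (Glue.of A B X ⟶ Glue.of A B Y))).map h2).trans
    (CategoryTheory.Functor.map_id _ _)

variable {f}

/-- The image in `Glue A B` of a morphism of the fundamental groupoid of the compactifications
of `f`. -/
noncomputable def Comp.zigzagCell {κ l : Comp A B B f}
    (s : FreeGroupoid.mk (Ho.mk κ) ⟶ FreeGroupoid.mk (Ho.mk l)) : κ.gpath ⟶ l.gpath :=
  (compGroupoidFunctor f A B).map s

theorem Comp.zigzagCell_comp {κ l m : Comp A B B f}
    (s : FreeGroupoid.mk (Ho.mk κ) ⟶ FreeGroupoid.mk (Ho.mk l))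
    (t : FreeGroupoid.mk (Ho.mk l) ⟶ FreeGroupoid.mk (Ho.mk m)) :
    zigzagCell (s ≫ t) = zigzagCell s ≫ zigzagCell t :=
  (compGroupoidFunctor f A B).map_comp s t

theorem Comp.zigzagCell_id (κ : Comp A B B f) :
    zigzagCell (𝟙 (FreeGroupoid.mk (Ho.mk κ))) = 𝟙 κ.gpath :=
  (compGroupoidFunctor f A B).map_id _

theorem Comp.zigzagCell_hom {κ l : Comp A B B f} (s : Comp.Hom κ l) :
    zigzagCell (FreeGroupoid.homMk (Ho.mkHom s)) =
      Groupoid.inv (Glue.cell s.pathCell) :=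
  FreeGroupoid.lift_map_homMk (compFunctor A B f) (Ho.mkHom s)

/-- `pathCell` points against the morphism of compactifications, so it is the image of the formal
inverse. This is the form required by the field `cell_hom` of `Canonical`. -/
theorem Comp.zigzagCell_inv {κ l : Comp A B B f} (s : Comp.Hom κ l) :
    zigzagCell (Groupoid.inv (FreeGroupoid.homMk (Ho.mkHom s))) =
      Glue.cell s.pathCell := by
  have h := zigzagCell_comp (Groupoid.inv (FreeGroupoid.homMk (Ho.mkHom s)))
    (FreeGroupoid.homMk (Ho.mkHom s))
  rw [Groupoid.inv_comp, zigzagCell_id, zigzagCell_hom] at h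
  have h' := h.symm =≫ (Glue.cell s.pathCell)
  rw [Category.assoc, Groupoid.inv_comp, Category.comp_id, Category.id_comp] at h'
  exact h'

/-- Linked compactifications are isomorphic in the fundamental groupoid. -/
theorem Comp.Linked.nonempty_hom {κ l : Comp A B B f} (h : κ.Linked l) :
    Nonempty (FreeGroupoid.mk (Ho.mk κ) ⟶ FreeGroupoid.mk (Ho.mk l)) := by
  induction h with
  | rel κ l h => exact h.elim fun s => ⟨FreeGroupoid.homMk (Ho.mkHom s)⟩
  | refl κ => exact ⟨𝟙 _⟩
  | symm κ l _ ih => exact ih.elim fun s => ⟨Groupoid.inv s⟩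
  | trans κ l m _ _ ih ih' => exact ih.elim fun s => ih'.elim fun t => ⟨s ≫ t⟩

/-- If the compactifications of every morphism are linked and give rise to fundamental groups with
trivial image, there is a coherent choice of isomorphisms. -/
theorem nonempty_canonical
    (hπ : ∀ (X Y : C) (f : X ⟶ Y), ∃ κ : Comp A B B f,
      (FundGroup.map (compFunctor A B f) ⟨κ⟩).range = ⊥)
    (hl : ∀ {X Y : C} {f : X ⟶ Y} (κ l : Comp A B B f), κ.Linked l) :
    Nonempty (Canonical A B) := by
  choose κ₀ hκ₀ using hπ
  have hom : ∀ {X Y : C} {f : X ⟶ Y} (κ l : Comp A B B f),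
      Nonempty (FreeGroupoid.mk (Ho.mk κ) ⟶ FreeGroupoid.mk (Ho.mk l)) :=
    fun κ l => (hl κ l).nonempty_hom
  have uniq : ∀ {X Y : C} {f : X ⟶ Y} {κ l : Comp A B B f}
      (s t : FreeGroupoid.mk (Ho.mk κ) ⟶ FreeGroupoid.mk (Ho.mk l)),
      Comp.zigzagCell s = Comp.zigzagCell t := by
    intro X Y f κ l s t
    obtain ⟨r⟩ := hom (κ₀ _ _ f) κ
    -- Conjugation by `r` turns the discrepancy between `s` and `t` into a loop at the base point
    -- `κ₀`, where the hypothesis applies.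
    have h : Comp.zigzagCell (r ≫ s ≫ Groupoid.inv t ≫ Groupoid.inv r) = 𝟙 _ :=
      compGroupoidFunctor_loop f (hκ₀ _ _ f) _
    have h' : Comp.zigzagCell (r ≫ s) = Comp.zigzagCell (r ≫ t) := by
      have e : r ≫ s = (r ≫ s ≫ Groupoid.inv t ≫ Groupoid.inv r) ≫ r ≫ t := by simp
      rw [e, Comp.zigzagCell_comp, h, Category.id_comp]
    rw [Comp.zigzagCell_comp, Comp.zigzagCell_comp] at h'
    exact (cancel_epi _).1 h'
  exact ⟨{
    comp f := κ₀ _ _ f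
    linked := hl
    cell κ l := Comp.zigzagCell (hom κ l).some
    cell_comp κ l m := (Comp.zigzagCell_comp _ _).symm.trans (uniq _ _)
    cell_hom s := (uniq _ _).trans (Comp.zigzagCell_inv s) }⟩

end Existence

theorem Triv.same {X Y : C} {a b a' b' : X ⟶ Y} {s : a ⟶ b} {t : a' ⟶ b'} (hs : Triv s)
    (ht : Triv t) (h : a = a') : Same s t := by
  obtain ⟨rfl, rfl⟩ := hs
  obtain ⟨rfl, rfl⟩ := ht
  subst h
  exact Same.refl _

theorem Triv.inv {X Y : C} {a b : X ⟶ Y} {e : a ≅ b} (h : Triv e.hom) : Triv e.inv := by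
  obtain ⟨rfl, h⟩ := h
  refine ⟨rfl, ?_⟩
  rw [← cancel_epi e.hom, Iso.hom_inv_id, h]
  simp

/-! ### Zigzags of compactifications of a morphism -/

section Restriction

open Delta

theorem Delta.le_00_10 : d00 ≤ d10 := show pair d00 ≤ pair d10 by decide
theorem Delta.le_10_11 : d10 ≤ d11 := show pair d10 ≤ pair d11 by decide

variable {X Y Z : C} {f : X ⟶ Y} {g : Y ⟶ Z}

/-- The compactification of `f` given by a compactification of `(g, f)`. -/
noncomputable def Comp₂.restrict (κ : Comp₂ A B f g) : Comp A B B f where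
  mid := κ.Z₁₀
  i := ⟨κ.F.map le_00_10, κ.hor_mem _ rfl⟩
  p := ⟨κ.F.map le_10_11, κ.ver_mem _ rfl⟩
  α := κ.F.mapComp le_00_10 le_10_11 ≪≫ eqToIso κ.map_f

/-- The morphism of compactifications of `f` given by a morphism of compactifications
of `(g, f)`. -/
noncomputable def Comp₂.Hom.restrict {κ l : Comp₂ A B f g} (s : Comp₂.Hom B κ l) :
    Comp.Hom κ.restrict l.restrict where
  r := ⟨s.τ.app d10, s.mem _⟩
  γ := (s.τ.nat le_00_10).hom ≫ eqToHom (by rw [s.app_00]; exact Strict.id_comp _)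
  δ := (s.τ.nat le_10_11).inv ≫ eqToHom (by rw [s.app_11]; exact Strict.comp_id _)
  comm := by
    -- The compatibility with the `2`-cells to `f` is the composition axiom of the transformation
    -- for `(0,0) ≤ (1,0) ≤ (1,1)`: the components at the diagonal points, and the one on `(0,0) ≤
    -- (1,1)`, are trivial.
    have h := s.τ.nat_comp le_00_10 le_10_11
    have h' : κ.F.map le_00_10 ◁ (s.τ.nat le_10_11).inv ≫ (α_ _ _ _).inv ≫
        (κ.F.mapComp le_00_10 le_10_11).hom ▷ s.τ.app d11 ≫ (s.τ.nat le_00_11).hom =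
          (α_ _ _ _).inv ≫ (s.τ.nat le_00_10).hom ▷ l.F.map le_10_11 ≫ (α_ _ _ _).hom ≫
            s.τ.app d00 ◁ (l.F.mapComp le_00_10 le_10_11).hom := by
      rw [h]
      simp
    have h1 : Same ((κ.F.mapComp le_00_10 le_10_11).hom ▷ s.τ.app d11)
        (κ.F.mapComp le_00_10 le_10_11).hom :=
      ((Same.refl _).right s.app_11).trans (same_right_id _)
    have h2 : Same (s.τ.app d00 ◁ (l.F.mapComp le_00_10 le_10_11).hom)
        (l.F.mapComp le_00_10 le_10_11).hom :=
      ((Same.refl _).left s.app_00).trans (same_id_left _)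
    refine Same.eq (Same.trans (t := κ.F.map le_00_10 ◁ (s.τ.nat le_10_11).inv ≫ (α_ _ _ _).inv ≫
        (κ.F.mapComp le_00_10 le_10_11).hom ▷ s.τ.app d11 ≫ (s.τ.nat le_00_11).hom) ?_ ?_)
    · refine Same.comp (Same.left ((triv_eqToHom _).comp_same _) rfl) ?_
      refine Same.trans ?_ ((triv_assoc_inv _ _ _).same_comp _).symm
      exact h1.symm.comp ((triv_eqToHom κ.map_f).same s.nat_f
        (by rw [s.app_11]; exact (Strict.comp_id _).symm))
    · rw [h']
      refine ((triv_assoc_inv _ _ _).same_comp _).trans (Same.trans ?_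
        ((triv_assoc_inv _ _ _).same_comp _).symm)
      refine Same.comp (Same.right ((triv_eqToHom _).comp_same _) rfl).symm ?_
      exact ((triv_assoc _ _ _).same_comp _).trans
        (h2.trans ((triv_eqToHom l.map_f).comp_same _).symm)

end Restriction

/-! ### Compactifications of `f` as compactifications of the pair `(𝟙 Y, f)`. -/

section Extension

open Delta

variable {X Y : C} {f : X ⟶ Y}

/-- The strict functor on the partially ordered set of pairs given by composable morphisms `i`
and `p`, which sends `(0, 0)` to `X`, `(1, 0)` and `(2, 0)` to `M` and the other pairs to `Y`. -/
def Delta.strictMap {M : C} (i : X ⟶ M) (p : M ⟶ Y) : ∀ x y : Delta, x ≤ y →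
    (objects X Y Y M M Y x ⟶ objects X Y Y M M Y y)
  | d00, d00, _ => 𝟙 X
  | d00, d10, _ => i
  | d00, d11, _ => i ≫ p
  | d00, d20, _ => i
  | d00, d21, _ => i ≫ p
  | d00, d22, _ => i ≫ p
  | d10, d10, _ => 𝟙 M
  | d10, d11, _ => p
  | d10, d20, _ => 𝟙 M
  | d10, d21, _ => p
  | d10, d22, _ => p
  | d11, d11, _ => 𝟙 Y
  | d11, d21, _ => 𝟙 Y
  | d11, d22, _ => 𝟙 Y
  | d20, d20, _ => 𝟙 M
  | d20, d21, _ => p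
  | d20, d22, _ => p
  | d21, d21, _ => 𝟙 Y
  | d21, d22, _ => 𝟙 Y
  | d22, d22, _ => 𝟙 Y
  | d10, d00, h | d11, d00, h | d11, d10, h | d11, d20, h | d20, d00, h | d20, d10, h
  | d20, d11, h | d21, d00, h | d21, d10, h | d21, d11, h | d21, d20, h | d22, d00, h
  | d22, d10, h | d22, d11, h | d22, d20, h | d22, d21, h =>
    absurd (show pair _ ≤ pair _ from h) (by decide)

theorem Delta.strictMap_refl {M : C} (i : X ⟶ M) (p : M ⟶ Y) (x : Delta) :
    strictMap i p x x le_rfl = 𝟙 _ := by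
  cases x <;> rfl

theorem Delta.strictMap_comp {M : C} (i : X ⟶ M) (p : M ⟶ Y) {x y z : Delta} (h : x ≤ y)
    (k : y ≤ z) :
    strictMap i p x y h ≫ strictMap i p y z k = strictMap i p x z (h.trans k) := by
  have h' : pair x ≤ pair y := h
  have k' : pair y ≤ pair z := k
  cases x <;> cases y <;> first
    | exact absurd h' (by decide)
    | (cases z <;> first
        | exact absurd k' (by decide)
        | exact Strict.id_comp _
        | exact Strict.comp_id _
        | rfl)

/-- A pseudofunctor obtained from a strict functor by replacing its values on morphisms by
isomorphic morphisms. -/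
def UPsFun.ofStrict {S : Type} [Preorder S] {obj : S → C} (F : ∀ x y : S, x ≤ y → (obj x ⟶ obj y))
    (F_refl : ∀ x, F x x le_rfl = 𝟙 (obj x))
    (F_comp : ∀ {x y z : S} (h : x ≤ y) (k : y ≤ z), F x y h ≫ F y z k = F x z (h.trans k))
    (G : ∀ x y : S, x ≤ y → (obj x ⟶ obj y)) (e : ∀ x y (h : x ≤ y), F x y h ≅ G x y h)
    (he : ∀ x, Triv (e x x le_rfl).hom) : UPsFun obj where
  map {x y} h := G x y h
  mapComp {x y z} h k := whiskerRightIso (e x y h).symm _ ≪≫ whiskerLeftIso _ (e y z k).symm ≪≫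
    eqToIso (F_comp h k) ≪≫ e x z (h.trans k)
  map_refl x := by rw [← F_refl]; exact (he x).1.symm
  mapComp_refl_left {x y} h := by
    have h1 : Triv ((e x x le_rfl).inv ▷ G x y h) := (he x).inv.right _
    have h2 : Same (F x x le_rfl ◁ (e x y h).inv) (e x y h).inv :=
      ((Same.refl _).left (F_refl x)).trans (same_id_left _)
    refine Triv.of_same (triv_id (G x y h)) (s := _ ≫ _ ≫ _ ≫ _) ?_
    refine (h1.same_comp _).trans ((h2.comp ((triv_eqToHom
      (F_comp (le_refl x) h)).same_comp _)).trans ?_)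
    rw [Iso.inv_hom_id]
    exact Same.refl _
  mapComp_refl_right {x y} h := by
    have h1 : Triv (F x y h ◁ (e y y le_rfl).inv) := (he y).inv.left _
    have h2 : Same ((e x y h).inv ▷ G y y le_rfl) (e x y h).inv :=
      ((Same.refl _).right (by rw [← F_refl]; exact (he y).1.symm)).trans (same_right_id _)
    refine Triv.of_same (triv_id (G x y h)) (s := _ ≫ _ ≫ _ ≫ _) ?_
    refine (h2.comp ((h1.same_comp _).trans ((triv_eqToHom
      (F_comp h (le_refl y))).same_comp _))).trans ?_
    rw [Iso.inv_hom_id]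
    exact Same.refl _
  mapComp_assoc {x y z t} h k l := by
    -- Associativity of the strict functor `F`; the factors coming from `e` are then matched by
    -- interchange.
    have h0 : eqToHom (F_comp h k) ▷ F z t l ≫ eqToHom (F_comp (h.trans k) l) =
        (α_ _ _ _).hom ≫ F x y h ◁ eqToHom (F_comp k l) ≫ eqToHom (F_comp h (k.trans l)) :=
      (((triv_eqToHom _).right _).comp (triv_eqToHom _)).eq ((triv_assoc _ _ _).comp
        (((triv_eqToHom _).left _).comp (triv_eqToHom _)))
    simp only [Iso.trans_hom, whiskerRightIso_hom, whiskerLeftIso_hom, Iso.symm_hom, eqToIso.hom,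
      comp_whiskerRight, Bicategory.whiskerLeft_comp, Category.assoc, hom_inv_whiskerRight_assoc]
    rw [← whisker_exchange_assoc, reassoc_of% h0, whisker_exchange_assoc,
      whisker_exchange_assoc, whisker_exchange_assoc]
    have h1 := (α_ _ _ _).hom ≫= whisker_exchange (e x y h).inv ((e y z k).inv ▷ G z t l)
    simp only [whiskerRight_comp, Category.assoc, Iso.hom_inv_id_assoc] at h1
    simp [reassoc_of% h1]

/-- The values on morphisms of the pseudofunctor given by a compactification `(M, i, p, α)` of `f`:
they are those of `Delta.strictMap i p`, with `p ∘ i` replaced by `f`. -/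
def Comp.deltaMap (κ : Comp A B B f) : ∀ (x y : Delta) (h : x ≤ y),
    Σ t : objects X Y Y κ.mid κ.mid Y x ⟶ objects X Y Y κ.mid κ.mid Y y,
      strictMap κ.i.val κ.p.val x y h ≅ t
  -- The diagonal forces the value `f` for the targets `(1,1)` and `(2,2)`; the off-diagonal target
  -- `(2,1)` is treated alike.
  | d00, d11, _ => ⟨f, κ.α⟩
  | d00, d21, _ => ⟨f, κ.α⟩
  | d00, d22, _ => ⟨f, κ.α⟩
  | x, y, h => ⟨strictMap κ.i.val κ.p.val x y h, Iso.refl _⟩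

theorem Comp.triv_deltaMap (κ : Comp A B B f) (x : Delta) :
    Triv (κ.deltaMap x x le_rfl).2.hom := by
  cases x <;> exact triv_id _

/-- A compactification of `f`, as a compactification of the pair `(𝟙 Y, f)`. -/
def Comp.extend (κ : Comp A B B f) : Comp₂ A B f (𝟙 Y) where
  Z₁₀ := κ.mid
  Z₂₀ := κ.mid
  Z₂₁ := Y
  F := UPsFun.ofStrict (strictMap κ.i.val κ.p.val) (strictMap_refl _ _) (strictMap_comp _ _)
    (fun x y h => (κ.deltaMap x y h).1) (fun x y h => (κ.deltaMap x y h).2) κ.triv_deltaMap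
  hor_mem {x y} h e := by
    have h' : pair x ≤ pair y := h
    cases x <;> cases y <;> first
      | exact absurd h' (by decide)
      | exact absurd e (by decide)
      | exact A.id_mem _
      | exact κ.i.mem
  ver_mem {x y} h e := by
    have h' : pair x ≤ pair y := h
    cases x <;> cases y <;> first
      | exact absurd h' (by decide)
      | exact absurd e (by decide)
      | exact B.id_mem _
      | exact κ.p.mem
  map_f := rfl
  map_g := rfl
  map_gf := (Strict.comp_id f).symm
  mapComp_gf := by
    -- Both `(0,0) ≤ (1,1)` and `(0,0) ≤ (2,2)` get the value `f` through the same `α`, so the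
    -- compositor is `α⁻¹` followed by `α`, up to trivial `2`-cells.
    have h1 : Same (κ.α.inv ▷ 𝟙 Y) κ.α.inv := same_right_id _
    have h2 : Triv ((κ.i.val ≫ κ.p.val) ◁ 𝟙 (𝟙 Y)) := (triv_id _).left _
    have h3 := h1.comp ((h2.same_comp _).trans
      ((triv_eqToHom (Strict.comp_id (κ.i.val ≫ κ.p.val))).same_comp κ.α.hom))
    rw [Iso.inv_hom_id] at h3
    exact (triv_id f).of_same h3

/-- On `(0,0) ≤ (1,0) ≤ (1,1)` only the composite has been replaced, so the compositor of the
extension there is `α` itself. Thus every compactification of `f` is a restriction, which lets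
connectedness descend from the pair to `f`. -/
theorem Comp.restrict_extend (κ : Comp A B B f) : κ.extend.restrict = κ := by
  obtain ⟨M, i, p, α⟩ := κ
  have h : (𝟙 i.val ▷ p.val ≫ i.val ◁ 𝟙 p.val ≫ 𝟙 _ ≫ α.hom) ≫ 𝟙 _ = α.hom := by simp
  exact congrArg (Comp.mk M i p) (Iso.ext h)

/-- If the compactifications of `(𝟙 Y, f)` are connected, so are those of `f`. -/
theorem Comp.linked_of_connected (h : Comp₂.Connected A B B f (𝟙 Y)) (κ l : Comp A B B f) :
    κ.Linked l := by
  -- Restriction carries morphisms to morphisms, hence zigzags to zigzags.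
  have key : ∀ {κ l : Comp₂ A B f (𝟙 Y)},
      Relation.EqvGen (fun κ l => Nonempty (Comp₂.Hom B κ l)) κ l →
        κ.restrict.Linked l.restrict := by
    intro κ l h
    induction h with
    | rel κ l h => exact .rel _ _ (h.map Comp₂.Hom.restrict)
    | refl κ => exact .refl _
    | symm κ l _ ih => exact ih.symm
    | trans κ l m _ _ ih ih' => exact ih.trans _ _ _ ih'
  have := key (h.2 κ.extend l.extend)
  rwa [restrict_extend, restrict_extend] at this

end Extension

/-! ### Further computations with squares -/

namespace TQ

/-- A `2`-cell on the left edge amounts to pasting on the left the square with horizontal identities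
that it defines; the inserted and deleted identities cancel. This mirrors `sq_right`. -/
theorem sq_left {X Y Z W : C} {j : A.Mor X Y} {p p' : B.Mor X Z} {q : B.Mor Y W}
    {i : A.Mor Z W} (δ : p.val ⟶ p'.val) (D : Sq A B j p' q i) (D' : Sq A B j p q i)
    (h : D'.cell = δ ▷ i.val ≫ D.cell) :
    verCell A δ ▷ edge A B .hor i ≫ sq D = sq D' := by
  have hs : Same D'.cell ((sqOf δ).hcomp D).cell := by
    rw [h]
    have h1 : Same ((sqOf (A := A) δ).cell ▷ i.val) (δ ▷ i.val) := (same_sqOf δ).right rfl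
    have h2 : Same (𝟙 X ◁ D.cell) D.cell := same_id_left _
    exact Same.symm (((triv_assoc_inv _ _ _).same_comp _).trans (h1.comp
      (((triv_assoc _ _ _).same_comp _).trans (((triv_assoc_inv _ _ _).comp_same _).trans h2))))
  have hj : (A.one X).comp j = j := Arrowy.Mor.ext (Strict.id_comp _)
  have hi : (A.one Z).comp i = i := Arrowy.Mor.ext (Strict.id_comp _)
  have key := sq_hcomp (sqOf δ) D D' hj hi hs
  rw [m_one_left, m_one_left] at key
  calc verCell A δ ▷ edge A B .hor i ≫ sq D
      = 𝟙 _ ⊗≫ edge A B .ver p ◁ u A B .hor Z ▷ edge A B .hor i ⊗≫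
          sq (sqOf δ) ▷ edge A B .hor i ⊗≫
            (v A B .hor X ▷ (edge A B .ver p' ≫ edge A B .hor i) ≫ 𝟙 _ ◁ sq D) ⊗≫ 𝟙 _ := by
        rw [verCell]
        bicategory
    _ = 𝟙 _ ⊗≫ edge A B .ver p ◁ u A B .hor Z ▷ edge A B .hor i ⊗≫
          (sq (sqOf δ) ▷ edge A B .hor i ≫ (α_ _ _ _).hom ≫ edge A B .hor (A.one X) ◁ sq D ≫
            (α_ _ _ _).inv ≫ (v A B .hor X ▷ edge A B .hor j ≫ (λ_ _).hom) ▷ edge A B .ver q) := by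
        rw [← whisker_exchange]
        bicategory
    _ = sq D' := by
        erw [key]
        calc _ = 𝟙 _ ⊗≫ edge A B .ver p ◁ (u A B .hor Z ≫ v A B .hor Z) ▷ edge A B .hor i ⊗≫
              sq D' := by bicategory
          _ = sq D' := by
            rw [u_v]
            bicategory

/-- The composite of the insertion of a vertical identity and of the transformation `sigma` of a
square whose left edge is an identity. -/
def slide {X Y Z : C} {i : A.Mor X Y} {r : B.Mor Y Z} {j : A.Mor X Z} (D : Sq A B i (B.one X) r j) :
    edge A B .hor j ⟶ edge A B .hor i ≫ edge A B .ver r :=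
  (λ_ _).inv ≫ u A B .ver X ▷ edge A B .hor j ≫ sq D

theorem slide_idHor {X Y : C} (i : A.Mor X Y) :
    slide (Sq.idHor i : Sq A B i _ _ i) = (ρ_ _).inv ≫ edge A B .hor i ◁ u A B .ver Y := by
  rw [slide, sq_idHor]
  simp

/-- The vertical identity is inserted at the source, so interchange moves it past the composition of
`j` and `k`, leaving the relation for the horizontal pasting of `D` and `E`. -/
theorem slide_hcomp {X Y Z V W : C} {i : A.Mor X Y} {r : B.Mor Y Z} {j : A.Mor X Z}
    {a : A.Mor Y V} {b : B.Mor V W} {k : A.Mor Z W} {ia : A.Mor X V} {jk : A.Mor X W}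
    (D : Sq A B i (B.one X) r j) (E : Sq A B a r b k) (R : Sq A B ia (B.one X) b jk)
    (hi : i.comp a = ia) (hj : j.comp k = jk) (h : Same R.cell (D.hcomp E).cell) :
    m A B .hor j k jk hj ≫ slide R =
      slide D ▷ edge A B .hor k ≫ (α_ _ _ _).hom ≫ edge A B .hor i ◁ sq E ≫ (α_ _ _ _).inv ≫
        m A B .hor i a ia hi ▷ edge A B .ver b := by
  have key := sq_hcomp D E R hi hj h
  symm
  calc _ = 𝟙 _ ⊗≫ u A B .ver X ▷ (edge A B .hor j ≫ edge A B .hor k) ⊗≫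
        (sq D ▷ edge A B .hor k ≫ (α_ _ _ _).hom ≫ edge A B .hor i ◁ sq E ≫ (α_ _ _ _).inv ≫
          m A B .hor i a ia hi ▷ edge A B .ver b) := by
        rw [slide]
        bicategory
    _ = 𝟙 _ ⊗≫ (u A B .ver X ▷ (edge A B .hor j ≫ edge A B .hor k) ≫
          edge A B .ver (B.one X) ◁ m A B .hor j k jk hj) ⊗≫ sq R := by
        rw [key]
        bicategory
    _ = _ := by
        rw [← whisker_exchange, slide]
        bicategory

end TQ

open TQ

namespace Comp

variable {X Y Z : C} {f : X ⟶ Y}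

theorem Hom.cellA_eq_slide {κ l : Comp A B B f} (s : Hom κ l) : s.cellA = slide s.square := rfl

/-! ### Extension of compactifications by vertical morphisms -/

/-- The compactification `(M, i, e p)` of `e f`. -/
def extV (κ : Comp A B B f) (e : B.Mor Y Z) : Comp A B B (f ≫ e.val) where
  mid := κ.mid
  i := κ.i
  p := κ.p.comp e
  α := (α_ _ _ _).symm ≪≫ whiskerRightIso κ.α e.val

/-- The `2`-cell `e * p * i ⇒ e p * i`. -/
def cellV (κ : Comp A B B f) (e : B.Mor Y Z) :
    κ.path ≫ edge A B .ver e ⟶ (κ.extV e).path :=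
  (α_ _ _ _).hom ≫ edge A B .hor κ.i ◁ m A B .ver κ.p e _ rfl

/-- The extension of a morphism of compactifications. -/
def Hom.extV {κ l : Comp A B B f} (s : Hom κ l) (e : B.Mor Y Z) :
    Hom (κ.extV e) (l.extV e) where
  r := s.r
  γ := s.γ
  δ := (α_ s.r.val l.p.val e.val).inv ≫ s.δ ▷ e.val
  comm := by
    have h : (κ.i.val ◁ s.δ ≫ κ.α.hom) ▷ e.val = _ ▷ e.val :=
      congrArg (fun t => t ▷ e.val) s.comm
    have h' : κ.i.val ◁ ((α_ s.r.val l.p.val e.val).inv ≫ s.δ ▷ e.val) ≫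
        (α_ _ _ _).inv ≫ κ.α.hom ▷ e.val =
      (α_ κ.i.val s.r.val (l.p.val ≫ e.val)).inv ≫ s.γ ▷ (l.p.val ≫ e.val) ≫
        (α_ _ _ _).inv ≫ l.α.hom ▷ e.val := by
      simp only [comp_whiskerRight, whisker_assoc, Category.assoc] at h
      rw [Bicategory.whiskerLeft_comp, Category.assoc, (Iso.eq_inv_comp _).2 h]
      simp
    exact h'

/-- Associativity of `gamma` regroups `r`, `q`, `e`, and `verCell_m` with the identity of `e` as
second `2`-cell carries `δ` past the composition with `e`. It is the vertical part of
`Hom.pathCell_extV`. -/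
theorem m_verCell_m {X Y Z W : C} (r : B.Mor X Y) (q : B.Mor Y Z) (p : B.Mor X Z) (e : B.Mor Z W)
    (δ : r.val ≫ q.val ⟶ p.val) :
    (m A B .ver r q (r.comp q) rfl ≫ verCell A δ) ▷ edge A B .ver e ≫
        m A B .ver p e (p.comp e) rfl =
      (α_ _ _ _).hom ≫ edge A B .ver r ◁ m A B .ver q e (q.comp e) rfl ≫
        m A B .ver r (q.comp e) (r.comp (q.comp e)) rfl ≫
          verCell A (p := r.comp (q.comp e)) (p' := p.comp e)
            ((α_ r.val q.val e.val).inv ≫ δ ▷ e.val) := by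
  have e' : (r.comp q).comp e = r.comp (q.comp e) := Arrowy.Mor.ext (Strict.assoc _ _ _)
  have h1 := m_assoc (A := A) (k := .ver) r q e (r.comp q) (q.comp e)
    (r.comp (q.comp e)) rfl rfl e' rfl
  have h2 := verCell_m (A := A) (rq := r.comp (q.comp e)) (r'q' := p.comp e) e' rfl
    δ (𝟙 e.val) ((α_ r.val q.val e.val).inv ≫ δ ▷ e.val) (by
      rw [Bicategory.whiskerLeft_id, Category.id_comp]
      exact (triv_assoc_inv _ _ _).same_comp _)
  rw [verCell_id, Bicategory.whiskerLeft_id, Category.id_comp] at h2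
  rw [comp_whiskerRight]
  simp only [Category.assoc]
  rw [h2, reassoc_of% h1]

/-- The extension leaves `r` and `γ` unchanged, so `cellA` involves the same `2`-cell on both sides
and passes the composition of `l.p` and `e` by interchange. The remaining parts agree by
`m_verCell_m`. -/
theorem Hom.pathCell_extV {κ l : Comp A B B f} (s : Hom κ l) (e : B.Mor Y Z) :
    s.pathCell ▷ edge A B .ver e ≫ κ.cellV e = l.cellV e ≫ (s.extV e).pathCell := by
  have key := m_verCell_m (A := A) s.r l.p κ.p e s.δ
  generalize hw : verCell A (p := s.r.comp (l.p.comp e)) (p' := κ.p.comp e)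
    ((α_ s.r.val l.p.val e.val).inv ≫ s.δ ▷ e.val) = w at key
  have h : (s.cellA ▷ edge A B .ver l.p ≫ (α_ _ _ _).hom ≫ edge A B .hor κ.i ◁
        (m A B .ver s.r l.p (s.r.comp l.p) rfl ≫ verCell A s.δ)) ▷ edge A B .ver e ≫
        (α_ _ _ _).hom ≫ edge A B .hor κ.i ◁ m A B .ver κ.p e (κ.p.comp e) rfl =
      ((α_ _ _ _).hom ≫ edge A B .hor l.i ◁ m A B .ver l.p e (l.p.comp e) rfl) ≫
        s.cellA ▷ edge A B .ver (l.p.comp e) ≫ (α_ _ _ _).hom ≫ edge A B .hor κ.i ◁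
          (m A B .ver s.r (l.p.comp e) (s.r.comp (l.p.comp e)) rfl ≫ w) := by
    calc _ = s.cellA ▷ edge A B .ver l.p ▷ edge A B .ver e ⊗≫
        edge A B .hor κ.i ◁ ((m A B .ver s.r l.p (s.r.comp l.p) rfl ≫ verCell A s.δ) ▷
          edge A B .ver e ≫ m A B .ver κ.p e (κ.p.comp e) rfl) := by bicategory
    _ = 𝟙 _ ⊗≫ (s.cellA ▷ (edge A B .ver l.p ≫ edge A B .ver e) ≫
          (edge A B .hor κ.i ≫ edge A B .ver s.r) ◁ m A B .ver l.p e (l.p.comp e) rfl) ⊗≫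
          edge A B .hor κ.i ◁
          (m A B .ver s.r (l.p.comp e) (s.r.comp (l.p.comp e)) rfl ≫ w) := by
        rw [key]
        bicategory
    _ = _ := by
        rw [← whisker_exchange]
        bicategory
  subst hw
  exact h

/-! ### Extension of compactifications by horizontal morphisms -/

/-- The compactification `(V, j i, q)` of `e f` given by a compactification `(M, i, p)` of `f` and a
square with left edge `p` and bottom edge `e`. -/
noncomputable def extH (κ : Comp A B B f) {V : C} {e : A.Mor Y Z} {j : A.Mor κ.mid V}
    {q : B.Mor V Z} (D : Sq A B j κ.p q e) : Comp A B B (f ≫ e.val) where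
  mid := V
  i := κ.i.comp j
  p := q
  α := α_ κ.i.val j.val q.val ≪≫ whiskerLeftIso κ.i.val (asIso D.cell).symm ≪≫
    (α_ κ.i.val κ.p.val e.val).symm ≪≫ whiskerRightIso κ.α e.val

/-- The `2`-cell `e * p * i ⇒ q * j i`. -/
noncomputable def cellH (κ : Comp A B B f) {V : C} {e : A.Mor Y Z} {j : A.Mor κ.mid V}
    {q : B.Mor V Z} (D : Sq A B j κ.p q e) : κ.path ≫ edge A B .hor e ⟶ (κ.extH D).path :=
  (α_ _ _ _).hom ≫ edge A B .hor κ.i ◁ sq D ≫ (α_ _ _ _).inv ≫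
    m A B .hor κ.i j _ rfl ▷ edge A B .ver q

end Comp

namespace TQ

/-- The case of `slide_hcomp` where the first square is the identity square of `i`: sliding along it
merely inserts the vertical identity at the target of `i`, which is where `slide D` needs it. -/
theorem slide_left {X Y Z W : C} (i : A.Mor X Y) {j : A.Mor Y Z} {r : B.Mor Z W} {k : A.Mor Y W}
    {ij : A.Mor X Z} {ik : A.Mor X W} (D : Sq A B j (B.one Y) r k) (R : Sq A B ij (B.one X) r ik)
    (hij : i.comp j = ij) (hik : i.comp k = ik)
    (h : Same R.cell (i.val ◁ D.cell)) :
    m A B .hor i k ik hik ≫ slide R =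
      edge A B .hor i ◁ slide D ≫ (α_ _ _ _).inv ≫ m A B .hor i j ij hij ▷ edge A B .ver r := by
  have hs : Same R.cell ((Sq.idHor i : Sq A B i _ _ i).hcomp D).cell := by
    refine h.trans (Same.symm ?_)
    refine ((triv_assoc_inv _ _ _).same_comp _).trans ?_
    refine ((((triv_leftUnitor _).comp (triv_rightUnitor_inv _)).right _).same_comp _).trans ?_
    exact ((triv_assoc _ _ _).same_comp _).trans ((triv_assoc_inv _ _ _).comp_same _)
  rw [slide_hcomp (Sq.idHor i) D R hij hik hs, slide_idHor, slide]
  bicategory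

/-- `D` arises by pasting `E`, whose left edge is an identity, on top of `D'` and then applying `δ`
to the right edge. In the relation for vertical pasting, composing `p` with this identity is a
deletion, which cancels the insertion contained in `slide`. -/
theorem sq_slide {X Y Z V V' : C} {j : A.Mor X V} {j' : A.Mor X V'} {p : B.Mor X Y}
    {q : B.Mor V Z} {q' : B.Mor V' Z} {e : A.Mor Y Z} (D : Sq A B j p q e) (D' : Sq A B j' p q' e)
    {r : B.Mor V V'} (E : Sq A B j (B.one X) r j') (γ : j'.val ⟶ j.val ≫ r.val)
    (hE : E.cell = (λ_ _).hom ≫ γ) (δ : r.val ≫ q'.val ⟶ q.val)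
    (h : D.cell = D'.cell ≫ γ ▷ q'.val ≫ (α_ _ _ _).hom ≫ j.val ◁ δ) :
    sq D' ≫ slide E ▷ edge A B .ver q' ≫ (α_ _ _ _).hom ≫ edge A B .hor j ◁
      (m A B .ver r q' (r.comp q') rfl ≫ verCell A (p := r.comp q') (p' := q) δ) = sq D := by
  have e' : (B.one X).comp p = p := Arrowy.Mor.ext (Strict.id_comp _)
  -- The pasting of `E` and `D'`, with left edge `p` instead of the composite of `p` with an
  -- identity. It differs from `D` only by `δ` on the right edge.
  let D₁ : Sq A B j p (r.comp q') e := ⟨D'.cell ≫ γ ▷ q'.val ≫ (α_ _ _ _).hom⟩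
  have hs : Same D₁.cell (E.vcomp D').cell := by
    have h1 : Same (𝟙 X ◁ D'.cell) D'.cell := same_id_left _
    have h2 : Same (E.cell ▷ q'.val) (γ ▷ q'.val) := by
      rw [hE]
      exact Same.right ((triv_leftUnitor _).same_comp _) rfl
    refine Same.symm (((triv_assoc _ _ _).same_comp _).trans (h1.comp ?_))
    exact ((triv_assoc_inv _ _ _).same_comp _).trans (h2.comp (Same.refl _))
  have key := sq_vcomp E D' D₁ e' rfl hs
  rw [m_one_left] at key
  have h3 := sq_right D₁ (p' := q) δ D (by rw [h]; simp [D₁])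
  generalize verCell A (p := r.comp q') (p' := q) δ = w at h3 ⊢
  calc _ = 𝟙 _ ⊗≫ (sq D' ≫ (λ_ _).inv ≫ u A B .ver X ▷ (edge A B .hor j' ≫ edge A B .ver q')) ⊗≫
        sq E ▷ edge A B .ver q' ≫ (α_ _ _ _).hom ≫
          edge A B .hor j ◁ m A B .ver r q' (r.comp q') rfl ≫ edge A B .hor j ◁ w := by
        rw [slide]
        bicategory
    _ = 𝟙 _ ⊗≫ u A B .ver X ▷ (edge A B .ver p ≫ edge A B .hor e) ⊗≫
        (edge A B .ver (B.one X) ◁ sq D' ≫ (α_ _ _ _).inv ≫ sq E ▷ edge A B .ver q' ≫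
          (α_ _ _ _).hom ≫ edge A B .hor j ◁ m A B .ver r q' (r.comp q') rfl) ⊗≫
          edge A B .hor j ◁ w := by
        have : sq D' ≫ (λ_ _).inv ≫ u A B .ver X ▷ (edge A B .hor j' ≫ edge A B .ver q') =
            (λ_ _).inv ≫ u A B .ver X ▷ (edge A B .ver p ≫ edge A B .hor e) ≫
              edge A B .ver (B.one X) ◁ sq D' := by
          rw [← whisker_exchange]
          simp
        rw [this]
        bicategory
    _ = 𝟙 _ ⊗≫ (u A B .ver X ≫ v A B .ver X) ▷ (edge A B .ver p ≫ edge A B .hor e) ⊗≫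
          sq D₁ ≫ edge A B .hor j ◁ w := by
        erw [key]
        bicategory
    _ = sq D := by
        rw [u_v, h3]
        bicategory

end TQ

namespace Comp

variable {X Y Z : C} {f : X ⟶ Y}

/-- The morphism of extensions given by a morphism between squares. -/
noncomputable def Hom.extSq (κ : Comp A B B f) {V V' : C} {e : A.Mor Y Z} {j : A.Mor κ.mid V}
    {q : B.Mor V Z} (D : Sq A B j κ.p q e) {j' : A.Mor κ.mid V'} {q' : B.Mor V' Z}
    (D' : Sq A B j' κ.p q' e) (r : B.Mor V V') (γ : j.val ≫ r.val ⟶ j'.val)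
    (δ : r.val ≫ q'.val ⟶ q.val)
    (h : j.val ◁ δ ≫ inv D.cell = (α_ j.val r.val q'.val).inv ≫ γ ▷ q'.val ≫ inv D'.cell) :
    Hom (κ.extH D) (κ.extH D') where
  r := r
  γ := (α_ κ.i.val j.val r.val).hom ≫ κ.i.val ◁ γ
  δ := δ
  comm := by
    have h' : (κ.i.val ≫ j.val) ◁ δ ≫ (α_ κ.i.val j.val q.val).hom ≫ κ.i.val ◁ inv D.cell ≫
        (α_ κ.i.val κ.p.val e.val).inv ≫ κ.α.hom ▷ e.val =
      (α_ (κ.i.val ≫ j.val) r.val q'.val).inv ≫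
        ((α_ κ.i.val j.val r.val).hom ≫ κ.i.val ◁ γ) ▷ q'.val ≫
        (α_ κ.i.val j'.val q'.val).hom ≫ κ.i.val ◁ inv D'.cell ≫
          (α_ κ.i.val κ.p.val e.val).inv ≫ κ.α.hom ▷ e.val := by
      have h1 := congrArg (fun x => κ.i.val ◁ x) h
      simp only [Bicategory.whiskerLeft_comp] at h1
      rw [comp_whiskerLeft]
      simp only [Category.assoc, Iso.inv_hom_id_assoc]
      rw [reassoc_of% h1]
      simp
    exact h'

/-- `slide_left` takes `κ.i` out of the inserted square, and what remains is `sq_slide`. Hence two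
squares related by a morphism give the same extension of `κ` by `e`, up to the `2`-cell of a
morphism of compactifications. -/
theorem Hom.pathCell_extSq (κ : Comp A B B f) {V V' : C} {e : A.Mor Y Z} {j : A.Mor κ.mid V}
    {q : B.Mor V Z} (D : Sq A B j κ.p q e) {j' : A.Mor κ.mid V'} {q' : B.Mor V' Z}
    (D' : Sq A B j' κ.p q' e) (r : B.Mor V V') (γ : j.val ≫ r.val ⟶ j'.val)
    (δ : r.val ≫ q'.val ⟶ q.val)
    (h : j.val ◁ δ ≫ inv D.cell = (α_ j.val r.val q'.val).inv ≫ γ ▷ q'.val ≫ inv D'.cell) :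
    κ.cellH D' ≫ (Hom.extSq κ D D' r γ δ h).pathCell = κ.cellH D := by
  let E : Sq A B j (B.one _) r j' := ⟨(λ_ j'.val).hom ≫ inv γ⟩
  have h1 := sq_slide D D' E (inv γ) rfl δ (by
    rw [IsIso.comp_inv_eq] at h
    rw [h]
    simp)
  let R : Sq A B (κ.i.comp j) (B.one _) r (κ.i.comp j') :=
    ⟨(λ_ (κ.i.val ≫ j'.val)).hom ≫ inv ((α_ κ.i.val j.val r.val).hom ≫ κ.i.val ◁ γ)⟩
  have h2 := slide_left κ.i E R rfl rfl (by
    refine (((triv_leftUnitor _).same_comp _).trans ?_)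
    simp only [IsIso.inv_comp, Bicategory.inv_whiskerLeft, IsIso.Iso.inv_hom, E,
      Bicategory.whiskerLeft_comp]
    exact ((triv_assoc_inv _ _ _).comp_same _).trans
      (((triv_leftUnitor _).left _).same_comp _).symm)
  generalize hx : slide R = x at h2
  generalize hw : verCell A (p := r.comp q') (p' := q) δ = w at h1
  have h3 : ((α_ _ _ _).hom ≫ edge A B .hor κ.i ◁ sq D' ≫ (α_ _ _ _).inv ≫
      m A B .hor κ.i j' (κ.i.comp j') rfl ▷ edge A B .ver q') ≫
        x ▷ edge A B .ver q' ≫ (α_ _ _ _).hom ≫ edge A B .hor (κ.i.comp j) ◁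
          (m A B .ver r q' (r.comp q') rfl ≫ w) =
      (α_ _ _ _).hom ≫ edge A B .hor κ.i ◁ sq D ≫ (α_ _ _ _).inv ≫
        m A B .hor κ.i j (κ.i.comp j) rfl ▷ edge A B .ver q := by
    calc _ = (α_ _ _ _).hom ≫ edge A B .hor κ.i ◁ sq D' ≫ (α_ _ _ _).inv ≫
          (m A B .hor κ.i j' (κ.i.comp j') rfl ≫ x) ▷ edge A B .ver q' ≫ (α_ _ _ _).hom ≫
            edge A B .hor (κ.i.comp j) ◁ (m A B .ver r q' (r.comp q') rfl ≫ w) := by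
          bicategory
      _ = 𝟙 _ ⊗≫ edge A B .hor κ.i ◁ (sq D' ≫ slide E ▷ edge A B .ver q') ⊗≫
          (m A B .hor κ.i j (κ.i.comp j) rfl ▷ (edge A B .ver r ≫ edge A B .ver q') ≫
            edge A B .hor (κ.i.comp j) ◁ (m A B .ver r q' (r.comp q') rfl ≫ w)) := by
          erw [h2]
          bicategory
      _ = 𝟙 _ ⊗≫ edge A B .hor κ.i ◁ (sq D' ≫ slide E ▷ edge A B .ver q' ≫
          (α_ _ _ _).hom ≫ edge A B .hor j ◁ (m A B .ver r q' (r.comp q') rfl ≫ w)) ⊗≫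
          m A B .hor κ.i j (κ.i.comp j) rfl ▷ edge A B .ver q := by
          rw [← whisker_exchange]
          bicategory
      _ = _ := by
          erw [h1]
          bicategory
  subst hw hx
  exact h3

/-- A square with left edge `p` obtained from a square with left edge `q` and a morphism `(r, γ, δ)`
of compactifications, `δ : q r ⇒ p`, by pasting it below a square with left edge `r`. -/
noncomputable def Hom.pasteSq {κ l : Comp A B B f} (s : Hom κ l) {V V' : C} {e : A.Mor Y Z}
    {j' : A.Mor l.mid V'} {q' : B.Mor V' Z} {a : A.Mor κ.mid V} {b : B.Mor V V'}
    (E : Sq A B a s.r b j') (D' : Sq A B j' l.p q' e) : Sq A B a κ.p (b.comp q') e :=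
  ⟨inv s.δ ▷ e.val ≫ (E.vcomp D').cell⟩

theorem Hom.pasteSq_inv_cell {κ l : Comp A B B f} (s : Hom κ l) {V V' : C} {e : A.Mor Y Z}
    {j' : A.Mor l.mid V'} {q' : B.Mor V' Z} {a : A.Mor κ.mid V} {b : B.Mor V V'}
    (E : Sq A B a s.r b j') (D' : Sq A B j' l.p q' e) :
    inv (s.pasteSq E D').cell = (α_ a.val b.val q'.val).inv ≫ inv E.cell ▷ q'.val ≫
      (α_ s.r.val j'.val q'.val).hom ≫ s.r.val ◁ inv D'.cell ≫ (α_ s.r.val l.p.val e.val).inv ≫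
        s.δ ▷ e.val := by
  rw [IsIso.inv_eq_of_hom_inv_id]
  simp [Hom.pasteSq, Sq.vcomp, ← comp_whiskerRight_assoc, ← Bicategory.whiskerLeft_comp_assoc,
    ← comp_whiskerRight]

/-- The morphism of extensions given by a morphism of compactifications. -/
noncomputable def Hom.extH {κ l : Comp A B B f} (s : Hom κ l) {V V' : C} {e : A.Mor Y Z}
    {j' : A.Mor l.mid V'} {q' : B.Mor V' Z} {a : A.Mor κ.mid V} {b : B.Mor V V'}
    (E : Sq A B a s.r b j') (D' : Sq A B j' l.p q' e) :
    Hom (κ.extH (s.pasteSq E D')) (l.extH D') where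
  r := b
  γ := (α_ κ.i.val a.val b.val).hom ≫ κ.i.val ◁ inv E.cell ≫ (α_ κ.i.val s.r.val j'.val).inv ≫
    s.γ ▷ j'.val
  δ := 𝟙 (b.val ≫ q'.val)
  comm := by
    have h := congrArg (fun x => x ▷ e.val) s.comm
    have h' : (κ.i.val ≫ a.val) ◁ 𝟙 (b.val ≫ q'.val) ≫ (α_ κ.i.val a.val (b.val ≫ q'.val)).hom ≫
        κ.i.val ◁ inv (s.pasteSq E D').cell ≫ (α_ κ.i.val κ.p.val e.val).inv ≫ κ.α.hom ▷ e.val =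
      (α_ (κ.i.val ≫ a.val) b.val q'.val).inv ≫
        ((α_ κ.i.val a.val b.val).hom ≫ κ.i.val ◁ inv E.cell ≫
          (α_ κ.i.val s.r.val j'.val).inv ≫ s.γ ▷ j'.val) ▷ q'.val ≫
        (α_ l.i.val j'.val q'.val).hom ≫ l.i.val ◁ inv D'.cell ≫
          (α_ l.i.val l.p.val e.val).inv ≫ l.α.hom ▷ e.val := by
      erw [s.pasteSq_inv_cell E D']
      generalize inv E.cell = x
      generalize inv D'.cell = y
      calc _ = 𝟙 _ ⊗≫ κ.i.val ◁ x ▷ q'.val ⊗≫ κ.i.val ◁ s.r.val ◁ y ⊗≫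
            (κ.i.val ◁ s.δ ≫ κ.α.hom) ▷ e.val := by bicategory
        _ = 𝟙 _ ⊗≫ κ.i.val ◁ x ▷ q'.val ⊗≫ ((κ.i.val ≫ s.r.val) ◁ y ≫
            s.γ ▷ (l.p.val ≫ e.val)) ⊗≫ l.α.hom ▷ e.val := by
          rw [s.comm]
          bicategory
        _ = _ := by
          rw [whisker_exchange]
          bicategory
    exact h'

/-- When `sq_left` absorbs the `δ` of `cellB` into the left edge, it cancels the `δ⁻¹` built into
`pasteSq`. What is left is the relation for the vertical pasting of `E` on top of `D'`. -/
theorem Hom.cellB_comp_sq {κ l : Comp A B B f} (s : Hom κ l) {V V' : C} {e : A.Mor Y Z}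
    {j' : A.Mor l.mid V'} {q' : B.Mor V' Z} {a : A.Mor κ.mid V} {b : B.Mor V V'}
    (E : Sq A B a s.r b j') (D' : Sq A B j' l.p q' e) :
    s.cellB ▷ edge A B .hor e ≫ sq (s.pasteSq E D') =
      (α_ _ _ _).hom ≫ edge A B .ver s.r ◁ sq D' ≫ (α_ _ _ _).inv ≫ sq E ▷ edge A B .ver q' ≫
        (α_ _ _ _).hom ≫ edge A B .hor a ◁ m A B .ver b q' _ rfl := by
  have h1 := sq_left (p := s.r.comp l.p) (p' := κ.p) s.δ (s.pasteSq E D') (E.vcomp D')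
    (by
      have : s.δ ▷ e.val ≫ inv s.δ ▷ e.val = 𝟙 _ := by
        rw [← comp_whiskerRight]
        simp
      exact ((reassoc_of% this) _).symm)
  have h2 := sq_vcomp E D' (E.vcomp D') rfl rfl (Same.refl _)
  rw [h2, Iso.hom_inv_id_assoc, ← h1]
  have h3 : s.cellB = m A B .ver s.r l.p _ rfl ≫
    verCell A (p := s.r.comp l.p) (p' := κ.p) s.δ := rfl
  rw [h3, comp_whiskerRight]
  exact Category.assoc _ _ _

/-- By `cellB_comp_sq`, moving `cellB` past `e` produces the square `E`, and `cellA` absorbs `E` by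
horizontal pasting (`slide_hcomp`). So extension by `e` is natural along `s`, provided that `κ` is
extended by the pasted square. -/
theorem Hom.pathCell_extH {κ l : Comp A B B f} (s : Hom κ l) {V V' : C} {e : A.Mor Y Z}
    {j' : A.Mor l.mid V'} {q' : B.Mor V' Z} {a : A.Mor κ.mid V} {b : B.Mor V V'}
    (E : Sq A B a s.r b j') (D' : Sq A B j' l.p q' e) :
    s.pathCell ▷ edge A B .hor e ≫ κ.cellH (s.pasteSq E D') =
      l.cellH D' ≫ (s.extH E D').pathCell := by
  let R : Sq A B (κ.i.comp a) (B.one _) b (l.i.comp j') :=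
    ⟨(λ_ (l.i.val ≫ j'.val)).hom ≫ inv ((α_ κ.i.val a.val b.val).hom ≫ κ.i.val ◁ inv E.cell ≫
      (α_ κ.i.val s.r.val j'.val).inv ≫ s.γ ▷ j'.val)⟩
  have h1 := slide_hcomp s.square E R rfl rfl (by
    have : R.cell = (s.square.hcomp E).cell := by
      simp [R, Sq.hcomp, Hom.square]
    rw [this]
    exact Same.refl _)
  have h2 := s.cellB_comp_sq E D'
  have h0 := verCell_id (A := A) (b.comp q')
  generalize hx : slide R = x at h1
  have h3 : (s.cellA ▷ edge A B .ver l.p ≫ (α_ _ _ _).hom ≫ edge A B .hor κ.i ◁ s.cellB) ▷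
      edge A B .hor e ≫ (α_ _ _ _).hom ≫ edge A B .hor κ.i ◁ sq (s.pasteSq E D') ≫
        (α_ _ _ _).inv ≫ m A B .hor κ.i a (κ.i.comp a) rfl ▷ edge A B .ver (b.comp q') =
      ((α_ _ _ _).hom ≫ edge A B .hor l.i ◁ sq D' ≫ (α_ _ _ _).inv ≫
        m A B .hor l.i j' (l.i.comp j') rfl ▷ edge A B .ver q') ≫
        x ▷ edge A B .ver q' ≫ (α_ _ _ _).hom ≫ edge A B .hor (κ.i.comp a) ◁
          (m A B .ver b q' (b.comp q') rfl ≫ verCell A (𝟙 (b.comp q').val)) := by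
    rw [h0]
    calc _ = 𝟙 _ ⊗≫ s.cellA ▷ edge A B .ver l.p ▷ edge A B .hor e ⊗≫
          edge A B .hor κ.i ◁ (s.cellB ▷ edge A B .hor e ≫ sq (s.pasteSq E D')) ⊗≫
            m A B .hor κ.i a (κ.i.comp a) rfl ▷ edge A B .ver (b.comp q') := by bicategory
      _ = 𝟙 _ ⊗≫ (s.cellA ▷ (edge A B .ver l.p ≫ edge A B .hor e) ≫
          (edge A B .hor κ.i ≫ edge A B .ver s.r) ◁ sq D') ⊗≫
            edge A B .hor κ.i ◁ sq E ▷ edge A B .ver q' ⊗≫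
              ((edge A B .hor κ.i ≫ edge A B .hor a) ◁ m A B .ver b q' _ rfl ≫
                m A B .hor κ.i a (κ.i.comp a) rfl ▷ edge A B .ver (b.comp q')) := by
        rw [h2]
        bicategory
      _ = 𝟙 _ ⊗≫ edge A B .hor l.i ◁ sq D' ⊗≫
          (slide s.square ▷ edge A B .hor j' ≫ (α_ _ _ _).hom ≫ edge A B .hor κ.i ◁ sq E ≫
            (α_ _ _ _).inv ≫ m A B .hor κ.i a (κ.i.comp a) rfl ▷ edge A B .ver b) ▷
              edge A B .ver q' ⊗≫
          edge A B .hor (κ.i.comp a) ◁ m A B .ver b q' (b.comp q') rfl := by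
        rw [← whisker_exchange s.cellA, whisker_exchange (m A B .hor κ.i a (κ.i.comp a) rfl),
          s.cellA_eq_slide]
        bicategory
      _ = _ := by
        rw [← h1]
        bicategory
  subst hx
  exact h3

end Comp

/-! ### Normalization of paths -/

theorem Glue.whisker_one {X Y : C} {a b : (TQ.mk X : TQ A B) ⟶ TQ.mk Y}
    (s : Glue.mor a ⟶ Glue.mor b) :
    Glue.whisker s (𝟙 _) = Glue.cell (ρ_ a).hom ≫ s ≫ Glue.cell (ρ_ b).inv :=
  whiskerRight_id s

theorem Glue.whisker_whisker {X Y Z W : C} {a b : (TQ.mk X : TQ A B) ⟶ TQ.mk Y}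
    (s : Glue.mor a ⟶ Glue.mor b) (e : (TQ.mk Y : TQ A B) ⟶ TQ.mk Z)
    (e' : (TQ.mk Z : TQ A B) ⟶ TQ.mk W) :
    Glue.whisker s (e ≫ e') =
      Glue.cell (α_ a e e').inv ≫ Glue.whisker (Glue.whisker s e) e' ≫ Glue.cell (α_ b e e').hom :=
  whiskerRight_comp s (Glue.mor e) (Glue.mor e')

theorem Glue.cell_whisker {X Y Z : C} {a b : (TQ.mk X : TQ A B) ⟶ TQ.mk Y}
    (s : Glue.mor a ⟶ Glue.mor b) {e e' : (TQ.mk Y : TQ A B) ⟶ TQ.mk Z} (t : e ⟶ e') :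
    Glue.cell (a ◁ t) ≫ Glue.whisker s e' = Glue.whisker s e ≫ Glue.cell (b ◁ t) :=
  whisker_exchange s (Glue.cell t)

/-! ### Change of target along a `2`-cell; squares as compactifications. -/

namespace Comp

variable {X Y Z : C} {f f' : X ⟶ Y}

/-- Postcomposition of the `2`-cell of a compactification with a `2`-cell. -/
noncomputable def push (κ : Comp A B B f) (σ : f ⟶ f') : Comp A B B f' :=
  ⟨κ.mid, κ.i, κ.p, κ.α ≪≫ asIso σ⟩

/-- A morphism of compactifications of `f` is one of compactifications of `f'`. -/
noncomputable def Hom.push {κ l : Comp A B B f} (s : Hom κ l) (σ : f ⟶ f') :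
    Hom (κ.push σ) (l.push σ) where
  r := s.r
  γ := s.γ
  δ := s.δ
  comm := by
    have h : κ.i.val ◁ s.δ ≫ κ.α.hom ≫ σ =
        (α_ κ.i.val s.r.val l.p.val).inv ≫ s.γ ▷ l.p.val ≫ l.α.hom ≫ σ := by
      have h1 := s.comm =≫ σ
      simpa only [Category.assoc] using h1
    exact h

/-- A compactification of `e p`, as a square with left edge `p` and bottom edge `e`. -/
def toSq {p : B.Mor X Y} {e : A.Mor Y Z} (w : Comp A B B (p.val ≫ e.val)) :
    Sq A B w.i p w.p e := ⟨w.α.inv⟩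

/-- A square with left edge `p` and bottom edge `e`, as a compactification of `e p`. -/
noncomputable def ofSq {V : C} {p : B.Mor X Y} {e : A.Mor Y Z} {j : A.Mor X V}
    {q : B.Mor V Z} (D : Sq A B j p q e) : Comp A B B (p.val ≫ e.val) :=
  ⟨V, j, q, (asIso D.cell).symm⟩

end Comp

namespace Canonical

variable (S : Canonical A B) {X Y Z : C} {f f' : X ⟶ Y}

@[simp]
theorem cell_self (κ : Comp A B B f) : S.cell κ κ = 𝟙 _ := by
  have h := S.cell_comp κ κ κ
  exact (cancel_epi (S.cell κ κ)).1 (h.trans (Category.comp_id _).symm)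

theorem cell_swap (κ l : Comp A B B f) : S.cell κ l ≫ S.cell l κ = 𝟙 _ := by
  rw [S.cell_comp, S.cell_self]

/-- Properties of the canonical isomorphisms can be checked for morphisms of compactifications. -/
theorem cell_induction (P : ∀ κ l : Comp A B B f, (κ.gpath ⟶ l.gpath) → Prop)
    (hom : ∀ {κ l : Comp A B B f} (s : Comp.Hom κ l), P l κ (Glue.cell s.pathCell))
    (refl : ∀ κ, P κ κ (𝟙 _))
    (symm : ∀ {κ l} {x : κ.gpath ⟶ l.gpath} {y : l.gpath ⟶ κ.gpath}, x ≫ y = 𝟙 _ → y ≫ x = 𝟙 _ →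
      P κ l x → P l κ y)
    (trans : ∀ {κ l m} {x : κ.gpath ⟶ l.gpath} {y : l.gpath ⟶ m.gpath}, P κ l x → P l m y →
      P κ m (x ≫ y)) (κ l : Comp A B B f) : P κ l (S.cell κ l) := by
  induction S.linked κ l with
  | rel κ l h =>
    obtain ⟨s⟩ := h
    have := hom s
    rw [← S.cell_hom] at this
    exact symm (S.cell_swap _ _) (S.cell_swap _ _) this
  | refl κ =>
    rw [S.cell_self]
    exact refl κ
  | symm κ l _ ih => exact symm (S.cell_swap _ _) (S.cell_swap _ _) ih
  | trans κ l m _ _ ih ih' =>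
    rw [← S.cell_comp κ l m]
    exact trans ih ih'

/-- A family of morphisms is compatible with the canonical isomorphisms if it is compatible with
morphisms of compactifications. -/
theorem whisker_cell_comp {e : (TQ.mk Y : TQ A B) ⟶ TQ.mk Z} {t : Glue.of A B X ⟶ Glue.of A B Z}
    (φ : ∀ κ : Comp A B B f, Glue.mor (κ.path ≫ e) ⟶ t)
    (h : ∀ {κ l : Comp A B B f} (s : Comp.Hom κ l), Glue.cell (s.pathCell ▷ e) ≫ φ κ = φ l)
    (κ l : Comp A B B f) : Glue.whisker (S.cell κ l) e ≫ φ l = φ κ := by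
  refine S.cell_induction (fun κ l x => Glue.whisker x e ≫ φ l = φ κ) h ?_ ?_ ?_ κ l
  · intro κ
    rw [Glue.whisker_id, Category.id_comp]
  · intro κ l x y _ hy hx
    rw [← hx, ← Category.assoc, ← Glue.whisker_comp, hy, Glue.whisker_id, Category.id_comp]
  · intro κ l m x y hx hy
    rw [← hx, ← hy, Glue.whisker_comp]
    exact Category.assoc _ _ _

/-- The `2`-cell of a morphism of compactifications does not involve the `2`-cells `α`, so `s` and
`s.push σ` have the same one. -/
theorem cell_push (κ l : Comp A B B f) (σ : f ⟶ f') :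
    S.cell (κ.push σ) (l.push σ) = S.cell κ l := by
  refine S.cell_induction (fun κ l x => S.cell (κ.push σ) (l.push σ) = x) ?_ ?_ ?_ ?_ κ l
  · intro κ l s
    exact S.cell_hom (s.push σ)
  · intro κ
    exact S.cell_self _
  · intro κ l x y _ hy hx
    have h := S.cell_swap (κ.push σ) (l.push σ)
    rw [hx] at h
    exact (cancel_epi x).1 (h.trans (by assumption : x ≫ y = 𝟙 _).symm)
  · intro κ l m x y hx hy
    rw [← hx, ← hy]
    exact (S.cell_comp _ _ _).symm

/-- `cell_push` for comparison `2`-cells that are not literally of the form `α ≫ σ`, as happens when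
they are built from other data. -/
theorem cell_push' {M M' : C} {i : A.Mor X M} {p : B.Mor M Y} {i' : A.Mor X M'} {p' : B.Mor M' Y}
    {α : i.val ≫ p.val ≅ f} {α' : i'.val ≫ p'.val ≅ f} {β : i.val ≫ p.val ≅ f'}
    {β' : i'.val ≫ p'.val ≅ f'} (σ : f ⟶ f') (h : β.hom = α.hom ≫ σ)
    (h' : β'.hom = α'.hom ≫ σ) :
    S.cell ⟨M, i, p, β⟩ ⟨M', i', p', β'⟩ = S.cell ⟨M, i, p, α⟩ ⟨M', i', p', α'⟩ := by
  obtain rfl : β = α ≪≫ asIso σ := Iso.ext h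
  obtain rfl : β' = α' ≪≫ asIso σ := Iso.ext h'
  exact S.cell_push ⟨M, i, p, α⟩ ⟨M', i', p', α'⟩ σ

/-! Extension by an edge -/

/-- The extension of a compactification of `f` by a square with bottom edge `e`, compared with a
compactification of `e f`. -/
noncomputable def extSq (κ : Comp A B B f) {V : C} {e : A.Mor Y Z} {j : A.Mor κ.mid V}
    {q : B.Mor V Z} (D : Sq A B j κ.p q e) (l : Comp A B B (f ≫ e.val)) :
    Glue.mor (κ.path ≫ TQ.edge A B .hor e) ⟶ l.gpath :=
  Glue.cell (κ.cellH D) ≫ S.cell (κ.extH D) l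

/-- Squares with left edge `κ.p` and bottom edge `e` are the compactifications of the composite of
`κ.p` and `e`, so any two are joined by a zigzag. Each step of it induces a morphism between the
extensions of `κ` whose `2`-cell is canonical, and `Hom.pathCell_extSq` gives the equality. -/
theorem extSq_eq (κ : Comp A B B f) {V V' : C} {e : A.Mor Y Z} {j : A.Mor κ.mid V}
    {q : B.Mor V Z} (D : Sq A B j κ.p q e) {j' : A.Mor κ.mid V'}
    {q' : B.Mor V' Z} (D' : Sq A B j' κ.p q' e) (l : Comp A B B (f ≫ e.val)) :
    S.extSq κ D l = S.extSq κ D' l := by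
  have key : ∀ w w' : Comp A B B (κ.p.val ≫ e.val), w.Linked w' →
      S.extSq κ w.toSq l = S.extSq κ w'.toSq l := by
    intro w w' h
    induction h with
    | rel w w' h =>
      obtain ⟨t⟩ := h
      have h := Comp.Hom.pathCell_extSq κ w.toSq w'.toSq t.r t.γ t.δ (by
        have := t.comm
        simpa [Comp.toSq] using this)
      rw [extSq, extSq, ← h, Glue.cell_comp, ← S.cell_hom]
      exact (Category.assoc _ _ _).trans (congrArg _ (S.cell_comp _ _ _))
    | refl _ => rfl
    | symm _ _ _ ih => exact ih.symm
    | trans _ _ _ _ _ ih ih' => exact ih.trans ih'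
  exact key (Comp.ofSq D) (Comp.ofSq D') (S.linked _ _)

/-- The comparison of the extension of a compactification of `f` by an edge `e` with a
compactification of `e f`. -/
noncomputable def ext (κ : Comp A B B f) : (e : Edge A B Y Z) → (l : Comp A B B (f ≫ e.2.val)) →
    (Glue.mor (κ.path ≫ TQ.edge A B e.1 e.2) ⟶ l.gpath)
  | ⟨.hor, e⟩, l => S.extSq κ (e := e) (S.comp (κ.p.val ≫ e.val)).toSq l
  | ⟨.ver, e⟩, l => Glue.cell (κ.cellV e) ≫ S.cell (κ.extV e) l

theorem ext_cell (κ : Comp A B B f) (e : Edge A B Y Z) (l l' : Comp A B B (f ≫ e.2.val)) :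
    S.ext κ e l ≫ S.cell l l' = S.ext κ e l' := by
  obtain ⟨_ | _, e⟩ := e
  · exact (Category.assoc _ _ _).trans (congrArg _ (S.cell_comp _ _ _))
  · exact (Category.assoc _ _ _).trans (congrArg _ (S.cell_comp _ _ _))

/-- It is enough to consider one morphism of compactifications. For a vertical edge this is
`Hom.pathCell_extV`; for a horizontal one it is `Hom.pathCell_extH`, after a compatible choice of
squares. -/
theorem whisker_cell_ext (κ l : Comp A B B f) (e : Edge A B Y Z) (m : Comp A B B (f ≫ e.2.val)) :
    Glue.whisker (S.cell κ l) (TQ.edge A B e.1 e.2) ≫ S.ext l e m = S.ext κ e m := by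
  refine S.whisker_cell_comp (fun κ => S.ext κ e m) ?_ κ l
  intro κ l s
  obtain ⟨_ | _, e⟩ := e
  -- The compactification chosen for `l.p` followed by `e` is a square `D'` with top edge `j'`, and
  -- the one chosen for `s.r` followed by `j'` is a square `E` on top of it. Their pasting serves as
  -- the square for `κ`, which `extSq_eq` permits.
  · have h := s.pathCell_extH (S.comp (s.r.val ≫ (S.comp (l.p.val ≫ e.val)).i.val)).toSq
      (S.comp (l.p.val ≫ e.val)).toSq
    have h1 : S.ext κ ⟨.hor, e⟩ m = _ := S.extSq_eq κ (e := e) _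
      (s.pasteSq (S.comp (s.r.val ≫ (S.comp (l.p.val ≫ e.val)).i.val)).toSq
        (S.comp (l.p.val ≫ e.val)).toSq) m
    rw [h1, extSq, ← Category.assoc]
    refine (congrArg (fun x => x ≫ _) ((Glue.cell_comp _ _).symm.trans
      ((congrArg Glue.cell h).trans (Glue.cell_comp _ _)))).trans ?_
    rw [← S.cell_hom]
    exact (Category.assoc _ _ _).trans (congrArg _ (S.cell_comp _ _ _))
  · have h := s.pathCell_extV e
    have h1 : S.ext κ ⟨.ver, e⟩ m = Glue.cell (κ.cellV e) ≫ S.cell (κ.extV e) m := rfl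
    rw [h1, ← Category.assoc]
    refine (congrArg (fun x => x ≫ _) ((Glue.cell_comp _ _).symm.trans
      ((congrArg Glue.cell h).trans (Glue.cell_comp _ _)))).trans ?_
    rw [← S.cell_hom]
    exact (Category.assoc _ _ _).trans (congrArg _ (S.cell_comp _ _ _))

end Canonical

theorem Glue.whisker_comp_comp {X Y Z : C} {a b c : (TQ.mk X : TQ A B) ⟶ TQ.mk Y}
    (s : Glue.mor a ⟶ Glue.mor b) (t : Glue.mor b ⟶ Glue.mor c)
    (e : (TQ.mk Y : TQ A B) ⟶ TQ.mk Z) {d : Glue.of A B X ⟶ Glue.of A B Z}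
    (r : Glue.mor (c ≫ e) ⟶ d) :
    Glue.whisker (s ≫ t) e ≫ r = Glue.whisker s e ≫ Glue.whisker t e ≫ r := by
  rw [Glue.whisker_comp]
  exact Category.assoc _ _ _

namespace Canonical

variable (S : Canonical A B) {X Y Z : C} {f f' : X ⟶ Y}

theorem comp_cell_self {κ : Comp A B B f} {t : Glue.of A B X ⟶ Glue.of A B Y} (x : t ⟶ κ.gpath) :
    x ≫ S.cell κ κ = x := by
  rw [S.cell_self, Category.comp_id]

/-- The composite `pe` is a variable, and `β` is prescribed up to trivial `2`-cells, because
equalities such as `p 1 = p` hold only propositionally. -/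
theorem ext_ver {M : C} {i : A.Mor X M} {p : B.Mor M Y} {α : i.val ≫ p.val ≅ f} (e : B.Mor Y Z)
    {pe : B.Mor M Z} (h : p.comp e = pe) (β : i.val ≫ pe.val ≅ f ≫ e.val)
    (hβ : Same β.hom (α.hom ▷ e.val)) :
    S.ext ⟨M, i, p, α⟩ (ver A e) ⟨M, i, pe, β⟩ =
      Glue.cell ((α_ _ _ _).hom ≫ edge A B .hor i ◁ m A B .ver p e pe h) := by
  subst h
  obtain rfl : β = (Comp.extV ⟨M, i, p, α⟩ e).α :=
    Iso.ext (hβ.trans ((triv_assoc_inv _ _ _).same_comp _).symm).eq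
  exact S.comp_cell_self (Glue.cell (Comp.cellV ⟨M, i, p, α⟩ e))

theorem ext_extH (κ : Comp A B B f) {V : C} {e : A.Mor Y Z} {j : A.Mor κ.mid V}
    {q : B.Mor V Z} (D : Sq A B j κ.p q e) :
    S.ext κ (hor B e) (κ.extH D) = Glue.cell (κ.cellH D) :=
  (S.extSq_eq κ (S.comp (κ.p.val ≫ e.val)).toSq D (κ.extH D)).trans
    (S.comp_cell_self (Glue.cell (κ.cellH D)))

/-- By `extSq_eq` any square may be used. The condition `hβ` determines `β`, while `ij` and `t`
leave room for equalities such as `i 1 = i` and associativity. -/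
theorem ext_hor {M V : C} {i : A.Mor X M} {p : B.Mor M Y} {α : i.val ≫ p.val ≅ f} {e : A.Mor Y Z}
    {j : A.Mor M V} {q : B.Mor V Z} (D : Sq A B j p q e) {ij : A.Mor X V} (h : i.comp j = ij)
    (β : ij.val ≫ q.val ≅ f ≫ e.val) {t : i.val ≫ j.val ≫ q.val ⟶ ij.val ≫ q.val} (ht : Triv t)
    (hβ : Same (i.val ◁ D.cell ≫ t ≫ β.hom) (α.hom ▷ e.val)) :
    S.ext ⟨M, i, p, α⟩ (hor B e) ⟨V, ij, q, β⟩ =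
      Glue.cell ((α_ _ _ _).hom ≫ edge A B .hor i ◁ sq D ≫ (α_ _ _ _).inv ≫
        m A B .hor i j ij h ▷ edge A B .ver q) := by
  subst h
  have hβ' : β = (Comp.extH ⟨M, i, p, α⟩ D).α := by
    have h2 : β.hom = (α_ i.val j.val q.val).hom ≫ i.val ◁ inv D.cell ≫
        (α_ i.val p.val e.val).inv ≫ α.hom ▷ e.val := by
      rw [ht.eq (triv_assoc_inv _ _ _)] at hβ
      rw [← (hβ.trans ((triv_assoc_inv i.val p.val e.val).same_comp _).symm).eq,
        ← Bicategory.whiskerLeft_comp_assoc]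
      simp
    exact Iso.ext h2
  rw [hβ']
  exact S.ext_extH ⟨M, i, p, α⟩ D

/-- The compactification of an identity given by identities. -/
def oneComp (A B : Arrowy C) (X : C) : Comp A B B (𝟙 X) := ⟨X, A.one X, B.one X, λ_ (𝟙 X)⟩

/-- The insertion of a vertical and a horizontal identity. -/
def oneCell (A B : Arrowy C) (X : C) : 𝟙 (TQ.mk X : TQ A B) ⟶ (oneComp A B X).path :=
  u A B .hor X ≫ (ρ_ _).inv ≫ edge A B .hor (A.one X) ◁ u A B .ver X

/-- The comparison between a path and the compactifications of its composite. -/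
noncomputable def norm {X : C} : {Y : C} → (a : TPath A B X Y) → (l : Comp A B B a.eval) →
    (Glue.mor (X := X) (Y := Y) a ⟶ l.gpath)
  | _, .nil _, l => Glue.cell (oneCell A B X) ≫ S.cell (oneComp A B X) l
  | _, .cons p e, l => Glue.whisker (norm p (S.comp p.eval)) (TQ.edge A B e.1 e.2) ≫
      S.ext (S.comp p.eval) e l

theorem norm_cell (a : TPath A B X Y) (κ l : Comp A B B a.eval) :
    S.norm a κ ≫ S.cell κ l = S.norm a l := by
  cases a with
  | nil =>
    exact (Category.assoc (Glue.cell (oneCell A B X)) (S.cell _ κ) (S.cell κ l)).trans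
      (congrArg (fun x => Glue.cell (oneCell A B X) ≫ x) (S.cell_comp _ _ _))
  | cons p e =>
    exact (Category.assoc (Glue.whisker (S.norm p (S.comp p.eval)) (TQ.edge A B e.1 e.2))
      (S.ext _ e κ) (S.cell κ l)).trans (congrArg (fun x => Glue.whisker _ _ ≫ x)
        (S.ext_cell _ e κ l))

/-- The definition of `norm` passes through the chosen compactification of the shorter path; by
`whisker_cell_ext` any other one does as well. This freedom allows compactifications adapted to each
generator. -/
theorem norm_cons (a : TPath A B X Y) (e : Edge A B Y Z) (κ : Comp A B B a.eval)
    (l : Comp A B B (a.cons e).eval) :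
    S.norm (a.cons e) l = Glue.whisker (S.norm a κ) (TQ.edge A B e.1 e.2) ≫ S.ext κ e l := by
  have h := Glue.whisker_comp_comp (S.norm a (S.comp a.eval)) (S.cell (S.comp a.eval) κ)
    (TQ.edge A B e.1 e.2) (S.ext κ e l)
  rw [S.norm_cell] at h
  exact (h.trans (congrArg (fun x => Glue.whisker (S.norm a (S.comp a.eval)) _ ≫ x)
    (S.whisker_cell_ext (S.comp a.eval) κ e l))).symm

/-- The comparisons between paths and compactifications are compatible with a `2`-cell `w` of
`Glue A B` lying over a `2`-cell `s` of `C`. -/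
def Nat {a b : TPath A B X Y} (w : Glue.mor (X := X) (Y := Y) a ⟶ Glue.mor (X := X) (Y := Y) b)
    (s : a.eval ⟶ b.eval) : Prop :=
  ∀ ⦃M : C⦄ (i : A.Mor X M) (p : B.Mor M Y) (α : i.val ≫ p.val ≅ a.eval)
    (β : i.val ≫ p.val ≅ b.eval), β.hom = α.hom ≫ s →
      S.norm a ⟨M, i, p, α⟩ = w ≫ S.norm b ⟨M, i, p, β⟩

variable {S}

/-- Passing to another compactification composes both sides with canonical `2`-cells, and these
coincide by `cell_push'`. Thus one compactification suffices for naturality. -/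
theorem Nat.mk' {a b : TPath A B X Y}
    {w : Glue.mor (X := X) (Y := Y) a ⟶ Glue.mor (X := X) (Y := Y) b}
    {s : a.eval ⟶ b.eval} {M : C} {i : A.Mor X M} {p : B.Mor M Y} (α : i.val ≫ p.val ≅ a.eval)
    (β : i.val ≫ p.val ≅ b.eval) (h : β.hom = α.hom ≫ s)
    (e : S.norm a ⟨M, i, p, α⟩ = w ≫ S.norm b ⟨M, i, p, β⟩) : S.Nat w s := by
  intro M' i' p' α' β' h'
  rw [← S.norm_cell a ⟨M, i, p, α⟩, ← S.norm_cell b ⟨M, i, p, β⟩, e, S.cell_push' s h h']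
  exact Category.assoc _ _ _

theorem Nat.id (a : TPath A B X Y) : S.Nat (𝟙 (Glue.mor (X := X) (Y := Y) a)) (𝟙 a.eval) := by
  intro M i p α β h
  obtain rfl : β = α := Iso.ext (h.trans (Category.comp_id _))
  exact (Category.id_comp _).symm

theorem Nat.comp {a b c : TPath A B X Y}
    {w : Glue.mor (X := X) (Y := Y) a ⟶ Glue.mor (X := X) (Y := Y) b}
    {w' : Glue.mor (X := X) (Y := Y) b ⟶ Glue.mor (X := X) (Y := Y) c}
    {s : a.eval ⟶ b.eval} {s' : b.eval ⟶ c.eval} (h : S.Nat w s) (h' : S.Nat w' s') :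
    S.Nat (w ≫ w') (s ≫ s') := by
  intro M i p α β hβ
  rw [h i p α (α ≪≫ asIso s) rfl, h' i p (α ≪≫ asIso s) β (by simp [hβ])]
  exact (Category.assoc _ _ _).symm

/-- This spares a separate treatment of `theta` and `delta`, the inverses of `iota` and `gamma`. -/
theorem Nat.symm {a b : TPath A B X Y}
    {w : Glue.mor (X := X) (Y := Y) a ⟶ Glue.mor (X := X) (Y := Y) b}
    {w' : Glue.mor (X := X) (Y := Y) b ⟶ Glue.mor (X := X) (Y := Y) a}
    {s : a.eval ⟶ b.eval} {s' : b.eval ⟶ a.eval} (h : S.Nat w s) (hw : w' ≫ w = 𝟙 _)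
    (hs : s' ≫ s = 𝟙 _) : S.Nat w' s' := by
  intro M i p α β hβ
  rw [h i p β α (by rw [hβ, Category.assoc, hs, Category.comp_id])]
  refine Eq.trans ?_ (Category.assoc _ _ _)
  rw [hw]
  exact (Category.id_comp _).symm

-- An extension by an edge is a `2`-cell that depends on `i`, `p` and `e` only, followed by a
-- canonical one. Neither notices the replacement of `f` by `f'`.
variable (S) in
theorem ext_push {M : C} {i : A.Mor X M} {p : B.Mor M Y} {α : i.val ≫ p.val ≅ f}
    {β : i.val ≫ p.val ≅ f'} (s : f ⟶ f') (h : β.hom = α.hom ≫ s) (e : Edge A B Y Z)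
    {M' : C} {i' : A.Mor X M'} {p' : B.Mor M' Z} {α' : i'.val ≫ p'.val ≅ f ≫ e.2.val}
    {β' : i'.val ≫ p'.val ≅ f' ≫ e.2.val} (h' : β'.hom = α'.hom ≫ s ▷ e.2.val) :
    S.ext ⟨M, i, p, α⟩ e ⟨M', i', p', α'⟩ = S.ext ⟨M, i, p, β⟩ e ⟨M', i', p', β'⟩ := by
  obtain ⟨_ | _, e⟩ := e
  · refine congrArg (fun x => _ ≫ x) (S.cell_push' (s ▷ e.val) ?_ h').symm
    simp [h]
  · refine congrArg (fun x => _ ≫ x) (S.cell_push' (s ▷ e.val) ?_ h').symm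
    simp [h]

/-- Both paths can be normalized through the same `p₀ * i₀`, after which the extension by `e` is the
same `2`-cell for both (`ext_push`). This takes care of the context following a generator. -/
theorem Nat.whisker {a b : TPath A B X Y}
    {w : Glue.mor (X := X) (Y := Y) a ⟶ Glue.mor (X := X) (Y := Y) b}
    {s : a.eval ⟶ b.eval} (h : S.Nat w s) (e : Edge A B Y Z) :
    S.Nat (a := a.cons e) (b := b.cons e) (Glue.whisker w (TQ.edge A B e.1 e.2))
      (s ▷ e.2.val) := by
  intro M i p α β hβ
  obtain ⟨M₀, i₀, p₀, α₀⟩ := S.comp a.eval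
  rw [S.norm_cons a e ⟨M₀, i₀, p₀, α₀⟩, S.norm_cons b e ⟨M₀, i₀, p₀, α₀ ≪≫ asIso s⟩,
    h i₀ p₀ α₀ (α₀ ≪≫ asIso s) rfl]
  refine Eq.trans (congrArg (fun x => _ ≫ x)
    (S.ext_push (f' := b.eval) (β := α₀ ≪≫ asIso s) s rfl e (β' := β) hβ)) ?_
  exact Glue.whisker_comp_comp w (S.norm b ⟨M₀, i₀, p₀, α₀ ≪≫ asIso s⟩) (TQ.edge A B e.1 e.2)
    (S.ext ⟨M₀, i₀, p₀, α₀ ≪≫ asIso s⟩ e ⟨M, i, p, β⟩)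

end Canonical

/-! ### Naturality of the normalization with respect to the generating `2`-cells -/

namespace Glue

variable {X Y Z W : C} {a b : (TQ.mk X : TQ A B) ⟶ TQ.mk Y}

/-- By interchange, a `2`-cell acting after a path commutes with the normalization `n` of this path.
Here and in the next lemmas this reduces naturality after an arbitrary path `a` to an identity of
`2`-cells after `b`, which will be of the form `p * i`. -/
theorem insert_whisker (n : mor a ⟶ mor b) {e : (TQ.mk Y : TQ A B) ⟶ TQ.mk Y} (s : 𝟙 _ ⟶ e)
    {c : (TQ.mk X : TQ A B) ⟶ TQ.mk Y} (t : b ≫ e ⟶ c) :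
    cell ((ρ_ a).inv ≫ a ◁ s) ≫ whisker n e ≫ cell t =
      n ≫ cell ((ρ_ b).inv ≫ b ◁ s ≫ t) := by
  have h1 := cell_whisker n s
  rw [whisker_one] at h1
  have h2 : cell (ρ_ a).inv ≫ cell (ρ_ a).hom = 𝟙 _ := by
    rw [← cell_comp, Iso.inv_hom_id, cell_id]
  simp only [cell_comp, Category.assoc] at h1 ⊢
  rw [reassoc_of% h1, reassoc_of% h2]

theorem whisker_whisker_cell (n : mor a ⟶ mor b) {e : (TQ.mk Y : TQ A B) ⟶ TQ.mk Z}
    {e' : (TQ.mk Z : TQ A B) ⟶ TQ.mk W} {e'' : (TQ.mk Y : TQ A B) ⟶ TQ.mk W} (s : e ≫ e' ⟶ e'') :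
    cell ((α_ a e e').hom ≫ a ◁ s) ≫ whisker n e'' =
      whisker (whisker n e) e' ≫ cell ((α_ b e e').hom ≫ b ◁ s) := by
  have h1 := cell_whisker n s
  rw [whisker_whisker] at h1
  have h2 : cell (α_ a e e').hom ≫ cell (α_ a e e').inv = 𝟙 _ := by
    rw [← cell_comp, Iso.hom_inv_id, cell_id]
  simp only [cell_comp, Category.assoc] at h1 ⊢
  rw [h1, reassoc_of% h2]

theorem compose_whisker (n : mor a ⟶ mor b) {e : (TQ.mk Y : TQ A B) ⟶ TQ.mk Z}
    {e' : (TQ.mk Z : TQ A B) ⟶ TQ.mk W} {e'' : (TQ.mk Y : TQ A B) ⟶ TQ.mk W} (s : e ≫ e' ⟶ e'')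
    {c : (TQ.mk X : TQ A B) ⟶ TQ.mk Z} {d : (TQ.mk X : TQ A B) ⟶ TQ.mk W}
    (t : b ≫ e ⟶ c) (t' : c ≫ e' ⟶ d) (t'' : b ≫ e'' ⟶ d)
    (h : t ▷ e' ≫ t' = (α_ b e e').hom ≫ b ◁ s ≫ t'') :
    whisker (whisker n e ≫ cell t) e' ≫ cell t' =
      cell ((α_ a e e').hom ≫ a ◁ s) ≫ whisker n e'' ≫ cell t'' := by
  rw [← Category.assoc (cell ((α_ a e e').hom ≫ a ◁ s)), whisker_whisker_cell, whisker_comp,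
    whisker_cell]
  simp only [Category.assoc, ← cell_comp, h]

theorem square_whisker (n : mor a ⟶ mor b) {Z' : C} {e : (TQ.mk Y : TQ A B) ⟶ TQ.mk Z}
    {e' : (TQ.mk Z : TQ A B) ⟶ TQ.mk W} {r : (TQ.mk Y : TQ A B) ⟶ TQ.mk Z'}
    {r' : (TQ.mk Z' : TQ A B) ⟶ TQ.mk W} (s : e ≫ e' ⟶ r ≫ r')
    {c : (TQ.mk X : TQ A B) ⟶ TQ.mk Z} {c' : (TQ.mk X : TQ A B) ⟶ TQ.mk Z'}
    {d : (TQ.mk X : TQ A B) ⟶ TQ.mk W}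
    (t : b ≫ e ⟶ c) (t' : c ≫ e' ⟶ d) (x : b ≫ r ⟶ c') (x' : c' ≫ r' ⟶ d)
    (h : t ▷ e' ≫ t' = (α_ b e e').hom ≫ b ◁ s ≫ (α_ b r r').inv ≫ x ▷ r' ≫ x') :
    whisker (whisker n e ≫ cell t) e' ≫ cell t' =
      cell ((α_ a e e').hom ≫ a ◁ s ≫ (α_ a r r').inv) ≫
        whisker (whisker n r ≫ cell x) r' ≫ cell x' := by
  have h1 := compose_whisker n s t t' ((α_ b r r').inv ≫ x ▷ r' ≫ x') h
  rw [h1, whisker_whisker, whisker_comp, whisker_cell]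
  simp only [cell_comp, Category.assoc]
  have h2 : cell (α_ b r r').hom ≫ cell (α_ b r r').inv = 𝟙 _ := by
    rw [← cell_comp, Iso.hom_inv_id, cell_id]
  rw [reassoc_of% h2]

end Glue

/-- A path of edges, as a morphism. -/
abbrev TPath.hom {X Y : C} (a : TPath A B X Y) : (TQ.mk X : TQ A B) ⟶ TQ.mk Y := a

namespace Canonical

variable {S : Canonical A B} {X Y Z W : C}

variable (S) in
theorem norm_ver (a : TPath A B X Y) {M : C} {i : A.Mor X M} {p : B.Mor M Y}
    (α : i.val ≫ p.val ≅ a.eval) (e : B.Mor Y Z)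
    {pe : B.Mor M Z} (h : p.comp e = pe) (β : i.val ≫ pe.val ≅ a.eval ≫ e.val)
    (hβ : Same β.hom (α.hom ▷ e.val)) :
    S.norm (a.cons (ver A e)) ⟨M, i, pe, β⟩ =
      Glue.whisker (a := a.hom) (S.norm a ⟨M, i, p, α⟩) (edge A B .ver e) ≫
        Glue.cell ((α_ _ _ _).hom ≫ edge A B .hor i ◁ m A B .ver p e pe h) := by
  rw [← S.ext_ver e h β hβ]
  exact S.norm_cons a (ver A e) ⟨M, i, p, α⟩ ⟨M, i, pe, β⟩

variable (S) in
theorem norm_hor (a : TPath A B X Y) {M V : C} {i : A.Mor X M} {p : B.Mor M Y}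
    (α : i.val ≫ p.val ≅ a.eval) {e : A.Mor Y Z}
    {j : A.Mor M V} {q : B.Mor V Z} (D : Sq A B j p q e) {ij : A.Mor X V} (h : i.comp j = ij)
    (β : ij.val ≫ q.val ≅ a.eval ≫ e.val) {t : i.val ≫ j.val ≫ q.val ⟶ ij.val ≫ q.val}
    (ht : Triv t) (hβ : Same (i.val ◁ D.cell ≫ t ≫ β.hom) (α.hom ▷ e.val)) :
    S.norm (a.cons (hor B e)) ⟨V, ij, q, β⟩ =
      Glue.whisker (a := a.hom) (S.norm a ⟨M, i, p, α⟩) (edge A B .hor e) ≫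
        Glue.cell ((α_ _ _ _).hom ≫ edge A B .hor i ◁ sq D ≫ (α_ _ _ _).inv ≫
          m A B .hor i j ij h ▷ edge A B .ver q) := by
  rw [← S.ext_hor D h β ht hβ]
  exact S.norm_cons a (hor B e) ⟨M, i, p, α⟩ ⟨V, ij, q, β⟩

/-- The comparison `2`-cell of `Comp.extH`, recorded through the property that `norm_hor` asks for,
so that its explicit form can be forgotten. -/
theorem exists_extH {f : X ⟶ Y} {M V : C} {i : A.Mor X M} {p : B.Mor M Y}
    (α : i.val ≫ p.val ≅ f) {e : A.Mor Y Z} {j : A.Mor M V} {q : B.Mor V Z} (D : Sq A B j p q e) :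
    ∃ β : (i.comp j).val ≫ q.val ≅ f ≫ e.val,
      Same (i.val ◁ D.cell ≫ (α_ i.val j.val q.val).inv ≫ β.hom) (α.hom ▷ e.val) := by
  refine ⟨α_ i.val j.val q.val ≪≫ whiskerLeftIso i.val (asIso D.cell).symm ≪≫
    (α_ i.val p.val e.val).symm ≪≫ whiskerRightIso α e.val, ?_⟩
  have h : i.val ◁ D.cell ≫ (α_ i.val j.val q.val).inv ≫ (α_ i.val j.val q.val).hom ≫
      i.val ◁ inv D.cell ≫ (α_ i.val p.val e.val).inv ≫ α.hom ▷ e.val =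
      (α_ i.val p.val e.val).inv ≫ α.hom ▷ e.val := by
    rw [Iso.inv_hom_id_assoc, ← Bicategory.whiskerLeft_comp_assoc]
    simp
  refine Same.trans ?_ ((triv_assoc_inv i.val p.val e.val).same_comp _)
  rw [← h]
  exact Same.refl _

/-- Since `p 1 = p`, the path and its extension by a vertical identity have the common normal form
`p * i`. The two normalizations differ by an insertion followed by a composition with `p`, which is
trivial by `m_u`. -/
theorem nat_u_ver (a : TPath A B X Y) :
    S.Nat (a := a) (b := a.cons (ver A (B.one Y)))
      (Glue.cell (a := a.hom) ((ρ_ a.hom).inv ≫ a.hom ◁ u A B .ver Y)) (ρ_ a.eval).inv := by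
  obtain ⟨M, i, p, α⟩ := S.comp a.eval
  let β : i.val ≫ p.val ≅ a.eval ≫ 𝟙 Y := α ≪≫ (ρ_ a.eval).symm
  refine Nat.mk' α β rfl ?_
  have hp : p.comp (B.one Y) = p := Arrowy.Mor.ext (Strict.comp_id _)
  rw [S.norm_ver a α (B.one Y) hp β
    (((triv_rightUnitor_inv _).comp_same _).trans (same_right_id _).symm)]
  refine Eq.trans ?_ (Glue.insert_whisker (a := a.hom) (S.norm a ⟨M, i, p, α⟩) (u A B .ver Y)
    ((α_ _ _ _).hom ≫ edge A B .hor i ◁ m A B .ver p (B.one Y) p hp)).symm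
  have h : (ρ_ (edge A B .hor i ≫ edge A B .ver p)).inv ≫
      (edge A B .hor i ≫ edge A B .ver p) ◁ u A B .ver Y ≫
        (α_ _ _ _).hom ≫ edge A B .hor i ◁ m A B .ver p (B.one Y) p hp = 𝟙 _ := by
    have := m_u (A := A) (k := .ver) p hp
    calc _ = 𝟙 _ ⊗≫ edge A B .hor i ◁
          (edge A B .ver p ◁ u A B .ver Y ≫ m A B .ver p (B.one Y) p hp) := by bicategory
      _ = 𝟙 _ := by
        erw [this]
        bicategory
  rw [h, Glue.cell_id]
  exact (Category.comp_id _).symm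

/-- The identity square of `p` is an admissible choice for sliding the horizontal identity past `p`.
By `sq_idVer` this moves the insertion between `p` and `i`, where it is absorbed into `i` by `m_u`.
-/
theorem nat_u_hor (a : TPath A B X Y) :
    S.Nat (a := a) (b := a.cons (hor B (A.one Y)))
      (Glue.cell (a := a.hom) ((ρ_ a.hom).inv ≫ a.hom ◁ u A B .hor Y)) (ρ_ a.eval).inv := by
  obtain ⟨M, i, p, α⟩ := S.comp a.eval
  let β : i.val ≫ p.val ≅ a.eval ≫ 𝟙 Y := α ≪≫ (ρ_ a.eval).symm
  refine Nat.mk' α β rfl ?_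
  have hi : i.comp (A.one M) = i := Arrowy.Mor.ext (Strict.comp_id _)
  rw [S.norm_hor a α (e := A.one Y) (Sq.idVer p) hi β
    (t := (α_ _ _ _).inv ≫ (ρ_ _).hom ▷ p.val)
    ((triv_assoc_inv _ _ _).comp ((triv_rightUnitor _).right _)) (by
      refine Same.trans ?_ (same_right_id _).symm
      refine ((((triv_rightUnitor _).comp (triv_leftUnitor_inv _)).left _).same_comp _).trans ?_
      refine ((((triv_assoc_inv _ _ _).comp ((triv_rightUnitor _).right _))).same_comp _).trans ?_
      exact (triv_rightUnitor_inv _).comp_same _)]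
  refine Eq.trans ?_ (Glue.insert_whisker (a := a.hom) (S.norm a ⟨M, i, p, α⟩) (u A B .hor Y)
    ((α_ _ _ _).hom ≫ edge A B .hor i ◁ sq (Sq.idVer p) ≫ (α_ _ _ _).inv ≫
        m A B .hor i (A.one M) i hi ▷ edge A B .ver p)).symm
  have h : (ρ_ (edge A B .hor i ≫ edge A B .ver p)).inv ≫
      (edge A B .hor i ≫ edge A B .ver p) ◁ u A B .hor Y ≫
        (α_ _ _ _).hom ≫ edge A B .hor i ◁ sq (Sq.idVer p) ≫ (α_ _ _ _).inv ≫
        m A B .hor i (A.one M) i hi ▷ edge A B .ver p = 𝟙 _ := by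
    have h1 := m_u (B := B) (k := .hor) i hi
    have h2 := sq_idVer (A := A) p
    calc _ = 𝟙 _ ⊗≫ edge A B .hor i ◁
          (edge A B .ver p ◁ u A B .hor Y ≫ sq (Sq.idVer p)) ⊗≫
            m A B .hor i (A.one M) i hi ▷ edge A B .ver p := by bicategory
      _ = 𝟙 _ ⊗≫ (edge A B .hor i ◁ u A B .hor M ≫ m A B .hor i (A.one M) i hi) ▷
            edge A B .ver p := by
        rw [h2]
        bicategory
      _ = 𝟙 _ := by
        erw [h1]
        bicategory
  rw [h, Glue.cell_id]
  exact (Category.comp_id _).symm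

/-- With the normal form `p * i` of `a`, the claim is associativity of `gamma` for `p`, `h`, `h'`.
-/
theorem nat_m_ver (a : TPath A B X Y) (h : B.Mor Y Z) (h' : B.Mor Z W) :
    S.Nat (a := (a.cons (ver A h)).cons (ver A h')) (b := a.cons (ver A (h.comp h')))
      (Glue.cell (a := (a.hom ≫ edge A B .ver h) ≫ edge A B .ver h')
        ((α_ a.hom (edge A B .ver h) (edge A B .ver h')).hom ≫
          a.hom ◁ m A B .ver h h' (h.comp h') rfl))
      (α_ a.eval h.val h'.val).hom := by
  obtain ⟨M, i, p, α⟩ := S.comp a.eval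
  have e : (p.comp h).comp h' = p.comp (h.comp h') := Arrowy.Mor.ext (Strict.assoc _ _ _)
  let α₁ : i.val ≫ (p.comp h).val ≅ a.eval ≫ h.val := (α_ _ _ _).symm ≪≫ whiskerRightIso α h.val
  let β : i.val ≫ (p.comp (h.comp h')).val ≅ a.eval ≫ (h.comp h').val :=
    (α_ _ _ _).symm ≪≫ whiskerRightIso α (h.comp h').val
  let α₂ : i.val ≫ (p.comp (h.comp h')).val ≅ (a.eval ≫ h.val) ≫ h'.val :=
    β ≪≫ (α_ _ _ _).symm
  have hα₁ : Same α₁.hom (α.hom ▷ h.val) := (triv_assoc_inv _ _ _).same_comp _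
  have hβ : Same β.hom (α.hom ▷ (h.comp h').val) := (triv_assoc_inv _ _ _).same_comp _
  have hα₂ : Same α₂.hom (α₁.hom ▷ h'.val) :=
    ((triv_assoc_inv _ _ _).comp_same _).trans (hβ.trans ((same_right_comp _ _ _).trans
      (hα₁.symm.right rfl)))
  refine Nat.mk' α₂ β ((Category.assoc _ _ _).trans
    ((congrArg _ (Iso.inv_hom_id _)).trans (Category.comp_id _))).symm ?_
  rw [S.norm_ver (a.cons (ver A h)) α₁ h' e α₂ hα₂, S.norm_ver a α h rfl α₁ hα₁,
    S.norm_ver a α (h.comp h') rfl β hβ]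
  refine Glue.compose_whisker (a := a.hom) (S.norm a ⟨M, i, p, α⟩) (m A B .ver h h' _ rfl)
    _ _ _ ?_
  have h1 := m_assoc (A := A) (k := .ver) p h h' _ _ _ rfl rfl e rfl
  calc _ = 𝟙 _ ⊗≫ edge A B .hor i ◁ (m A B .ver p h _ rfl ▷ edge A B .ver h' ≫
        m A B .ver (p.comp h) h' _ e) := by bicategory
    _ = _ := by
      rw [h1]
      bicategory

/-- The edge `h` slides past `p` along a square `D`, then `h'` slides past the right edge of `D`
along a square `D'`. The pasting of `D` and `D'` is an admissible square for the composite edge, so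
the claim follows from the pasting relation and from associativity of `gamma` for `i`, `j`, `j'`. -/
theorem nat_m_hor (a : TPath A B X Y) (h : A.Mor Y Z) (h' : A.Mor Z W) :
    S.Nat (a := (a.cons (hor B h)).cons (hor B h')) (b := a.cons (hor B (h.comp h')))
      (Glue.cell (a := (a.hom ≫ edge A B .hor h) ≫ edge A B .hor h')
        ((α_ a.hom (edge A B .hor h) (edge A B .hor h')).hom ≫
          a.hom ◁ m A B .hor h h' (h.comp h') rfl))
      (α_ a.eval h.val h'.val).hom := by
  obtain ⟨M, i, p, α⟩ := S.comp a.eval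
  obtain ⟨V, j, q, η⟩ := S.comp (p.val ≫ h.val)
  let D : Sq A B j p q h := ⟨η.inv⟩
  obtain ⟨V', j', q', η'⟩ := S.comp (q.val ≫ h'.val)
  let D' : Sq A B j' q q' h' := ⟨η'.inv⟩
  have e : i.comp (j.comp j') = (i.comp j).comp j' :=
    Arrowy.Mor.ext (Strict.assoc _ _ _).symm
  obtain ⟨α₁, hα₁⟩ := exists_extH α D
  obtain ⟨α₂, hα₂⟩ := exists_extH α₁ D'
  let β : ((i.comp j).comp j').val ≫ q'.val ≅ a.eval ≫ (h.comp h').val :=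
    α₂ ≪≫ α_ a.eval h.val h'.val
  have hβ : Same (i.val ◁ (D.hcomp D').cell ≫ ((α_ i.val (j.val ≫ j'.val) q'.val).inv ≫
      (α_ i.val j.val j'.val).inv ▷ q'.val) ≫ β.hom) (α.hom ▷ (h.comp h').val) := by
    have h1 : i.val ◁ D.cell ≫ (α_ i.val j.val q.val).inv ≫ α₁.hom =
        (α_ i.val p.val h.val).inv ≫ α.hom ▷ h.val :=
      (hα₁.trans ((triv_assoc_inv _ _ _).same_comp _).symm).eq
    have h2 : (α_ (i.val ≫ j.val) q.val h'.val).hom ≫ (i.val ≫ j.val) ◁ D'.cell ≫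
        (α_ (i.val ≫ j.val) j'.val q'.val).inv ≫ α₂.hom = α₁.hom ▷ h'.val :=
      (((triv_assoc _ _ _).same_comp _).trans hα₂).eq
    have h3 : i.val ◁ (D.hcomp D').cell ≫ ((α_ i.val (j.val ≫ j'.val) q'.val).inv ≫
        (α_ i.val j.val j'.val).inv ▷ q'.val) ≫ β.hom =
        (α_ i.val p.val (h.val ≫ h'.val)).inv ≫ α.hom ▷ (h.val ≫ h'.val) := by
      have h4 : β.hom = α₂.hom ≫ (α_ a.eval h.val h'.val).hom := rfl
      rw [h4]
      calc _ = 𝟙 _ ⊗≫ (i.val ◁ D.cell ≫ (α_ i.val j.val q.val).inv) ▷ h'.val ≫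
            ((α_ (i.val ≫ j.val) q.val h'.val).hom ≫ (i.val ≫ j.val) ◁ D'.cell ≫
        (α_ (i.val ≫ j.val) j'.val q'.val).inv ≫ α₂.hom) ≫ (α_ a.eval h.val h'.val).hom := by
            rw [Sq.hcomp]
            bicategory
        _ = 𝟙 _ ⊗≫ (i.val ◁ D.cell ≫ (α_ i.val j.val q.val).inv ≫ α₁.hom) ▷ h'.val ≫
            (α_ a.eval h.val h'.val).hom := by
            rw [h2]
            bicategory
        _ = _ := by
            rw [h1]
            bicategory
    rw [h3]
    exact (triv_assoc_inv _ _ _).same_comp _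
  refine Nat.mk' α₂ β rfl ?_
  rw [S.norm_hor (a.cons (hor B h)) α₁ D' rfl α₂ (triv_assoc_inv _ _ _) hα₂,
    S.norm_hor a α D rfl α₁ (triv_assoc_inv _ _ _) hα₁,
    S.norm_hor a α (D.hcomp D') e β
      ((triv_assoc_inv _ _ _).comp ((triv_assoc_inv _ _ _).right _)) hβ]
  refine Glue.compose_whisker (a := a.hom) (S.norm a ⟨M, i, p, α⟩) (m A B .hor h h' _ rfl)
    _ _ _ ?_
  have h1 := m_assoc (B := B) (k := .hor) i j j' _ _ _ rfl rfl rfl e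
  have h2 := sq_hcomp D D' (D.hcomp D') rfl rfl (Same.refl _)
  calc _ = 𝟙 _ ⊗≫ edge A B .hor i ◁ sq D ▷ edge A B .hor h' ⊗≫
        (m A B .hor i j (i.comp j) rfl ▷ (edge A B .ver q ≫ edge A B .hor h') ≫
          edge A B .hor (i.comp j) ◁ sq D') ⊗≫
        m A B .hor (i.comp j) j' _ rfl ▷ edge A B .ver q' := by bicategory
    _ = 𝟙 _ ⊗≫ edge A B .hor i ◁ (sq D ▷ edge A B .hor h' ≫ (α_ _ _ _).hom ≫
          edge A B .hor j ◁ sq D') ⊗≫ (m A B .hor i j (i.comp j) rfl ▷ edge A B .hor j' ≫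
        m A B .hor (i.comp j) j' _ rfl) ▷ edge A B .ver q' := by
      rw [← whisker_exchange]
      bicategory
    _ = 𝟙 _ ⊗≫ edge A B .hor i ◁ (sq D ▷ edge A B .hor h' ≫ (α_ _ _ _).hom ≫
          edge A B .hor j ◁ sq D' ≫ (α_ _ _ _).inv ≫
            m A B .hor j j' _ rfl ▷ edge A B .ver q') ⊗≫ 
        m A B .hor i (j.comp j') _ e ▷ edge A B .ver q' := by
      rw [h1]
      bicategory
    _ = _ := by
      rw [h2]
      bicategory

/-- Let `E` be a square with left edge `p` and bottom edge `j`. The path through `j` and `r` slides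
along `E` and then composes the right edge `b` with `r`; the path through `q` and `i` composes `p`
with `q` and then slides along the pasting of `E` on top of `D`. Both arrive at the same horizontal
and vertical edges, and the relation for vertical pasting compares the two routes. -/
theorem nat_sq (a : TPath A B X Y) {Y' Z : C} {j : A.Mor Y Y'} {q : B.Mor Y Z} {r : B.Mor Y' W}
    {i : A.Mor Z W} (D : Sq A B j q r i) :
    S.Nat (a := (a.cons (ver A q)).cons (hor B i)) (b := (a.cons (hor B j)).cons (ver A r))
      (Glue.cell (a := (a.hom ≫ edge A B .ver q) ≫ edge A B .hor i)
        ((α_ a.hom (edge A B .ver q) (edge A B .hor i)).hom ≫ a.hom ◁ sq D ≫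
          (α_ a.hom (edge A B .hor j) (edge A B .ver r)).inv))
      ((α_ a.eval q.val i.val).hom ≫ a.eval ◁ D.cell ≫ (α_ a.eval j.val r.val).inv) := by
  obtain ⟨M, i₀, p, α⟩ := S.comp a.eval
  obtain ⟨V, k, b, η⟩ := S.comp (p.val ≫ j.val)
  let E : Sq A B k p b j := ⟨η.inv⟩
  let α₁ : i₀.val ≫ (p.comp q).val ≅ a.eval ≫ q.val := (α_ _ _ _).symm ≪≫ whiskerRightIso α q.val
  have hα₁ : Same α₁.hom (α.hom ▷ q.val) := (triv_assoc_inv _ _ _).same_comp _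
  obtain ⟨β₁, hβ₁⟩ := exists_extH α E
  let β₂ : (i₀.comp k).val ≫ (b.comp r).val ≅ (a.eval ≫ j.val) ≫ r.val :=
    (α_ _ _ _).symm ≪≫ whiskerRightIso β₁ r.val
  have hβ₂ : Same β₂.hom (β₁.hom ▷ r.val) := (triv_assoc_inv _ _ _).same_comp _
  let s : (a.eval ≫ q.val) ≫ i.val ⟶ (a.eval ≫ j.val) ≫ r.val :=
    (α_ a.eval q.val i.val).hom ≫ a.eval ◁ D.cell ≫ (α_ a.eval j.val r.val).inv
  -- Defined from `β₂`, so that the two comparisons differ exactly by `s`, as `Nat.mk'` demands.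
  -- That `α₂` belongs to the extension by the pasted square then has to be proved.
  let α₂ : (i₀.comp k).val ≫ (b.comp r).val ≅ (a.eval ≫ q.val) ≫ i.val := β₂ ≪≫ (asIso s).symm
  have hα₂ : Same (i₀.val ◁ (E.vcomp D).cell ≫ (α_ i₀.val k.val (b.val ≫ r.val)).inv ≫ α₂.hom)
      (α₁.hom ▷ i.val) := by
    have h1 : i₀.val ◁ E.cell ≫ (α_ i₀.val k.val b.val).inv ≫ β₁.hom =
        (α_ i₀.val p.val j.val).inv ≫ α.hom ▷ j.val :=
      (hβ₁.trans ((triv_assoc_inv _ _ _).same_comp _).symm).eq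
    have h2 : i₀.val ◁ (E.vcomp D).cell ≫ (α_ i₀.val k.val (b.val ≫ r.val)).inv ≫ β₂.hom =
        ((α_ i₀.val (p.val ≫ q.val) i.val).inv ≫ α₁.hom ▷ i.val) ≫ s := by
      have h3 : β₂.hom = (α_ (i₀.val ≫ k.val) b.val r.val).inv ≫ β₁.hom ▷ r.val := rfl
      have h4 : α₁.hom = (α_ i₀.val p.val q.val).inv ≫ α.hom ▷ q.val := rfl
      have h5 : s = (α_ a.eval q.val i.val).hom ≫ a.eval ◁ D.cell ≫
        (α_ a.eval j.val r.val).inv := rfl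
      rw [h3, h4, h5]
      calc _ = 𝟙 _ ⊗≫ i₀.val ◁ p.val ◁ D.cell ⊗≫
            (i₀.val ◁ E.cell ≫ (α_ i₀.val k.val b.val).inv ≫ β₁.hom) ▷ r.val := by
            rw [Sq.vcomp]
            bicategory
        _ = 𝟙 _ ⊗≫ ((i₀.val ≫ p.val) ◁ D.cell ≫ α.hom ▷ (j.val ≫ r.val)) ⊗≫ 𝟙 _ := by
            rw [h1]
            bicategory
        _ = _ := by
            rw [whisker_exchange]
            bicategory
    have h3 : i₀.val ◁ (E.vcomp D).cell ≫ (α_ i₀.val k.val (b.val ≫ r.val)).inv ≫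
        β₂.hom ≫ inv s = (α_ i₀.val (p.val ≫ q.val) i.val).inv ≫ α₁.hom ▷ i.val := by
      have h4 := h2 =≫ inv s
      simp only [Category.assoc, IsIso.hom_inv_id, Category.comp_id] at h4
      exact h4
    exact (show Same (i₀.val ◁ (E.vcomp D).cell ≫ (α_ i₀.val k.val (b.val ≫ r.val)).inv ≫
      β₂.hom ≫ inv s) (α₁.hom ▷ i.val) by
        rw [h3]
        exact (triv_assoc_inv _ _ _).same_comp _)
  refine Nat.mk' α₂ β₂ ((Category.assoc _ _ _).trans
    ((congrArg _ (IsIso.inv_hom_id s)).trans (Category.comp_id _))).symm ?_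
  rw [S.norm_hor (a.cons (ver A q)) α₁ (E.vcomp D) rfl α₂ (triv_assoc_inv _ _ _) hα₂,
    S.norm_ver a α q rfl α₁ hα₁, S.norm_ver (a.cons (hor B j)) β₁ r rfl β₂ hβ₂,
    S.norm_hor a α E rfl β₁ (triv_assoc_inv _ _ _) hβ₁]
  refine Glue.square_whisker (a := a.hom) (S.norm a ⟨M, i₀, p, α⟩) (sq D) _ _ _ _ ?_
  have h2 := sq_vcomp E D (E.vcomp D) rfl rfl (Same.refl _)
  calc _ = 𝟙 _ ⊗≫ edge A B .hor i₀ ◁ ((α_ _ _ _).inv ≫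
        m A B .ver p q _ rfl ▷ edge A B .hor i ≫ sq (E.vcomp D)) ⊗≫
          m A B .hor i₀ k _ rfl ▷ edge A B .ver (b.comp r) := by bicategory
    _ = 𝟙 _ ⊗≫ edge A B .hor i₀ ◁ (edge A B .ver p ◁ sq D ≫ (α_ _ _ _).inv ≫
          sq E ▷ edge A B .ver r) ⊗≫
          ((edge A B .hor i₀ ≫ edge A B .hor k) ◁ m A B .ver b r _ rfl ≫
            m A B .hor i₀ k _ rfl ▷ edge A B .ver (b.comp r)) := by
      rw [← h2]
      bicategory
    _ = _ := by
      rw [whisker_exchange]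
      bicategory

end Canonical

/-! ### Naturality of the normalization with respect to all `2`-cells. -/

open Gen

namespace Canonical

variable {S : Canonical A B} {X Y Z W : C}

theorem Nat.congr {a b : TPath A B X Y}
    {w w' : Glue.mor (X := X) (Y := Y) a ⟶ Glue.mor (X := X) (Y := Y) b}
    {s s' : a.eval ⟶ b.eval} (h : S.Nat w s) (hw : w = w') (hs : s = s') : S.Nat w' s' := by
  subst hw hs
  exact h

theorem cell_whiskerLeft_inv (f : (TQ.mk X : TQ A B) ⟶ TQ.mk Y)
    {a b : (TQ.mk Y : TQ A B) ⟶ TQ.mk Z} {s : a ⟶ b} {t : b ⟶ a} (h : s ≫ t = 𝟙 _) :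
    Glue.cell (f ◁ s) ≫ Glue.cell (f ◁ t) = 𝟙 _ := by
  rw [← Glue.cell_comp, ← Bicategory.whiskerLeft_comp, h, Bicategory.whiskerLeft_id, Glue.cell_id]

theorem nat_iota (f : TPath A B X Y) (k : Dir) (σ : f.eval ⟶ f.eval ≫ ((side A B k).one Y).val)
    (hσ : Triv σ) :
    S.Nat (a := f) (b := f.cons ⟨k, (side A B k).one Y⟩)
      (Glue.cell (a := f.hom) (f.hom ◁ u A B k Y)) σ := by
  cases k with
  | hor =>
    exact (nat_u_hor f).congr (congrArg Glue.cell (Category.id_comp _))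
      ((triv_rightUnitor_inv _).eq hσ)
  | ver =>
    exact (nat_u_ver f).congr (congrArg Glue.cell (Category.id_comp _))
      ((triv_rightUnitor_inv _).eq hσ)

theorem nat_gamma (f : TPath A B X Y) {k : Dir} (h : (side A B k).Mor Y Z)
    (h' : (side A B k).Mor Z W)
    (σ : (f.eval ≫ h.val) ≫ h'.val ⟶ f.eval ≫ (h.comp h').val) (hσ : Triv σ) :
    S.Nat (a := (f.cons ⟨k, h⟩).cons ⟨k, h'⟩) (b := f.cons ⟨k, h.comp h'⟩)
      (Glue.cell (a := (f.hom ≫ edge A B k h) ≫ edge A B k h')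
        (f.hom ◁ m A B k h h' (h.comp h') rfl)) σ := by
  cases k with
  | hor =>
    exact (nat_m_hor f h h').congr (congrArg Glue.cell (Category.id_comp _))
      ((triv_assoc _ _ _).eq hσ)
  | ver =>
    exact (nat_m_ver f h h').congr (congrArg Glue.cell (Category.id_comp _))
      ((triv_assoc _ _ _).eq hσ)

/-- `theta` and `delta` are handled as inverses of `iota` and `gamma`. The image `σ` is given only
up to equalities of source and target, because the composite of a concatenated path is the composite
of the two composites by a propositional equality only. -/
theorem nat_gen (f : TPath A B X Y) {s t : TPath A B Y Z} (x : Gen A B s t)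
    (σ : (f.comp s).eval ⟶ (f.comp t).eval) (hσ : Same σ (f.eval ◁ x.eval)) :
    S.Nat (a := f.comp s) (b := f.comp t)
      (Glue.cell (a := (f.comp s).hom) (b := (f.comp t).hom) (f.hom ◁ (Trans.of x).toHom)) σ := by
  cases x with
  | iota k =>
    have hx : Triv (iota (A := A) (B := B) k Y).eval := triv_eqToHom (Strict.id_comp (𝟙 Y)).symm
    exact nat_iota f k σ ((hx.left _).of_same hσ)
  | theta k =>
    have hx : Triv (theta (A := A) (B := B) k Y).eval := triv_eqToHom (Strict.id_comp (𝟙 Y))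
    have hσ' : Triv σ := (hx.left _).of_same hσ
    exact (nat_iota f k _ (triv_eqToHom hσ'.choose.symm)).symm
      (cell_whiskerLeft_inv f (v_u k Y)) ((hσ'.comp (triv_eqToHom _)).eq (triv_id _))
  | gamma h h' h'' e =>
    subst e
    have hx : Triv (gamma (A := A) (B := B) h h' _ rfl).eval :=
      triv_eqToHom (Strict.assoc (𝟙 Y) h.val h'.val)
    exact nat_gamma f h h' σ ((hx.left _).of_same hσ)
  | delta h h' h'' e =>
    subst e
    have hx : Triv (delta (A := A) (B := B) h h' _ rfl).eval :=
      triv_eqToHom (Strict.assoc (𝟙 Y) h.val h'.val).symm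
    have hσ' : Triv σ := (hx.left _).of_same hσ
    exact (nat_gamma f h h' _ (triv_eqToHom hσ'.choose.symm)).symm
      (cell_whiskerLeft_inv f (toHom_of_rel (.delta_gamma h h')))
      ((hσ'.comp (triv_eqToHom _)).eq (triv_id _))
  | sigma D =>
    refine (nat_sq f D).congr (congrArg Glue.cell ((Category.id_comp _).trans (Category.comp_id _)))
      (Same.eq ?_)
    refine Same.trans ?_ hσ.symm
    refine ((triv_assoc _ _ _).same_comp _).trans (((triv_assoc_inv _ _ _).comp_same _).trans ?_)
    exact (Gen.same_sigma D).symm.left rfl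

/-- The initial path is already arbitrary in `nat_gen`, so an induction on the final path suffices,
with `Nat.whisker` adding one edge at a time. -/
theorem nat_context (f : TPath A B X Y) {s t : TPath A B Y Z} (x : Gen A B s t)
    (g : TPath A B Z W) (σ : (f.comp (s.comp g)).eval ⟶ (f.comp (t.comp g)).eval)
    (hσ : Same σ (f.eval ◁ x.eval ▷ g.eval)) :
    S.Nat (Glue.cell (a := (f.comp (s.comp g)).hom) (b := (f.comp (t.comp g)).hom)
      (Trans.refl.tail ⟨f, x, g, rfl, rfl⟩).toHom) σ := by
  induction g with
  | nil => exact nat_gen f x σ (hσ.trans ((same_right_id _).left rfl))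
  | cons g e ih =>
    have h := (ih (Atom.mk f x g rfl rfl).eval (Atom.same_eval _)).whisker e
    refine h.congr rfl (Same.eq ?_)
    refine ((Atom.same_eval _).right rfl).trans (Same.trans ?_ hσ.symm)
    exact (same_mid _ _ _).trans (((same_right_comp _ _ _).symm).left rfl)

theorem nat_atom {a b : TPath A B X Y} (x : Atom a b) :
    S.Nat (Glue.cell (a := a.hom) (b := b.hom) (Trans.refl.tail x).toHom) x.eval := by
  obtain ⟨f, x, g, rfl, rfl⟩ := x
  exact nat_context f x g _ (Atom.same_eval _)

theorem nat_trans {a b : TPath A B X Y} (x : Trans a b) :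
    S.Nat (Glue.cell (a := a.hom) (b := b.hom) x.toHom) x.eval := by
  induction x with
  | refl => exact (Nat.id a).congr (Glue.cell_id a.hom).symm rfl
  | tail t x ih =>
    exact (ih.comp (nat_atom x)).congr
      ((Glue.cell_comp _ _).symm.trans (congrArg Glue.cell (toHom_tail t x).symm)) rfl

theorem nat_cell {a b : TPath A B X Y} (s : a.hom ⟶ b.hom) :
    S.Nat (Glue.cell s) (evalCell s) := by
  obtain ⟨s⟩ := s
  exact nat_trans s

end Canonical

/-! ### Images of `2`-cells in the base -/

section Eval

variable {X Y Z : C}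

theorem evalCell_comp {a b c : (TQ.mk X : TQ A B) ⟶ TQ.mk Y} (s : a ⟶ b) (t : b ⟶ c) :
    evalCell (s ≫ t) = evalCell s ≫ evalCell t := by
  obtain ⟨s⟩ := s
  obtain ⟨t⟩ := t
  exact Trans.eval_trans s t

theorem same_evalCell_whiskerLeft (f : (TQ.mk X : TQ A B) ⟶ TQ.mk Y)
    {a b : (TQ.mk Y : TQ A B) ⟶ TQ.mk Z} (s : a ⟶ b) :
    Same (evalCell (f ◁ s)) (TPath.eval f ◁ evalCell s) := by
  obtain ⟨s⟩ := s
  exact Trans.same_whiskerL f s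

theorem same_evalCell_whiskerRight {a b : (TQ.mk X : TQ A B) ⟶ TQ.mk Y} (s : a ⟶ b)
    (f : (TQ.mk Y : TQ A B) ⟶ TQ.mk Z) :
    Same (evalCell (s ▷ f)) (evalCell s ▷ TPath.eval f) := by
  obtain ⟨s⟩ := s
  exact Trans.same_whiskerR s f

theorem triv_evalCell_eqToHom {a b : (TQ.mk X : TQ A B) ⟶ TQ.mk Y} (h : a = b) :
    Triv (evalCell (eqToHom h)) := by
  subst h
  exact triv_id _

theorem same_evalCell_sq {Z' : C} {j : A.Mor X Y} {q : B.Mor X Z} {p : B.Mor Y Z'}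
    {i : A.Mor Z Z'} (D : Sq A B j q p i) : Same (evalCell (sq D)) D.cell :=
  (Trans.same_of _).trans (Gen.same_sigma D)

theorem same_evalCell_verCell {p p' : B.Mor X Y} (δ : p.val ⟶ p'.val) :
    Same (evalCell (verCell A δ)) δ := by
  have h1 : Triv (evalCell (ρ_ (edge A B .ver p)).inv) :=
    triv_evalCell_eqToHom (Strict.comp_id _).symm
  have h2 : Triv (evalCell (edge A B .ver p ◁ u A B .hor Y)) :=
    ((Trans.triv_iota .hor Y).left _).of_same (same_evalCell_whiskerLeft _ _)
  have h3 : Triv (evalCell (v A B .hor X ▷ edge A B .ver p')) :=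
    ((Trans.triv_theta .hor X).right _).of_same (same_evalCell_whiskerRight _ _)
  have h4 : Triv (evalCell (λ_ (edge A B .ver p')).hom) :=
    triv_evalCell_eqToHom (Strict.id_comp _)
  rw [verCell, evalCell_comp, evalCell_comp, evalCell_comp, evalCell_comp]
  refine (h1.same_comp _).trans ((h2.same_comp _).trans (((h3.comp h4).comp_same _).trans ?_))
  exact (same_evalCell_sq _).trans (same_sqOf δ)

namespace Comp

variable {f : X ⟶ Y}

theorem Hom.same_evalCell_cellA {κ l : Comp A B B f} (s : Hom κ l) :
    Same (evalCell s.cellA) (inv s.γ) := by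
  have h1 : Triv (evalCell (λ_ (edge A B .hor l.i)).inv) :=
    triv_evalCell_eqToHom (Strict.id_comp _).symm
  have h2 : Triv (evalCell (u A B .ver X ▷ edge A B .hor l.i)) :=
    ((Trans.triv_iota .ver X).right _).of_same (same_evalCell_whiskerRight _ _)
  rw [Hom.cellA, evalCell_comp, evalCell_comp]
  refine (h1.same_comp _).trans ((h2.same_comp _).trans ((same_evalCell_sq _).trans ?_))
  exact (triv_leftUnitor _).same_comp _

theorem Hom.same_evalCell_cellB {κ l : Comp A B B f} (s : Hom κ l) :
    Same (evalCell s.cellB) s.δ := by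
  have h1 : Triv (evalCell (m A B .ver s.r l.p (s.r.comp l.p) rfl)) := Trans.triv_gamma _ _ _ _
  rw [Hom.cellB, evalCell_comp]
  exact (h1.same_comp _).trans (same_evalCell_verCell (p := s.r.comp l.p) (p' := κ.p) s.δ)

theorem Hom.same_evalCell_pathCell {κ l : Comp A B B f} (s : Hom κ l) :
    Same (evalCell s.pathCell)
      (inv s.γ ▷ l.p.val ≫ (α_ κ.i.val s.r.val l.p.val).hom ≫ κ.i.val ◁ s.δ) := by
  have h1 := (same_evalCell_whiskerRight s.cellA (edge A B .ver l.p)).trans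
    (s.same_evalCell_cellA.right (TPath.eval_single _))
  have h2 : Triv (evalCell (α_ (edge A B .hor κ.i) (edge A B .ver s.r) (edge A B .ver l.p)).hom) :=
    triv_evalCell_eqToHom (Strict.assoc _ _ _)
  have h3 := (same_evalCell_whiskerLeft (edge A B .hor κ.i) s.cellB).trans
    (s.same_evalCell_cellB.left (TPath.eval_single _))
  rw [Hom.pathCell, evalCell_comp, evalCell_comp]
  exact h1.comp (((h2.same_comp _).trans h3).trans ((triv_assoc _ _ _).same_comp _).symm)

/-- The `2`-cell of a compactification, as a `2`-cell whose source is the image of its path. -/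
def ev (κ : Comp A B B f) : TPath.eval κ.path ⟶ f := (λ_ κ.i.val).hom ▷ κ.p.val ≫ κ.α.hom

theorem same_ev (κ : Comp A B B f) : Same κ.ev κ.α.hom :=
  ((triv_leftUnitor _).right _).same_comp _

/-- In `C`, the `2`-cell of a morphism of compactifications becomes `γ⁻¹` followed by `δ`, and the
condition `comm` says exactly that this respects the `2`-cells to `f`. -/
theorem Hom.evalCell_pathCell {κ l : Comp A B B f} (s : Hom κ l) :
    evalCell s.pathCell ≫ κ.ev = l.ev := by
  refine Same.eq ((s.same_evalCell_pathCell.comp κ.same_ev).trans (Same.trans ?_ l.same_ev.symm))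
  have h : (inv s.γ ▷ l.p.val ≫ (α_ κ.i.val s.r.val l.p.val).hom ≫ κ.i.val ◁ s.δ) ≫ κ.α.hom =
      l.α.hom := by
    have h1 := s.comm
    have h2 : inv s.γ ▷ l.p.val ≫ s.γ ▷ l.p.val = 𝟙 _ := by
      rw [← comp_whiskerRight]
      simp
    simp only [Category.assoc]
    rw [h1, Iso.hom_inv_id_assoc, reassoc_of% h2]
  rw [h]
  exact Same.refl _

end Comp

end Eval

/-! ### The inverse of the functors on the categories of morphisms -/

/-- The image in `C` of a `2`-cell of `Glue A B`. -/
noncomputable def Glue.eval {X Y : C} {a b : (TQ.mk X : TQ A B) ⟶ TQ.mk Y}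
    (s : Glue.mor a ⟶ Glue.mor b) : TPath.eval a ⟶ TPath.eval b :=
  (Glue.homFunctor A B X Y).map s

theorem Glue.eval_id {X Y : C} (a : (TQ.mk X : TQ A B) ⟶ TQ.mk Y) :
    Glue.eval (𝟙 (Glue.mor a)) = 𝟙 (TPath.eval a) :=
  (Glue.homFunctor A B X Y).map_id (Glue.mor a)

theorem Glue.eval_comp {X Y : C} {a b c : (TQ.mk X : TQ A B) ⟶ TQ.mk Y}
    (s : Glue.mor a ⟶ Glue.mor b) (t : Glue.mor b ⟶ Glue.mor c) :
    Glue.eval (s ≫ t) = Glue.eval s ≫ Glue.eval t :=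
  (Glue.homFunctor A B X Y).map_comp s t

theorem Glue.eval_cell {X Y : C} {a b : (TQ.mk X : TQ A B) ⟶ TQ.mk Y} (s : a ⟶ b) :
    Glue.eval (Glue.cell s) = evalCell s :=
  liftHom_of (evalFunctor A B).toPseudofunctor s

namespace Canonical

variable (S : Canonical A B) (X Y : C)

/-- The functor that sends a morphism of `C` to the chosen compactification. -/
noncomputable def functor : (X ⟶ Y) ⥤ (Glue.of A B X ⟶ Glue.of A B Y) where
  obj f := (S.comp f).gpath
  map {f g} σ := S.cell ((S.comp f).push σ) (S.comp g)
  map_id f := by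
    generalize S.comp f = κ
    obtain ⟨M, i, p, α⟩ := κ
    have h : ∀ β : i.val ≫ p.val ≅ f, β = α →
        S.cell ⟨M, i, p, β⟩ ⟨M, i, p, α⟩ = 𝟙 (Comp.mk M i p α).gpath := by
      rintro _ rfl
      exact S.cell_self _
    exact h _ (Iso.ext (Category.comp_id α.hom))
  map_comp {f g h} σ τ := by
    have e : S.cell ((S.comp f).push (σ ≫ τ)) ((S.comp g).push τ) =
        S.cell ((S.comp f).push σ) (S.comp g) :=
      S.cell_push' τ (by simp) rfl
    exact (S.cell_comp _ ((S.comp g).push τ) _).symm.trans (congrArg (fun x => x ≫ _) e)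

variable {X Y}

/-- For one morphism of compactifications this is `Hom.evalCell_pathCell`, and it propagates along
zigzags. It says that `E` followed by the comparison with `f` does not see canonical isomorphisms.
-/
theorem eval_cell {f : X ⟶ Y} (κ l : Comp A B B f) : Glue.eval (S.cell κ l) ≫ l.ev = κ.ev := by
  refine S.cell_induction (fun κ l x => Glue.eval x ≫ l.ev = κ.ev) ?_ ?_ ?_ ?_ κ l
  · intro κ l s
    rw [Glue.eval_cell]
    exact s.evalCell_pathCell
  · intro κ
    rw [Glue.eval_id, Category.id_comp]
  · intro κ l x y _ hy hx
    rw [← hx, ← Category.assoc, ← Glue.eval_comp, hy, Glue.eval_id, Category.id_comp]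
  · intro κ l m x y hx hy
    rw [Glue.eval_comp, ← hx, ← hy, Category.assoc]

/-- By `eval_cell`, the image under `E` of the value at `σ` determines the composite of `ev` with
`σ`, and `ev` is invertible. -/
theorem functor_map_injective {f g : X ⟶ Y} {σ τ : f ⟶ g}
    (h : (S.functor X Y).map σ = (S.functor X Y).map τ) : σ = τ := by
  have h₁ := S.eval_cell ((S.comp f).push σ) (S.comp g)
  have h₂ := S.eval_cell ((S.comp f).push τ) (S.comp g)
  have h₃ : ((S.comp f).push σ).ev = ((S.comp f).push τ).ev :=
    h₁.symm.trans ((congrArg (fun x => Glue.eval x ≫ (S.comp g).ev) h).trans h₂)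
  have h₄ : ∀ ρ : f ⟶ g, ((S.comp f).push ρ).ev = (S.comp f).ev ≫ ρ := fun ρ =>
    (Category.assoc _ _ _).symm
  rw [h₄, h₄] at h₃
  exact (cancel_epi _).1 h₃

/-- `nat_cell` is used for the compactification chosen for `a.eval` and its push along the image of
`s`, which have the same path. The canonical `2`-cell from the latter to the compactification chosen
for `b.eval` is the value of `functor`. -/
theorem natural_cell {a b : TPath A B X Y} (s : a.hom ⟶ b.hom) :
    Glue.cell s ≫ S.norm b (S.comp b.eval) =
      S.norm a (S.comp a.eval) ≫ (S.functor X Y).map (X := a.eval) (Y := b.eval) (evalCell s) := by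
  let κ := (S.comp a.eval).push (f' := b.eval) (evalCell s)
  have h₁ := S.norm_cell b κ (S.comp b.eval)
  have h₂ : S.norm a (S.comp a.eval) = Glue.cell s ≫ S.norm b κ :=
    nat_cell s _ _ (S.comp a.eval).α κ.α rfl
  rw [h₂, ← h₁]
  exact (Category.assoc _ _ _).symm

variable (A B X Y) in
/-- The morphisms of `Glue A B`, as those of a free groupoid. -/
def toLoc : FreeGroupoid ((TQ.mk X : TQ A B) ⟶ TQ.mk Y) ⥤ (Glue.of A B X ⟶ Glue.of A B Y) where
  obj x := ⟨x.as.as⟩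
  map s := s

/-- Formal inverses come for free: a family natural for the morphisms of a category is natural for
those of its free groupoid. Thus the normalizations form an isomorphism from the identity of `E(X,
Y)` to `Φ E`, where `Φ` is `functor`. -/
theorem natural {a b : (TQ.mk X : TQ A B) ⟶ TQ.mk Y} (x : Glue.mor a ⟶ Glue.mor b) :
    x ≫ S.norm b (S.comp (TPath.eval b)) =
      S.norm a (S.comp (TPath.eval a)) ≫ (S.functor X Y).map (Glue.eval x) :=
  natural_of_locOf (toLoc A B X Y)
    (liftHom (evalFunctor A B).toPseudofunctor (TQ.mk X) (TQ.mk Y) ⋙ S.functor X Y)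
    (fun a => S.norm a (S.comp (TPath.eval a)))
    (fun s => (S.natural_cell s).trans (congrArg (fun y => _ ≫ (S.functor X Y).map y)
      (Glue.eval_cell s).symm)) x

/-- By naturality, `x` is recovered from its image in `C` by conjugation with normalizations, which
are invertible. -/
theorem eval_injective (S : Canonical A B) {a b : (TQ.mk X : TQ A B) ⟶ TQ.mk Y}
    {x y : Glue.mor a ⟶ Glue.mor b} (h : Glue.eval x = Glue.eval y) : x = y := by
  have hx := S.natural x
  rw [h, ← S.natural y] at hx
  have : IsIso (S.norm b (S.comp (TPath.eval b))) := IsGroupoid.all_isIso _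
  exact (cancel_mono (S.norm b (S.comp (TPath.eval b)))).1 hx

/-- Conjugating `Φ(s)` by the normalizations gives `x` with `Φ(E(x)) = Φ(s)`, by naturality; then
`E(x) = s` because `Φ` is faithful. -/
theorem eval_surjective (S : Canonical A B) {a b : (TQ.mk X : TQ A B) ⟶ TQ.mk Y}
    (s : TPath.eval a ⟶ TPath.eval b) : ∃ x : Glue.mor a ⟶ Glue.mor b, Glue.eval x = s := by
  let n : Glue.mor a ⟶ (S.comp (TPath.eval a)).gpath := S.norm a (S.comp (TPath.eval a))
  let m : Glue.mor b ⟶ (S.comp (TPath.eval b)).gpath := S.norm b (S.comp (TPath.eval b))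
  have : IsIso n := IsGroupoid.all_isIso n
  have : IsIso m := IsGroupoid.all_isIso m
  let t : (S.comp (TPath.eval a)).gpath ⟶ (S.comp (TPath.eval b)).gpath := (S.functor X Y).map s
  have h := S.natural (n ≫ t ≫ inv m)
  refine ⟨n ≫ t ≫ inv m, S.functor_map_injective ((cancel_epi n).1 (h.symm.trans ?_))⟩
  exact (Category.assoc n _ m).trans (congrArg (fun y => n ≫ y)
    ((Category.assoc t _ m).trans ((congrArg (fun y => t ≫ y) (IsIso.inv_hom_id m)).trans
      (Category.comp_id t))))

theorem isEquivalence_homFunctor (S : Canonical A B) (X Y : C) :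
    (Glue.homFunctor A B X Y).IsEquivalence where
  faithful := ⟨fun h => S.eval_injective h⟩
  full := ⟨fun s => S.eval_surjective s⟩
  -- The composite of the path `p * i` begins with an identity, removed by the left unitor; then `α`
  -- leads to `f`.
  essSurj := ⟨fun f => ⟨(S.comp f).gpath,
    ⟨whiskerRightIso (λ_ (S.comp f).i.val) (S.comp f).p.val ≪≫ (S.comp f).α⟩⟩⟩

end Canonical
end Gluing

/-- Let `C` be a `(2,1)`-category and let `A`, `B` be arrowy `2`-subcategories of `C`. If every
morphism `f` of `C` has a compactification `κ` at which the functor `compFunctor A B f` induces a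
homomorphism of fundamental groups with trivial image, and if the `2`-category of compactifications
of every pair of composable morphisms is connected, then `Glue A B → C` is a `2`-equivalence. -/
theorem theoremt {C : Type u} [Bicategory.{w, v} C] [Bicategory.Strict C]
    [Bicategory.IsLocallyGroupoid C] (A B : Gluing.Arrowy C)
    (hπ : ∀ (X Y : C) (f : X ⟶ Y), ∃ κ : Gluing.Comp A B B f,
      (Gluing.FundGroup.map (Gluing.compFunctor A B f) ⟨κ⟩).range = ⊥)
    (hconn : ∀ (X Y Z : C) (f : X ⟶ Y) (g : Y ⟶ Z), Gluing.Comp₂.Connected A B B f g) :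
    Gluing.IsTwoEquivalence (Gluing.Glue.toBase A B).toPseudofunctor := by
  obtain ⟨S⟩ := Gluing.nonempty_canonical hπ
    fun κ l => Gluing.Comp.linked_of_connected (hconn _ _ _ _ (𝟙 _)) κ l
  have : ∀ X Y, (Gluing.Glue.homFunctor A B X Y).IsEquivalence := S.isEquivalence_homFunctor
  exact Gluing.Glue.isTwoEquivalence_of_locally A B
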